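/- Let $M$ be a closed smooth 3-manifold and let $\pi:M\to B$ be a fixed Seifert fibering: $B$ has the quotient topology, and each fiber has a saturated neighborhood which is fiber-preservingly diffeomorphic to the quotient of $S^1\times D^2$ (fibered by the circles $S^1\times\{z\}$, with the given fiber as core), where $S^1=\mathbb{R}/\mathbb{Z}$ and $D^2\subset\mathbb{C}$ is the open unit disk, by the free $\mathbb{Z}/m$-action generated by $(t,z)\mapsto(t+\tfrac1m,e^{2\pi i k/m}z)$ for some $m\ge 1$ and $k$ with $\gcd(k,m)=1$; the fiber is singular if $m\ge2$. A contact structure $\xi$ on $M$ (a plane field that is locally the kernel of a smooth 1-form $\alpha$ with $\alpha\wedge d\alpha$ nowhere zero) that is transverse to the fibers is called $S^1$-invariant if there is a global contact form $\alpha$ with $\ker\alpha=\xi$, with Reeb vector field $R$ (i.e. $\alpha(R)=1$, $d\alpha(R,\cdot)=0$), such that (i) each fiber of $\pi$ is an orbit of $R$, and (ii) each singular fiber, of multiplicity $m$ say, has a neighborhood that is a $\mathbb{Z}/m$-quotient of $S^1\times D^2$ as above (with $S^1=\mathbb{R}/T\mathbb{Z}$ for some $T>0$, and translation by $T/m$)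 on which $\alpha$ lifts to $dt+\beta$ and $R$ to $\partial/\partial t$, where $t$ is the coordinate on $S^1$ and $\beta$ is a rotationally invariant smooth 1-form on $D^2$, independent of $t$, such that $d\beta$ is an area form on $D^2$. Then any two $S^1$-invariant contact structures $\xi,\xi'$ on $M$ transverse to the fibers are isotopic: there is a smooth isotopy $(\Phi_s)$ of diffeomorphisms of $M$ with $\Phi_0=\mathrm{id}_M$ and $(\Phi_1)_*\xi=\xi'$. -/

import Mathlib

open scoped Manifold ContDiff Topology

noncomputable section

/-! ### Differential 1-forms and contact structures on 3-manifolds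

Throughout, a 3-manifold is a space charted on `EuclideanSpace ℝ (Fin 3)`, with model `𝓡 3`
(so without boundary). A 1-form assigns to each point a linear functional on the tangent space. -/

/-- Exterior derivative of a 1-form `β` on a normed space:
`dβ_y (u, v) = (D_u β)(v) - (D_v β)(u)`. -/
def flatD {E : Type*} [NormedAddCommGroup E] [NormedSpace ℝ E]
    (β : E → E →L[ℝ] ℝ) (y u v : E) : ℝ :=
  fderiv ℝ β y u v - fderiv ℝ β y v u

section Manifold

variable {M : Type*} [TopologicalSpace M] [ChartedSpace (EuclideanSpace ℝ (Fin 3)) M]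

/-- The coordinate expression of a 1-form in the preferred chart around `c`, that is, its
pullback under the inverse of the chart. -/
def oneFormInChart (α : (x : M) → TangentSpace (𝓡 3) x →L[ℝ] ℝ) (c : M) :
    EuclideanSpace ℝ (Fin 3) → EuclideanSpace ℝ (Fin 3) →L[ℝ] ℝ :=
  fun y => (α ((extChartAt (𝓡 3) c).symm y)).comp
    (mfderiv 𝓘(ℝ, EuclideanSpace ℝ (Fin 3)) (𝓡 3) (extChartAt (𝓡 3) c).symm y)

/-- The exterior derivative `dα` of a 1-form on `M`: the exterior derivative of the coordinate
expression at `x`, pulled back by the differential of the chart at `x`. -/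
def oneFormD (α : (x : M) → TangentSpace (𝓡 3) x →L[ℝ] ℝ) (x : M)
    (u v : TangentSpace (𝓡 3) x) : ℝ :=
  flatD (oneFormInChart α x) (extChartAt (𝓡 3) x x)
    (mfderiv (𝓡 3) 𝓘(ℝ, EuclideanSpace ℝ (Fin 3)) (extChartAt (𝓡 3) x) x u)
    (mfderiv (𝓡 3) 𝓘(ℝ, EuclideanSpace ℝ (Fin 3)) (extChartAt (𝓡 3) x) x v)

/-- The value of the 3-form `α ∧ dα` on three tangent vectors. -/
def wedgeD (α : (x : M) → TangentSpace (𝓡 3) x →L[ℝ] ℝ) (x : M)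
    (u v w : TangentSpace (𝓡 3) x) : ℝ :=
  α x u * oneFormD α x v w + α x v * oneFormD α x w u + α x w * oneFormD α x u v

/-- `α` is a contact form on the open set `U`: it is smooth on `U` and `α ∧ dα` vanishes nowhere
on `U`. -/
structure IsContactFormOn [IsManifold (𝓡 3) ∞ M]
    (α : (x : M) → TangentSpace (𝓡 3) x →L[ℝ] ℝ) (U : Set M) : Prop where
  smooth : ContMDiffOn (𝓡 3) ((𝓡 3).prod 𝓘(ℝ, EuclideanSpace ℝ (Fin 3) →L[ℝ] ℝ)) ∞
    (fun x => Bundle.TotalSpace.mk' (EuclideanSpace ℝ (Fin 3) →L[ℝ] ℝ)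
      (E := fun x : M => TangentSpace (𝓡 3) x →L[ℝ] Bundle.Trivial M ℝ x) x (α x)) U
  wedge_ne_zero : ∀ x ∈ U, ∃ u v w : TangentSpace (𝓡 3) x, wedgeD α x u v w ≠ 0

/-- A plane field is a contact structure if it is locally the kernel of a contact form. -/
def IsContactStructure [IsManifold (𝓡 3) ∞ M]
    (ξ : (x : M) → Submodule ℝ (TangentSpace (𝓡 3) x)) : Prop :=
  ∀ x : M, ∃ U : Set M, IsOpen U ∧ x ∈ U ∧
    ∃ α : (x : M) → TangentSpace (𝓡 3) x →L[ℝ] ℝ,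
      IsContactFormOn α U ∧ ∀ y ∈ U, ∀ v : TangentSpace (𝓡 3) y, v ∈ ξ y ↔ α y v = 0

/-- `R` is the Reeb vector field of the 1-form `α`: `α(R) = 1` and `dα(R, ·) = 0`. -/
structure IsReebField (α : (x : M) → TangentSpace (𝓡 3) x →L[ℝ] ℝ)
    (R : (x : M) → TangentSpace (𝓡 3) x) : Prop where
  apply_eq_one : ∀ x, α x (R x) = 1
  d_eq_zero : ∀ x, ∀ v : TangentSpace (𝓡 3) x, oneFormD α x (R x) v = 0

/-- Two plane fields are isotopic if there is a smooth ambient isotopy `Φ`, starting at the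
identity, whose time-one map carries `ξ` to `ξ'`. -/
def AreIsotopic (ξ ξ' : (x : M) → Submodule ℝ (TangentSpace (𝓡 3) x)) : Prop :=
  ∃ Φ : ℝ → (M ≃ₘ⟮𝓡 3, 𝓡 3⟯ M),
    ContMDiff (𝓘(ℝ, ℝ).prod (𝓡 3)) (𝓡 3) ∞ (fun p : ℝ × M => Φ p.1 p.2) ∧
    (∀ x, Φ 0 x = x) ∧
    ∀ x, (ξ x).map (mfderiv (𝓡 3) (𝓡 3) (Φ 1) x).toLinearMap = ξ' (Φ 1 x)

/-! ### Seifert fiberings -/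

variable {B : Type*}

/-- `q` presents a neighbourhood of the fiber of `π` over `b` as a fibered solid torus of type
`(m, k)`, i.e. as the quotient of `S¹ × D²` by the free `ℤ/m`-action generated by
`(t, z) ↦ (t + T/m, e^{2πik/m} z)`, where `S¹ = ℝ/Tℤ` and `D²` is the open unit disk in `ℂ`.
The map `q` is written on the cover `ℝ × D²` of `S¹ × D²` (its values at `(t, z)` with `z` outside
the disk are irrelevant). The fibers of `π` near `b` are the images of the circles
`S¹ × {z}`, and the fiber over `b` is the image of `S¹ × {0}`. -/
structure IsFiberedSolidTorus (π : M → B) (b : B) (m k : ℕ) (T : ℝ) (q : ℝ × ℂ → M) :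
    Prop where
  m_pos : 0 < m
  coprime : Nat.Coprime k m
  T_pos : 0 < T
  localDiffeo : IsLocalDiffeomorphOn 𝓘(ℝ, ℝ × ℂ) (𝓡 3) ∞ q
    (Set.univ ×ˢ Metric.ball (0 : ℂ) 1)
  eq_iff : ∀ t t' : ℝ, ∀ z ∈ Metric.ball (0 : ℂ) 1, ∀ z' ∈ Metric.ball (0 : ℂ) 1,
    q (t, z) = q (t', z') ↔ ∃ j : ℤ, t' = t + j * (T / m) ∧
      z' = Complex.exp (2 * Real.pi * Complex.I * (k / m) * j) * z
  fiber_eq : ∀ t : ℝ, ∀ z ∈ Metric.ball (0 : ℂ) 1,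
    π ⁻¹' {π (q (t, z))} = Set.range (fun s : ℝ => q (s, z))
  center : π (q (0, 0)) = b

/-- `π : M → B` is a Seifert fibering: `B` carries the quotient topology, and each fiber has a
neighbourhood that is a fibered solid torus around it. -/
structure IsSeifertFibering [TopologicalSpace B] (π : M → B) : Prop where
  isQuotientMap : Topology.IsQuotientMap π
  locally_fibered : ∀ b : B, ∃ (m k : ℕ) (q : ℝ × ℂ → M), IsFiberedSolidTorus π b m k 1 q

/-- The fiber over `b` has multiplicity `m`; it is a singular fiber if `m ≥ 2`. -/
def HasMultiplicity (π : M → B) (b : B) (m : ℕ) : Prop :=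
  ∃ (k : ℕ) (q : ℝ × ℂ → M), IsFiberedSolidTorus π b m k 1 q

/-- The plane field `ξ` is transverse to the fibers of `π`: in fibered solid tori, the tangent
vector `∂/∂t` of the fiber never lies in `ξ`. -/
def IsTransverseToFibers (π : M → B) (ξ : (x : M) → Submodule ℝ (TangentSpace (𝓡 3) x)) :
    Prop :=
  ∀ (b : B) (m k : ℕ) (T : ℝ) (q : ℝ × ℂ → M), IsFiberedSolidTorus π b m k T q →
    ∀ t : ℝ, ∀ z ∈ Metric.ball (0 : ℂ) 1,
      mfderiv 𝓘(ℝ, ℝ × ℂ) (𝓡 3) q (t, z) ((1, 0) : ℝ × ℂ) ∉ ξ (q (t, z))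

/-- Standard form of `(α, R)` near the fiber over `b` of multiplicity `m`: some neighbourhood is a
`ℤ/m`-quotient of `S¹ × D²` on which `α` pulls back to `dt + β` and `R` to `∂/∂t`, where `β` is a
smooth 1-form on `D²` (so independent of `t`), invariant under rotations, such that `dβ` is
an area form. -/
def HasStandardForm (π : M → B) (b : B) (m : ℕ)
    (α : (x : M) → TangentSpace (𝓡 3) x →L[ℝ] ℝ) (R : (x : M) → TangentSpace (𝓡 3) x) : Prop :=
  ∃ (k : ℕ) (T : ℝ) (q : ℝ × ℂ → M) (β : ℂ → ℂ →L[ℝ] ℝ),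
    IsFiberedSolidTorus π b m k T q ∧
    ContDiffOn ℝ ∞ β (Metric.ball (0 : ℂ) 1) ∧
    (∀ z ∈ Metric.ball (0 : ℂ) 1, ∀ u : ℂ, ‖u‖ = 1 → ∀ w : ℂ, β (u * z) (u * w) = β z w) ∧
    (∀ z ∈ Metric.ball (0 : ℂ) 1, flatD β z 1 Complex.I ≠ 0) ∧
    ∀ t : ℝ, ∀ z ∈ Metric.ball (0 : ℂ) 1,
      (∀ (a : ℝ) (w : ℂ),
        α (q (t, z)) (mfderiv 𝓘(ℝ, ℝ × ℂ) (𝓡 3) q (t, z) ((a, w) : ℝ × ℂ)) = a + β z w) ∧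
      mfderiv 𝓘(ℝ, ℝ × ℂ) (𝓡 3) q (t, z) ((1, 0) : ℝ × ℂ) = R (q (t, z))

/-- `ξ` is `S¹`-invariant for the fibering `π`: it has a global contact form `α` whose Reeb vector
field `R` has each fiber of `π` as an orbit, and `α`, `R` have the standard form near each singular
fiber. -/
def IsS1Invariant [IsManifold (𝓡 3) ∞ M] (π : M → B)
    (ξ : (x : M) → Submodule ℝ (TangentSpace (𝓡 3) x)) : Prop :=
  ∃ (α : (x : M) → TangentSpace (𝓡 3) x →L[ℝ] ℝ) (R : (x : M) → TangentSpace (𝓡 3) x),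
    IsContactFormOn α Set.univ ∧
    (∀ x, ∀ v : TangentSpace (𝓡 3) x, v ∈ ξ x ↔ α x v = 0) ∧
    IsReebField α R ∧
    (∀ x, ∃ γ : ℝ → M, IsMIntegralCurve γ R ∧ γ 0 = x ∧ Set.range γ = π ⁻¹' {π x}) ∧
    ∀ (b : B) (m : ℕ), 2 ≤ m → HasMultiplicity π b m → HasStandardForm π b m α R

end Manifold

end

/-! Write the two structures as kernels of contact forms α and β with Reeb fields R and R'. Both
fields are tangent to the fibers, hence parallel. The line ker dα is spanned by R and ker dβ by R',
so pointwise (α ∧ dβ)(β ∧ dα) = (α ∧ dα)(β ∧ dβ), each factor being measured against a fixed volume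
element (`wedgeAt_mul_of_parallel`). In particular neither mixed product vanishes anywhere.

After a change of sign of β on a clopen set, which does not affect its kernel, β ∧ dα has the sign
of α ∧ dα. The sign of α ∧ dβ is then forced by Stokes: d(α ∧ β) = dα ∧ β - α ∧ dβ, so on the clopen
set where α ∧ dβ has the opposite sign this exact form is strictly positive relative to α ∧ dα. Its
integral over that closed manifold is zero, so the set is empty (`exactDensity_eq_zero_of_nonneg`,
`wedgeAt_div_pos`). By the product identity β ∧ dβ then has the sign of α ∧ dα too.

Hence every (1 - r) α + r β with 0 ≤ r ≤ 1 is a contact form (`exists_segmentContact`), and Gray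
stability along this segment yields the isotopy (`exists_isotopy_of_segmentContact`).

The analytic tools are built along the way: smooth flows by the inverse function theorem on a space
of curves, isotopies generated by time-dependent fields on a closed manifold, and Stokes' theorem
for densities, which needs no orientation. Forms on three-space are handled by vector calculus: a
two-form κ is represented by the vector `twoFormVec κ`, a ∧ b by the cross product, and a ∧ κ by the
number a (`twoFormVec κ`). -/

section

open Set Filter MeasureTheory

/-! ### Smoothness of composition operators on spaces of continuous maps -/

section Nemytskii

variable {K : Type*} [TopologicalSpace K] [CompactSpace K]

/-- Pointwise application of a continuous family of linear maps to a continuous family of vectors,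
as a continuous bilinear map. -/
noncomputable def ContinuousMap.pointwiseApply (K : Type*) [TopologicalSpace K] [CompactSpace K]
    (E F : Type*) [NormedAddCommGroup E] [NormedSpace ℝ E] [NormedAddCommGroup F]
    [NormedSpace ℝ F] : C(K, E →L[ℝ] F) →L[ℝ] C(K, E) →L[ℝ] C(K, F) :=
  LinearMap.mkContinuous₂
    (LinearMap.mk₂ ℝ (fun (A : C(K, E →L[ℝ] F)) (h : C(K, E)) =>
      (⟨fun k => A k (h k), by fun_prop⟩ : C(K, F)))
      (fun _ _ _ => by ext; simp) (fun _ _ _ => by ext; simp)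
      (fun _ _ _ => by ext; simp) (fun _ _ _ => by ext; simp)) 1
    (fun A h => by
      rw [one_mul]
      refine (ContinuousMap.norm_le _ (by positivity)).2 fun k => ?_
      exact (A k).le_of_opNorm_le_of_le (A.norm_coe_le_norm k) (h.norm_coe_le_norm k))

@[simp] theorem ContinuousMap.pointwiseApply_apply {E F : Type*} [NormedAddCommGroup E]
    [NormedSpace ℝ E] [NormedAddCommGroup F] [NormedSpace ℝ F] (A : C(K, E →L[ℝ] F)) (h : C(K, E))
    (k : K) : ContinuousMap.pointwiseApply K E F A h k = A k (h k) := rfl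

/-- The mean value inequality on each segment from γ k to γ k + η k bounds the remainder by the
oscillation of f' there. -/
theorem hasFDerivAt_postcomp {E F : Type*} [NormedAddCommGroup E]
    [NormedSpace ℝ E] [NormedAddCommGroup F] [NormedSpace ℝ F] {f : C(E, F)}
    {f' : C(E, E →L[ℝ] F)} (hf : ∀ x, HasFDerivAt f (f' x) x) (γ : C(K, E)) :
    HasFDerivAt (fun γ : C(K, E) => f.comp γ)
      (ContinuousMap.pointwiseApply K E F (f'.comp γ)) γ := by
  rw [hasFDerivAt_iff_isLittleO_nhds_zero, Asymptotics.isLittleO_iff]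
  intro c hc
  -- Continuity of composition with f' in the sup norm makes the bound on the oscillation uniform in
  -- k.
  have hcont : Continuous fun η : C(K, E) => f'.comp (γ + η) :=
    (ContinuousMap.continuous_postcomp f').comp (by fun_prop)
  have h0 := (Metric.continuousAt_iff (f := fun η : C(K, E) => f'.comp (γ + η)) (a := 0)).1
    hcont.continuousAt c hc
  obtain ⟨δ, hδ, h⟩ := h0
  filter_upwards [Metric.ball_mem_nhds (0 : C(K, E)) hδ] with η hη
  refine (ContinuousMap.norm_le _ (by positivity)).2 fun k => ?_
  have hbound : ∀ z ∈ segment ℝ (γ k) (γ k + η k), ‖f' z - f' (γ k)‖ ≤ c := by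
    rintro z hz
    rw [segment_eq_image'] at hz
    obtain ⟨s, hs, rfl⟩ := hz
    have hs' : dist (s • η) 0 < δ := by
      rw [dist_zero_right, norm_smul]
      rw [Metric.mem_ball, dist_zero_right] at hη
      refine lt_of_le_of_lt ?_ hη
      rw [Real.norm_of_nonneg hs.1]
      exact mul_le_of_le_one_left (norm_nonneg _) hs.2
    have := (ContinuousMap.dist_apply_le_dist k).trans (h hs').le
    rw [dist_eq_norm] at this
    simpa using this
  have := Convex.norm_image_sub_le_of_norm_hasFDerivWithin_le' (f := f) (f' := f')
    (φ := f' (γ k)) (C := c) (s := segment ℝ (γ k) (γ k + η k))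
    (fun z _ => (hf z).hasFDerivWithinAt) hbound (convex_segment _ _)
    (left_mem_segment ℝ _ _) (right_mem_segment ℝ _ _)
  have h2 := this.trans (mul_le_mul_of_nonneg_left
    (show ‖γ k + η k - γ k‖ ≤ ‖η‖ by simpa using η.norm_coe_le_norm k) hc.le)
  simpa using h2

/-- The derivative of composition with f is composition with Df followed by a fixed continuous
linear map, so the induction runs over all targets F. The common universe lets `E →L[ℝ] F` serve as
the next target. -/
theorem contDiff_postcomp_nat.{u} {E : Type u} [NormedAddCommGroup E] [NormedSpace ℝ E] (n : ℕ) :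
    ∀ {F : Type u} [NormedAddCommGroup F] [NormedSpace ℝ F] (f : C(E, F)),
    ContDiff ℝ n f → ContDiff ℝ n (fun γ : C(K, E) => f.comp γ) := by
  induction n with
  | zero =>
    intro F _ _ f _
    exact contDiff_zero.2 (ContinuousMap.continuous_postcomp f)
  | succ n ih =>
    intro F _ _ f hf
    have hd : ContDiff ℝ n (fderiv ℝ f) := hf.fderiv_right (by norm_cast)
    have hD : Differentiable ℝ f := hf.differentiable (by simp)
    let f' : C(E, E →L[ℝ] F) := ⟨fderiv ℝ f, hd.continuous⟩
    have key := fun γ : C(K, E) =>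
      hasFDerivAt_postcomp (f := f) (f' := f') (fun x => (hD x).hasFDerivAt) γ
    have h2 : ContDiff ℝ n (fun γ : C(K, E) =>
        ContinuousMap.pointwiseApply K E F (f'.comp γ)) :=
      (ih f' hd).continuousLinearMap_comp (ContinuousMap.pointwiseApply K E F)
    exact (contDiff_succ_iff_hasFDerivAt (n := n)).2 ⟨_, h2, key⟩

/-- The Nemytskii operator of a smooth map is smooth. -/
theorem contDiff_postcomp {E : Type*} [NormedAddCommGroup E] [NormedSpace ℝ E]
    (f : C(E, E)) (hf : ContDiff ℝ ∞ f) :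
    ContDiff ℝ ∞ (fun γ : C(K, E) => f.comp γ) :=
  contDiff_infty.2 fun n => contDiff_postcomp_nat n f (hf.of_le (by exact_mod_cast le_top))

end Nemytskii

/-! ### Integral operator and smooth local flows in a Banach space -/

section Volterra

variable {E : Type*} [NormedAddCommGroup E] [NormedSpace ℝ E] {a : ℝ}

/-- Integration from `0`, as an operator on continuous functions on `[-a, a]`. -/
noncomputable def volterra (E : Type*) [NormedAddCommGroup E] [NormedSpace ℝ E] [CompleteSpace E]
    {a : ℝ} (ha : -a ≤ a) : C(Icc (-a) a, E) →L[ℝ] C(Icc (-a) a, E) :=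
  LinearMap.mkContinuous
    { toFun := fun γ => ⟨fun r => ∫ s in (0 : ℝ)..r, IccExtend ha γ s,
        (intervalIntegral.continuous_primitive
          (fun _ _ => (γ.continuous.Icc_extend' (h := ha)).intervalIntegrable _ _) 0).comp
          continuous_subtype_val⟩
      map_add' := fun γ η => by
        ext r
        simp only [ContinuousMap.coe_mk, ContinuousMap.add_apply]
        rw [← intervalIntegral.integral_add
          ((γ.continuous.Icc_extend' (h := ha)).intervalIntegrable _ _)
          ((η.continuous.Icc_extend' (h := ha)).intervalIntegrable _ _)]
        rfl
      map_smul' := fun c γ => by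
        ext r
        simp only [ContinuousMap.coe_mk, ContinuousMap.smul_apply, RingHom.id_apply]
        rw [← intervalIntegral.integral_smul]
        rfl } a
    (fun γ => by
      have ha' : 0 ≤ a := by linarith
      refine (ContinuousMap.norm_le _ (by positivity)).2 fun r => ?_
      have := intervalIntegral.norm_integral_le_of_norm_le_const (a := (0 : ℝ)) (b := r) (C := ‖γ‖)
        (f := IccExtend ha γ) (fun s _ => γ.norm_coe_le_norm _)
      refine this.trans ?_
      rw [mul_comm]
      gcongr
      rw [sub_zero, abs_le]
      exact r.2)

end Volterra

section LocalFlow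

/-- The inclusion of constant functions. -/
noncomputable def ContinuousMap.constCLM (K : Type*) [TopologicalSpace K] [CompactSpace K]
    (E : Type*) [NormedAddCommGroup E] [NormedSpace ℝ E] : E →L[ℝ] C(K, E) :=
  LinearMap.mkContinuous
    { toFun := fun x => ContinuousMap.const K x
      map_add' := fun _ _ => by ext; simp
      map_smul' := fun _ _ => by ext; simp } 1
    (fun x => by
      rw [one_mul]
      exact (ContinuousMap.norm_le _ (by positivity)).2 fun _ => le_rfl)

variable {E : Type*} [NormedAddCommGroup E] [NormedSpace ℝ E] [CompleteSpace E] {a : ℝ}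

/-- The map whose fibres are the solutions of the rescaled integral equation
`γ r = x + t ∫₀ʳ f (γ s) ds`. -/
noncomputable def integralEquationMap (f : C(E, E)) (ha : -a ≤ a)
    (p : ℝ × E × C(Icc (-a) a, E)) : ℝ × E × C(Icc (-a) a, E) :=
  (p.1, p.2.1, p.2.2 - ContinuousMap.constCLM _ E p.2.1 - p.1 • volterra E ha (f.comp p.2.2))

theorem contDiff_integralEquationMap (f : C(E, E)) (hf : ContDiff ℝ ∞ f) (ha : -a ≤ a) :
    ContDiff ℝ ∞ (integralEquationMap f ha) := by
  have h : ContDiff ℝ ∞ fun p : ℝ × E × C(Icc (-a) a, E) => volterra E ha (f.comp p.2.2) :=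
    ((contDiff_postcomp f hf).comp (contDiff_snd.comp contDiff_snd)).continuousLinearMap_comp
      (volterra E ha)
  have h2 : ContDiff ℝ ∞ fun p : ℝ × E × C(Icc (-a) a, E) =>
      ContinuousMap.constCLM (Icc (-a) a) E p.2.1 :=
    (contDiff_fst.comp contDiff_snd).continuousLinearMap_comp _
  exact contDiff_fst.prodMk ((contDiff_fst.comp contDiff_snd).prodMk
    (((contDiff_snd.comp contDiff_snd).sub h2).sub (contDiff_fst.smul h)))

/-- The derivative of `integralEquationMap` at `t = 0`. -/
noncomputable def shearEquiv {X Y Z : Type*} [NormedAddCommGroup X] [NormedSpace ℝ X]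
    [NormedAddCommGroup Y] [NormedSpace ℝ Y] [NormedAddCommGroup Z] [NormedSpace ℝ Z]
    (A : X →L[ℝ] Z) (B : Y →L[ℝ] Z) : (X × Y × Z) ≃L[ℝ] (X × Y × Z) :=
  ContinuousLinearEquiv.equivOfInverse
    ((ContinuousLinearMap.fst ℝ X (Y × Z)).prod
      (((ContinuousLinearMap.fst ℝ Y Z).comp (ContinuousLinearMap.snd ℝ X (Y × Z))).prod
      ((ContinuousLinearMap.snd ℝ Y Z).comp (ContinuousLinearMap.snd ℝ X (Y × Z))
        - B.comp ((ContinuousLinearMap.fst ℝ Y Z).comp (ContinuousLinearMap.snd ℝ X (Y × Z)))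
        - A.comp (ContinuousLinearMap.fst ℝ X (Y × Z)))))
    ((ContinuousLinearMap.fst ℝ X (Y × Z)).prod
      (((ContinuousLinearMap.fst ℝ Y Z).comp (ContinuousLinearMap.snd ℝ X (Y × Z))).prod
      ((ContinuousLinearMap.snd ℝ Y Z).comp (ContinuousLinearMap.snd ℝ X (Y × Z))
        + B.comp ((ContinuousLinearMap.fst ℝ Y Z).comp (ContinuousLinearMap.snd ℝ X (Y × Z)))
        + A.comp (ContinuousLinearMap.fst ℝ X (Y × Z)))))
    (fun p => by ext; exacts [rfl, rfl, by simp; abel]) (fun p => by ext; exacts [rfl, rfl, by simp; abel])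

/-- The nonlinear term carries the factor t, so at t = 0 it contributes to the derivative only in
the t direction. The derivative is therefore a shear, invertible whatever the size of f or of the
interval. -/
theorem hasFDerivAt_integralEquationMap (f : C(E, E)) (hf : ContDiff ℝ ∞ f) (ha : -a ≤ a)
    (x : E) (γ : C(Icc (-a) a, E)) :
    HasFDerivAt (integralEquationMap f ha)
      (shearEquiv ((ContinuousLinearMap.id ℝ ℝ).smulRight (volterra E ha (f.comp γ)))
        (ContinuousMap.constCLM (Icc (-a) a) E) : ℝ × E × C(Icc (-a) a, E) →L[ℝ] _) (0, x, γ) := by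
  have h : ContDiff ℝ ∞ fun p : ℝ × E × C(Icc (-a) a, E) => volterra E ha (f.comp p.2.2) :=
    ((contDiff_postcomp f hf).comp (contDiff_snd.comp contDiff_snd)).continuousLinearMap_comp
      (volterra E ha)
  have h1 := (h.differentiable (by simp) (0, x, γ)).hasFDerivAt
  have h2 := (hasFDerivAt_fst (𝕜 := ℝ) (p := ((0 : ℝ), x, γ))).smul h1
  have h3 := (hasFDerivAt_snd (𝕜 := ℝ) (p := ((0 : ℝ), x, γ)))
  have h4 := (hasFDerivAt_fst (𝕜 := ℝ) (p := (x, γ))).comp ((0 : ℝ), x, γ) h3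
  have h5 := (hasFDerivAt_snd (𝕜 := ℝ) (p := (x, γ))).comp ((0 : ℝ), x, γ) h3
  have h6 := ((ContinuousMap.constCLM (Icc (-a) a) E).hasFDerivAt).comp ((0 : ℝ), x, γ) h4
  have h7 := (hasFDerivAt_fst (𝕜 := ℝ) (p := ((0 : ℝ), x, γ))).prodMk
    (h4.prodMk ((h5.sub h6).sub h2))
  refine h7.congr_fderiv ?_
  ext p <;> simp [shearEquiv]

/-- The rescaled local flow of a smooth vector field `f` near `x₀`: `Ψ t x` is the solution of
`γ' = t f(γ)`, `γ 0 = x` on `(-2, 2)`, and its value at time `1` is smooth in `(t, x)`. -/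
theorem exists_rescaled_localFlow (f : E → E) (hf : ContDiff ℝ ∞ f) (x₀ : E) {V : Set E}
    (hV : V ∈ 𝓝 x₀) :
    ∃ ε > 0, ∃ U ∈ 𝓝 x₀, ∃ Ψ : ℝ → E → ℝ → E,
      ContDiffOn ℝ ∞ (fun p : ℝ × E => Ψ p.1 p.2 1) (Ioo (-ε) ε ×ˢ U) ∧
      ∀ t ∈ Ioo (-ε) ε, ∀ x ∈ U, Ψ t x 0 = x ∧ ∀ r ∈ Ioo (-2 : ℝ) 2,
        Ψ t x r ∈ V ∧ HasDerivAt (Ψ t x) (t • f (Ψ t x r)) r := by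
  obtain ⟨δ, hδ, hδV⟩ := Metric.mem_nhds_iff.1 hV
  -- The interval [-2, 2] has the evaluation time 1 in its interior.
  have ha : -(2 : ℝ) ≤ 2 := by norm_num
  let f₀ : C(E, E) := ⟨f, hf.continuous⟩
  let G := integralEquationMap f₀ ha
  have hG : ContDiff ℝ ∞ G := contDiff_integralEquationMap f₀ hf ha
  let γ₀ : C(Icc (-2 : ℝ) 2, E) := ContinuousMap.constCLM _ E x₀
  let p₀ : ℝ × E × C(Icc (-2 : ℝ) 2, E) := (0, x₀, γ₀)
  have hG₀ := hasFDerivAt_integralEquationMap f₀ hf ha x₀ γ₀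
  let e := hG.contDiffAt.toOpenPartialHomeomorph G hG₀ (by simp)
  have he₀ : p₀ ∈ e.source :=
    hG.contDiffAt.mem_toOpenPartialHomeomorph_source hG₀ (by simp)
  have heq : ∀ p, e p = G p := fun _ => rfl
  have hGp : G p₀ = (0, x₀, 0) := by
    simp [G, p₀, integralEquationMap, γ₀]
  -- Smoothness of the inverse at a point requires an invertible derivative at that very point;
  -- invertibility is open, so it persists near p₀.
  let X := ℝ × E × C(Icc (-2 : ℝ) 2, E)
  have hinv : {p | ∃ e' : X ≃L[ℝ] X, (e' : X →L[ℝ] X) = fderiv ℝ G p} ∈ 𝓝 p₀ :=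
    (ContinuousLinearEquiv.isOpen.preimage (hG.continuous_fderiv (by simp))).mem_nhds
      ⟨_, hG₀.fderiv.symm⟩
  have hball : {p : ℝ × E × C(Icc (-2 : ℝ) 2, E) | p.2.2 ∈ Metric.ball γ₀ δ} ∈ 𝓝 p₀ :=
    (Metric.isOpen_ball.preimage (by fun_prop)).mem_nhds (Metric.mem_ball_self hδ)
  have hsymm₀ : e.symm (0, x₀, 0) = p₀ := by
    rw [← hGp, ← heq, e.left_inv he₀]
  have htgt₀ : ((0 : ℝ), x₀, (0 : C(Icc (-2 : ℝ) 2, E))) ∈ e.target := by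
    rw [← hGp, ← heq]; exact e.map_source he₀
  have hj : Continuous fun p : ℝ × E => (p.1, p.2, (0 : C(Icc (-2 : ℝ) 2, E))) := by fun_prop
  have hgood : ∀ᶠ p : ℝ × E in 𝓝 (0, x₀), (p.1, p.2, (0 : C(Icc (-2 : ℝ) 2, E))) ∈ e.target ∧
      (e.symm (p.1, p.2, 0)).2.2 ∈ Metric.ball γ₀ δ ∧
      ∃ e' : X ≃L[ℝ] X, (e' : X →L[ℝ] X) = fderiv ℝ G (e.symm (p.1, p.2, 0)) := by
    have h1 := hj.continuousAt.eventually_mem (x := ((0 : ℝ), x₀)) (e.open_target.mem_nhds htgt₀)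
    have h2 : ContinuousAt (fun p : ℝ × E => e.symm (p.1, p.2, 0)) ((0 : ℝ), x₀) :=
      ContinuousAt.comp' (e.continuousAt_symm htgt₀) hj.continuousAt
    have h3 := h2.eventually_mem (s := {p | p.2.2 ∈ Metric.ball γ₀ δ}) (by simpa [hsymm₀] using hball)
    have h4 := h2.eventually_mem (s := {p | ∃ e' : X ≃L[ℝ] X, (e' : X →L[ℝ] X) = fderiv ℝ G p})
      (by simpa only [hsymm₀] using hinv)
    filter_upwards [h1, h3, h4] with p h1 h3 h4 using ⟨h1, h3, h4⟩
  obtain ⟨S, hS, U, hU, hSU⟩ := mem_nhds_prod_iff.1 hgood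
  obtain ⟨ε, hε, hεS⟩ := Metric.mem_nhds_iff.1 hS
  rw [Real.ball_eq_Ioo, zero_sub, zero_add] at hεS
  let Γ : ℝ × E → C(Icc (-2 : ℝ) 2, E) := fun p => (e.symm (p.1, p.2, 0)).2.2
  -- The inverse keeps the first two coordinates, and vanishing of the third coordinate of G is the
  -- integral equation.
  have hΓ : ∀ p ∈ Ioo (-ε) ε ×ˢ U, ∀ r, Γ p r =
      p.2 + p.1 • ∫ s in (0 : ℝ)..r, f (IccExtend ha (Γ p) s) := by
    intro p hp r
    have hp' := (hSU ⟨hεS hp.1, hp.2⟩ : _ ∧ _ ∧ _).1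
    have h1 : G (e.symm (p.1, p.2, 0)) = (p.1, p.2, 0) := e.right_inv hp'
    have h2 : (e.symm (p.1, p.2, 0)).1 = p.1 := congrArg Prod.fst h1
    have h3 : (e.symm (p.1, p.2, 0)).2.1 = p.2 := congrArg (fun q => q.2.1) h1
    have h4 : (G (e.symm (p.1, p.2, 0))).2.2 = 0 := by rw [h1]
    simp only [G, integralEquationMap, h2, h3] at h4
    have h5 := DFunLike.congr_fun h4 r
    simp only [ContinuousMap.sub_apply, ContinuousMap.zero_apply, sub_sub, sub_eq_zero] at h5
    exact h5
  refine ⟨ε, hε, U, hU, fun t x r => IccExtend ha (Γ (t, x)) r, ?_, ?_⟩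
  · intro p hp
    obtain ⟨hp1, -, e', he'⟩ := (hSU ⟨hεS hp.1, hp.2⟩ : _ ∧ _ ∧ _)
    have hd : HasFDerivAt e (e' : _ →L[ℝ] _) (e.symm (p.1, p.2, 0)) := by
      rw [he']; exact (hG.differentiable (by simp) _).hasFDerivAt
    have h1 : ContDiffAt ℝ ∞ e.symm (p.1, p.2, 0) := e.contDiffAt_symm hp1 hd hG.contDiffAt
    have h2 : ContDiffAt ℝ ∞ (fun p : ℝ × E => e.symm (p.1, p.2, 0)) p :=
      ContDiffAt.comp (f := fun p : ℝ × E => (p.1, p.2, (0 : C(Icc (-2 : ℝ) 2, E)))) p h1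
        (contDiff_fst.prodMk (contDiff_snd.prodMk contDiff_const)).contDiffAt
    exact ((ContinuousMap.evalCLM ℝ (projIcc _ _ ha 1)).contDiff.contDiffAt.comp p
      (contDiff_snd.contDiffAt.comp p (contDiff_snd.contDiffAt.comp p h2))).contDiffWithinAt
  · intro t ht x hx
    have hcont : Continuous fun s => f (IccExtend ha (Γ (t, x)) s) :=
      hf.continuous.comp (Γ (t, x)).continuous.Icc_extend'
    refine ⟨?_, fun r hr => ⟨?_, ?_⟩⟩
    · change IccExtend ha (Γ (t, x)) 0 = x
      rw [IccExtend_of_mem ha _ (⟨by norm_num, by norm_num⟩ : (0 : ℝ) ∈ Icc (-2 : ℝ) 2),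
        hΓ (t, x) ⟨ht, hx⟩]
      simp
    · apply hδV
      have h1 : Γ (t, x) ∈ Metric.ball γ₀ δ := (hSU ⟨hεS ht, hx⟩ : _ ∧ _ ∧ _).2.1
      exact lt_of_le_of_lt (ContinuousMap.dist_apply_le_dist (projIcc _ _ ha r)) h1
    · have h1 := (hcont.integral_hasStrictDerivAt 0 r).hasDerivAt
      refine ((h1.const_smul t).const_add x).congr_of_eventuallyEq ?_
      filter_upwards [Ioo_mem_nhds hr.1 hr.2] with s hs
      rw [IccExtend_of_mem ha _ (Ioo_subset_Icc_self hs)]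
      exact hΓ (t, x) ⟨ht, hx⟩ _

end LocalFlow

/-- A smooth map on an open set agrees near each point of it with a globally smooth map. -/
theorem ContDiffOn.exists_contDiff_eventuallyEq {E F : Type*} [NormedAddCommGroup E]
    [NormedSpace ℝ E] [FiniteDimensional ℝ E] [NormedAddCommGroup F] [NormedSpace ℝ F]
    {g : E → F} {s : Set E} (hg : ContDiffOn ℝ ∞ g s) (hs : IsOpen s) {x : E} (hx : x ∈ s) :
    ∃ f : E → F, ContDiff ℝ ∞ f ∧ f =ᶠ[𝓝 x] g := by
  obtain ⟨ε, hε, hεs⟩ := Metric.nhds_basis_closedBall.mem_iff.1 (hs.mem_nhds hx)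
  let b : ContDiffBump x := ⟨ε / 2, ε, by positivity, by linarith⟩
  refine ⟨fun y => b y • g y, contDiff_iff_contDiffAt.2 fun y => ?_, ?_⟩
  · by_cases hy : y ∈ s
    · exact b.contDiff.contDiffAt.smul (hg.contDiffAt (hs.mem_nhds hy))
    · have : y ∉ tsupport b := fun h => hy (hεs (b.tsupport_eq ▸ h))
      refine (contDiffAt_const (c := (0 : F))).congr_of_eventuallyEq ?_
      filter_upwards [(isClosed_tsupport b).isOpen_compl.mem_nhds this] with z hz
      rw [image_eq_zero_of_notMem_tsupport hz, zero_smul]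
  · filter_upwards [b.eventuallyEq_one] with y hy
    simp [hy]

/-! ### Flows of smooth vector fields on manifolds -/

section VectorField

variable {E : Type*} [NormedAddCommGroup E] [NormedSpace ℝ E]
  {H : Type*} [TopologicalSpace H] {I : ModelWithCorners ℝ E H} [I.Boundaryless]
  {N : Type*} [TopologicalSpace N] [ChartedSpace H N]

omit [I.Boundaryless] in
theorem contMDiffOn_chart_source_iff {F : Type*} [NormedAddCommGroup F] [NormedSpace ℝ F]
    [IsManifold I ∞ N] {f : N → F} (c : N) :
    ContMDiffOn I 𝓘(ℝ, F) ∞ f (chartAt H c).source ↔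
      ContDiffOn ℝ ∞ (fun y => f ((extChartAt I c).symm y)) (extChartAt I c).target := by
  constructor
  · intro h
    rw [← contMDiffOn_iff_contDiffOn]
    refine h.comp (contMDiffOn_extChartAt_symm c) fun y hy => ?_
    rw [← extChartAt_source I]
    exact (extChartAt I c).map_target hy
  · intro h
    rw [← contMDiffOn_iff_contDiffOn] at h
    refine (h.comp (contMDiffOn_extChartAt (x := c)) fun y hy => ?_).congr fun y hy => ?_
    · exact (extChartAt I c).map_source (by rwa [extChartAt_source])
    · change f y = f _
      rw [(extChartAt I c).left_inv (by rwa [extChartAt_source])]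

/-- The coordinate expression of a vector field in the preferred chart at `c`. -/
noncomputable def vectorFieldInChart (W : (x : N) → TangentSpace I x) (c : N) : E → E := fun y =>
  mfderiv I 𝓘(ℝ, E) (extChartAt I c) ((extChartAt I c).symm y) (W ((extChartAt I c).symm y))

omit [I.Boundaryless] in
theorem contMDiffOn_vectorField_iff [IsManifold I ∞ N] (W : (x : N) → TangentSpace I x) (c : N) :
    ContMDiffOn I I.tangent ∞ (fun x => (⟨x, W x⟩ : TangentBundle I N)) (chartAt H c).source ↔
      ContDiffOn ℝ ∞ (vectorFieldInChart W c) (extChartAt I c).target := by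
  have h := (trivializationAt E (TangentSpace I) c).contMDiffOn_section_baseSet_iff (IB := I)
    (n := ∞) (s := W)
  rw [TangentBundle.trivializationAt_baseSet] at h
  refine h.trans (Iff.trans (contMDiffOn_congr fun x hx => ?_) (contMDiffOn_chart_source_iff (I := I)
    (f := fun x => (mfderiv I 𝓘(ℝ, E) (extChartAt I c) x (W x) : E)) c))
  · have := TangentBundle.continuousLinearMapAt_trivializationAt (I := I) hx
    rw [← this]
    have hb : x ∈ (trivializationAt E (TangentSpace I) c).baseSet := by
      rwa [TangentBundle.trivializationAt_baseSet]
    exact (congrFun ((trivializationAt E (TangentSpace I) c).coe_linearMapAt_of_mem (R := ℝ) hb)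
      (W x)).symm

theorem mfderiv_extChartAt_symm_comp [IsManifold I ∞ N] {c : N} {y : E}
    (hy : y ∈ (extChartAt I c).target) (v : TangentSpace I ((extChartAt I c).symm y)) :
    mfderiv 𝓘(ℝ, E) I (extChartAt I c).symm y
      (mfderiv I 𝓘(ℝ, E) (extChartAt I c) ((extChartAt I c).symm y) v) = v := by
  have : IsManifold I 1 N := IsManifold.of_le (n := ∞) (by simp)
  have := mfderivWithin_extChartAt_symm_comp_mfderiv_extChartAt (I := I) hy
  rw [I.range_eq_univ, mfderivWithin_univ] at this
  exact DFunLike.congr_fun this v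

theorem mdifferentiableAt_extChartAt_symm_of_mem [IsManifold I ∞ N] {c : N} {y : E}
    (hy : y ∈ (extChartAt I c).target) :
    MDifferentiableAt 𝓘(ℝ, E) I (extChartAt I c).symm y := by
  have : IsManifold I 1 N := IsManifold.of_le (n := ∞) (by simp)
  have := mdifferentiableWithinAt_extChartAt_symm (I := I) hy
  rwa [I.range_eq_univ, mdifferentiableWithinAt_univ] at this

/-- The field in a chart is replaced by a globally smooth f agreeing with it near the center. Local
solutions for f are confined to the region of agreement, so they are integral curves of the original
field. -/
theorem exists_rescaled_localFlow_manifold [FiniteDimensional ℝ E] [IsManifold I ∞ N]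
    {W : (x : N) → TangentSpace I x}
    (hW : ContMDiff I I.tangent ∞ (fun x => (⟨x, W x⟩ : TangentBundle I N))) (c : N) :
    ∃ ε > 0, ∃ U ∈ 𝓝 c, ∃ Ψ : ℝ → N → ℝ → N,
      ContMDiffOn (𝓘(ℝ, ℝ).prod I) I ∞ (fun p : ℝ × N => Ψ p.1 p.2 1) (Ioo (-ε) ε ×ˢ U) ∧
      ∀ t ∈ Ioo (-ε) ε, ∀ x ∈ U, Ψ t x 0 = x ∧ IsMIntegralCurveOn (Ψ t x) (t • W) (Ioo (-2) 2) := by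
  have hopen := isOpen_extChartAt_target (I := I) c
  have hWc := (contMDiffOn_vectorField_iff W c).1 hW.contMDiffOn
  obtain ⟨f, hf, hfW⟩ := hWc.exists_contDiff_eventuallyEq hopen (mem_extChartAt_target c)
  obtain ⟨ε, hε, U, hU, Ψ, hΨ, h⟩ := exists_rescaled_localFlow f hf (extChartAt I c c)
    (inter_mem (hopen.mem_nhds (mem_extChartAt_target c)) hfW)
  have hU' : (extChartAt I c).source ∩ extChartAt I c ⁻¹' U ∈ 𝓝 c :=
    inter_mem (extChartAt_source_mem_nhds c) ((continuousAt_extChartAt c) hU)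
  refine ⟨ε, hε, _, hU', fun t x r => (extChartAt I c).symm (Ψ t (extChartAt I c x) r), ?_, ?_⟩
  · have h1 : ContMDiffOn (𝓘(ℝ, ℝ).prod 𝓘(ℝ, E)) 𝓘(ℝ, E) ∞ (fun p : ℝ × E => Ψ p.1 p.2 1)
        (Ioo (-ε) ε ×ˢ U) := by
      rw [← modelWithCornersSelf_prod, chartedSpaceSelf_prod]
      exact hΨ.contMDiffOn
    have h2 : ContMDiffOn (𝓘(ℝ, ℝ).prod I) (𝓘(ℝ, ℝ).prod 𝓘(ℝ, E)) ∞
        (fun p : ℝ × N => (p.1, extChartAt I c p.2))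
        (Ioo (-ε) ε ×ˢ ((extChartAt I c).source ∩ extChartAt I c ⁻¹' U)) := by
      refine contMDiffOn_fst.prodMk ((contMDiffOn_extChartAt (x := c)).comp contMDiffOn_snd ?_)
      intro p hp
      simpa using hp.2.1
    refine (contMDiffOn_extChartAt_symm (n := ∞) c).comp (h1.comp h2 fun p hp => ⟨hp.1, hp.2.2⟩) ?_
    exact fun p hp => ((h p.1 hp.1 _ hp.2.2).2 1 (by norm_num)).1.1
  · rintro t ht x ⟨hx, hxU⟩
    obtain ⟨h0, h1⟩ := h t ht _ hxU
    refine ⟨?_, fun r hr => HasMFDerivAt.hasMFDerivWithinAt ?_⟩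
    · change (extChartAt I c).symm (Ψ t (extChartAt I c x) 0) = x
      rw [h0, (extChartAt I c).left_inv hx]
    · obtain ⟨⟨hy, hy'⟩, hd⟩ := h1 r hr
      have h2 := (mdifferentiableAt_extChartAt_symm_of_mem hy).hasMFDerivAt.comp r
        hd.hasFDerivAt.hasMFDerivAt
      have h3 : (1 : ℝ →L[ℝ] ℝ).smulRight
          ((t • W) ((extChartAt I c).symm (Ψ t (extChartAt I c x) r))) =
          (mfderiv 𝓘(ℝ, E) I (extChartAt I c).symm (Ψ t (extChartAt I c x) r)).comp
            (ContinuousLinearMap.toSpanSingleton ℝ (t • f (Ψ t (extChartAt I c x) r))) := by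
        let D : E →L[ℝ] TangentSpace I ((extChartAt I c).symm (Ψ t (extChartAt I c x) r)) :=
          mfderiv 𝓘(ℝ, E) I (extChartAt I c).symm (Ψ t (extChartAt I c x) r)
        have h4 : D (f (Ψ t (extChartAt I c x) r)) = W _ := by
          rw [hy']; exact mfderiv_extChartAt_symm_comp hy _
        refine ContinuousLinearMap.ext_ring ?_
        change (1 : ℝ) • t • W _ = D ((1 : ℝ) • t • f (Ψ t (extChartAt I c x) r))
        rw [map_smul, map_smul, h4]
      exact h3 ▸ h2

/-- The rescaled local flows coincide with the global integral curves. -/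
theorem eq_of_isMIntegralCurveOn_smul [IsManifold I ∞ N] [T2Space N]
    {W : (x : N) → TangentSpace I x}
    (hW : ContMDiff I I.tangent ∞ (fun x => (⟨x, W x⟩ : TangentBundle I N)))
    {γ η : ℝ → N} {t : ℝ} (hγ : IsMIntegralCurve γ W)
    (hη : IsMIntegralCurveOn η (t • W) (Ioo (-2) 2)) (h0 : γ 0 = η 0) : γ t = η 1 := by
  have : IsManifold I 1 N := IsManifold.of_le (n := ∞) (by simp)
  have htW : ContMDiff I I.tangent 1 (fun x => (⟨x, (t • W) x⟩ : TangentBundle I N)) :=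
    contMDiff_const.smul_section (hW.of_le (by simp))
  have h1 := (hγ.comp_mul t).isMIntegralCurveOn (Ioo (-2) 2)
  have h2 := isMIntegralCurveOn_Ioo_eqOn_of_contMDiff_boundaryless (t₀ := 0) (by norm_num) htW h1 hη
    (by simpa using h0)
  simpa using h2 (show (1 : ℝ) ∈ Ioo (-2 : ℝ) 2 by norm_num)

/-- A vector field that has integral curves of a uniform length has global ones. -/
theorem exists_uniform_time_nhds [FiniteDimensional ℝ E] [IsManifold I ∞ N]
    {W : (x : N) → TangentSpace I x}
    (hW : ContMDiff I I.tangent ∞ (fun x => (⟨x, W x⟩ : TangentBundle I N))) (c : N) :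
    ∃ ε > 0, ∀ᶠ x in 𝓝 c, ∃ γ : ℝ → N, γ 0 = x ∧ IsMIntegralCurveOn γ W (Ioo (-ε) ε) := by
  obtain ⟨ε, hε, U, hU, Ψ, -, h⟩ := exists_rescaled_localFlow_manifold hW c
  refine ⟨ε, hε, ?_⟩
  filter_upwards [hU] with x hx
  -- Undoing the rescaling by ε / 2 stretches the interval (-2, 2) to (-ε, ε).
  obtain ⟨h0, h1⟩ := h (ε / 2) ⟨by linarith, by linarith⟩ x hx
  have h2 := h1.comp_mul (ε / 2)⁻¹
  have h3 : (ε / 2)⁻¹ • (ε / 2) • W = W := by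
    rw [smul_smul, inv_mul_cancel₀ (by positivity), one_smul]
  rw [h3] at h2
  refine ⟨_, ?_, h2.mono fun t ht => ?_⟩
  · simpa using h0
  · constructor
    · rw [← div_eq_mul_inv, lt_div_iff₀ (by positivity)]; linarith [ht.1]
    · rw [← div_eq_mul_inv, div_lt_iff₀ (by positivity)]; linarith [ht.2]

/-- The flow of a complete smooth vector field is smooth. -/
theorem contMDiff_flow [FiniteDimensional ℝ E] [IsManifold I ∞ N] [T2Space N]
    {W : (x : N) → TangentSpace I x}
    (hW : ContMDiff I I.tangent ∞ (fun x => (⟨x, W x⟩ : TangentBundle I N)))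
    {Φ : N → ℝ → N} (h0 : ∀ x, Φ x 0 = x) (hΦ : ∀ x, IsMIntegralCurve (Φ x) W) :
    (∀ x s t, Φ (Φ x s) t = Φ x (s + t)) ∧
    ContMDiff (𝓘(ℝ, ℝ).prod I) I ∞ (fun p : ℝ × N => Φ p.2 p.1) := by
  have : IsManifold I 1 N := IsManifold.of_le (n := ∞) (by simp)
  have hadd : ∀ x s t, Φ (Φ x s) t = Φ x (s + t) := by
    intro x s t
    have := isMIntegralCurve_Ioo_eq_of_contMDiff_boundaryless (t₀ := 0) (hW.of_le (by simp))
      (hΦ (Φ x s)) ((hΦ x).comp_add s) (by simp [h0])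
    rw [congrFun this t, Function.comp_apply, add_comm]
  refine ⟨hadd, fun p => ?_⟩
  have hloc : ∀ c : N, ∃ ε > 0, ∃ U ∈ 𝓝 c, ContMDiffOn (𝓘(ℝ, ℝ).prod I) I ∞
      (fun p : ℝ × N => Φ p.2 p.1) (Ioo (-ε) ε ×ˢ U) := by
    intro c
    obtain ⟨ε, hε, U, hU, Ψ, hΨ, h⟩ := exists_rescaled_localFlow_manifold hW c
    refine ⟨ε, hε, U, hU, hΨ.congr fun p hp => ?_⟩
    obtain ⟨h1, h2⟩ := h p.1 hp.1 p.2 hp.2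
    exact eq_of_isMIntegralCurveOn_smul hW (hΦ p.2) h2 (by rw [h0, h1])
  obtain ⟨t₁, x⟩ := p
  -- Connectedness of the time line: the times near which the flow is smooth at x form a nonempty
  -- clopen set.
  let S : Set ℝ := {t | ∃ O ∈ 𝓝 (t, x), ContMDiffOn (𝓘(ℝ, ℝ).prod I) I ∞
    (fun p : ℝ × N => Φ p.2 p.1) O}
  suffices hS : S = univ by
    obtain ⟨O, hO, h⟩ : t₁ ∈ S := hS ▸ mem_univ _
    exact h.contMDiffAt hO
  refine IsClopen.eq_univ ⟨?_, ?_⟩ ⟨0, ?_⟩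
  -- For a limit time t, pick a good time s close to t and factor the flow as the small-time flow
  -- near Φ x t, which is smooth by `hloc`, after the flow for time s.
  · rw [← closure_subset_iff_isClosed]
    intro t ht
    obtain ⟨ε, hε, U, hU, hs⟩ := hloc (Φ x t)
    have hmem : {s | Φ x s ∈ interior U} ∩ Ioo (t - ε / 2) (t + ε / 2) ∈ 𝓝 t :=
      inter_mem ((hΦ x).continuous.continuousAt.eventually_mem (interior_mem_nhds.2 hU))
        (Ioo_mem_nhds (by linarith) (by linarith))
    obtain ⟨s, ⟨hsU, hst⟩, O, hO, hsO⟩ := mem_closure_iff_nhds.1 ht _ hmem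
    have hO' : ∀ᶠ y in 𝓝 x, (s, y) ∈ interior O :=
      (Continuous.prodMk_right s).continuousAt.eventually_mem
        (isOpen_interior.mem_nhds (mem_interior_iff_mem_nhds.2 hO))
    have hsO' : ContMDiffOn I I ∞ (fun y => Φ y s) {y | (s, y) ∈ interior O} :=
      (hsO.mono interior_subset).comp (contMDiff_const.prodMk contMDiff_id).contMDiffOn
        (fun y hy => hy)
    have hcont : ContinuousAt (fun y => Φ y s) x :=
      (hsO'.contMDiffAt hO').continuousAt
    have hO2 : {y | (s, y) ∈ interior O ∧ Φ y s ∈ U} ∈ 𝓝 x :=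
      hO'.and (hcont.eventually_mem (mem_interior_iff_mem_nhds.1 hsU))
    refine ⟨Ioo (t - ε / 2) (t + ε / 2) ×ˢ {y | (s, y) ∈ interior O ∧ Φ y s ∈ U},
      prod_mem_nhds (Ioo_mem_nhds (by linarith) (by linarith)) hO2, ?_⟩
    have h1 : ContMDiffOn (𝓘(ℝ, ℝ).prod I) (𝓘(ℝ, ℝ).prod I) ∞
        (fun p : ℝ × N => (p.1 - s, Φ p.2 s))
        (Ioo (t - ε / 2) (t + ε / 2) ×ˢ {y | (s, y) ∈ interior O ∧ Φ y s ∈ U}) := by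
      refine ContMDiffOn.prodMk ?_ (hsO'.comp contMDiffOn_snd fun p hp => hp.2.1)
      exact contMDiffOn_fst.sub contMDiffOn_const
    refine (hs.comp h1 fun p hp => ⟨⟨?_, ?_⟩, hp.2.2⟩).congr fun p _ => ?_
    · have := hp.1.1; have := hst.2; simp only; linarith
    · have := hp.1.2; have := hst.1; simp only; linarith
    · change _ = Φ (Φ p.2 s) (p.1 - s)
      rw [hadd, add_sub_cancel]
  · refine isOpen_iff_mem_nhds.2 fun t ⟨O, hO, h⟩ => ?_
    have := (Continuous.prodMk_left x).continuousAt.eventually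
      (eventually_mem_nhds_iff.2 hO : ∀ᶠ q in 𝓝 ((t, x) : ℝ × N), O ∈ 𝓝 q)
    filter_upwards [this] with s hs using ⟨O, hs, h⟩
  · obtain ⟨ε, hε, U, hU, hs⟩ := hloc x
    exact ⟨_, prod_mem_nhds (Ioo_mem_nhds (by linarith) hε) hU, hs⟩

end VectorField

/-! ### Isotopies generated by time-dependent vector fields -/

section Isotopy

variable {E : Type*} [NormedAddCommGroup E] [NormedSpace ℝ E] [FiniteDimensional ℝ E]
  {H : Type*} [TopologicalSpace H] {I : ModelWithCorners ℝ E H} [I.Boundaryless]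
  {M : Type*} [TopologicalSpace M] [ChartedSpace H M] [IsManifold I ∞ M]

/-- The autonomous vector field `∂/∂s + X` on `ℝ × M` of a time-dependent field `X` on `M`. -/
def suspension (X : ℝ → (x : M) → TangentSpace I x) (p : ℝ × M) :
    TangentSpace (𝓘(ℝ, ℝ).prod I) p :=
  ((1 : ℝ), X p.1 p.2)

omit [FiniteDimensional ℝ E] [I.Boundaryless] in
-- In the product charts of ℝ × M the suspension is the pair of the constant 1 and the coordinate
-- expression of X.
theorem contMDiff_suspension {X : ℝ → (x : M) → TangentSpace I x}
    (hX : ∀ c, ContDiffOn ℝ ∞ (fun p : ℝ × E => vectorFieldInChart (X p.1) c p.2)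
      (univ ×ˢ (extChartAt I c).target)) :
    ContMDiff (𝓘(ℝ, ℝ).prod I) (𝓘(ℝ, ℝ).prod I).tangent ∞
      (fun p => (⟨p, suspension X p⟩ : TangentBundle (𝓘(ℝ, ℝ).prod I) (ℝ × M))) := by
  have h1M : IsManifold I 1 M := IsManifold.of_le (n := ∞) (by simp)
  intro p
  refine ContMDiffOn.contMDiffAt (s := (chartAt (ModelProd ℝ H) p).source) ?_
    (chart_source_mem_nhds _ p)
  rw [contMDiffOn_vectorField_iff]
  have htarget : (extChartAt (𝓘(ℝ, ℝ).prod I) p).target = univ ×ˢ (extChartAt I p.2).target := by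
    rw [extChartAt_prod, extChartAt_model_space_eq_id]; rfl
  have hchart : ⇑(extChartAt (𝓘(ℝ, ℝ).prod I) p) = fun q : ℝ × M => (q.1, extChartAt I p.2 q.2) := by
    rw [extChartAt_prod, extChartAt_model_space_eq_id]; rfl
  have hsymm : ⇑(extChartAt (𝓘(ℝ, ℝ).prod I) p).symm =
      fun q : ℝ × E => (q.1, (extChartAt I p.2).symm q.2) := by
    rw [extChartAt_prod, extChartAt_model_space_eq_id]; rfl
  rw [htarget]
  refine ((contDiffOn_const (c := (1 : ℝ))).prodMk (hX p.2)).congr fun q hq => ?_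
  have h2 : MDifferentiableAt I 𝓘(ℝ, E) (extChartAt I p.2) ((extChartAt I p.2).symm q.2) := by
    apply mdifferentiableAt_extChartAt
    rw [← extChartAt_source I]
    exact (extChartAt I p.2).map_target hq.2
  have h3 := HasMFDerivAt.prodMk (hasMFDerivAt_fst (I := 𝓘(ℝ, ℝ)) (I' := I)
    (q.1, (extChartAt I p.2).symm q.2))
    (HasMFDerivAt.comp (q.1, (extChartAt I p.2).symm q.2) h2.hasMFDerivAt
      (hasMFDerivAt_snd (I := 𝓘(ℝ, ℝ)) (I' := I) (q.1, (extChartAt I p.2).symm q.2)))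
  have h3' : HasMFDerivAt (𝓘(ℝ, ℝ).prod I) 𝓘(ℝ, ℝ × E)
      (fun q : ℝ × M => (q.1, extChartAt I p.2 q.2)) (q.1, (extChartAt I p.2).symm q.2)
      ((ContinuousLinearMap.fst ℝ (TangentSpace 𝓘(ℝ, ℝ) q.1)
          (TangentSpace I ((extChartAt I p.2).symm q.2))).prod
        ((mfderiv I 𝓘(ℝ, E) (extChartAt I p.2) ((extChartAt I p.2).symm q.2)).comp
          (ContinuousLinearMap.snd ℝ (TangentSpace 𝓘(ℝ, ℝ) q.1)
            (TangentSpace I ((extChartAt I p.2).symm q.2))))) := by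
    rw [modelWithCornersSelf_prod, ← chartedSpaceSelf_prod]
    exact h3
  have h4 := DFunLike.congr_fun h3'.mfderiv (suspension X (q.1, (extChartAt I p.2).symm q.2))
  have h5 : vectorFieldInChart (suspension X) p q =
      mfderiv (𝓘(ℝ, ℝ).prod I) 𝓘(ℝ, ℝ × E) (fun q : ℝ × M => (q.1, extChartAt I p.2 q.2))
        (q.1, (extChartAt I p.2).symm q.2) (suspension X (q.1, (extChartAt I p.2).symm q.2)) := by
    unfold vectorFieldInChart
    rw [hsymm, hchart]
  exact h5.trans h4

/-- The time-one isotopy of a compactly supported time-dependent vector field. -/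
theorem exists_isotopy [CompactSpace M] [T2Space M] {X : ℝ → (x : M) → TangentSpace I x}
    (hX : ∀ c, ContDiffOn ℝ ∞ (fun p : ℝ × E => vectorFieldInChart (X p.1) c p.2)
      (univ ×ˢ (extChartAt I c).target))
    (hX0 : ∀ s ∉ Icc (0 : ℝ) 1, ∀ x, X s x = 0) :
    ∃ Φ : ℝ → (M ≃ₘ⟮I, I⟯ M),
      ContMDiff (𝓘(ℝ, ℝ).prod I) I ∞ (fun p : ℝ × M => Φ p.1 p.2) ∧ (∀ x, Φ 0 x = x) ∧
      ∀ x s, HasMFDerivAt 𝓘(ℝ, ℝ) I (fun s => Φ s x) s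
        ((1 : ℝ →L[ℝ] ℝ).smulRight (X s (Φ s x))) := by
  have h1M : IsManifold I 1 M := IsManifold.of_le (n := ∞) (by simp)
  have hW := contMDiff_suspension hX
  -- Starting outside [-1, 2], the time coordinate stays outside [0, 1] for one unit of time, where
  -- the suspension is ∂/∂s and its integral curves are straight.
  have hout : ∀ p : ℝ × M, p.1 ∉ Icc (-1 : ℝ) 2 → ∃ γ : ℝ → ℝ × M, γ 0 = p ∧
      IsMIntegralCurveOn γ (suspension X) (Ioo (-1) 1) := by
    intro p hp
    refine ⟨fun t => (p.1 + t, p.2), by simp, fun t ht => HasMFDerivAt.hasMFDerivWithinAt ?_⟩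
    have h1 : HasMFDerivAt 𝓘(ℝ, ℝ) 𝓘(ℝ, ℝ) (fun t : ℝ => p.1 + t) t
        ((1 : ℝ →L[ℝ] ℝ).smulRight (1 : ℝ)) :=
      ((hasDerivAt_id t).const_add p.1).hasFDerivAt.hasMFDerivAt
    have h2 := HasMFDerivAt.prodMk h1 (hasMFDerivAt_const (I := 𝓘(ℝ, ℝ)) (I' := I) p.2 t)
    have h3 : X (p.1 + t) p.2 = 0 := by
      refine hX0 _ (fun h => hp ⟨?_, ?_⟩) _
      · linarith [h.1, ht.2]
      · linarith [h.2, ht.1]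
    refine h2.congr_mfderiv (Eq.symm (ContinuousLinearMap.ext_ring ?_))
    change ((1 : ℝ) • ((1 : ℝ), X (p.1 + t) p.2) : ℝ × TangentSpace I p.2) = ((1 : ℝ) • (1 : ℝ), 0)
    rw [h3]; simp
  -- The remaining starting points form a compact set, so a uniform existence time exists and the
  -- suspension is complete.
  have hK : IsCompact (Icc (-1 : ℝ) 2 ×ˢ (univ : Set M)) := isCompact_Icc.prod isCompact_univ
  obtain ⟨ε, hε, hεK⟩ : ∃ ε > 0, ∀ p ∈ Icc (-1 : ℝ) 2 ×ˢ (univ : Set M), ∃ γ : ℝ → ℝ × M,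
      γ 0 = p ∧ IsMIntegralCurveOn γ (suspension X) (Ioo (-ε) ε) := by
    refine hK.induction_on (p := fun S => ∃ ε > 0, ∀ p ∈ S, ∃ γ : ℝ → ℝ × M,
      γ 0 = p ∧ IsMIntegralCurveOn γ (suspension X) (Ioo (-ε) ε)) ⟨1, one_pos, by simp⟩ ?_ ?_ ?_
    · rintro S T hST ⟨ε, hε, h⟩
      exact ⟨ε, hε, fun p hp => h p (hST hp)⟩
    · rintro S T ⟨ε, hε, h⟩ ⟨δ, hδ, h'⟩
      refine ⟨min ε δ, lt_min hε hδ, fun p hp => ?_⟩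
      rcases hp with hp | hp
      · obtain ⟨γ, h1, h2⟩ := h p hp
        exact ⟨γ, h1, h2.mono (Ioo_subset_Ioo (neg_le_neg (min_le_left _ _)) (min_le_left _ _))⟩
      · obtain ⟨γ, h1, h2⟩ := h' p hp
        exact ⟨γ, h1, h2.mono (Ioo_subset_Ioo (neg_le_neg (min_le_right _ _)) (min_le_right _ _))⟩
    · intro p _
      obtain ⟨ε, hε, h⟩ := exists_uniform_time_nhds hW p
      exact ⟨_, mem_nhdsWithin_of_mem_nhds h, ε, hε, fun q hq => hq⟩
  have hunif : ∀ p : ℝ × M, ∃ γ : ℝ → ℝ × M, γ 0 = p ∧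
      IsMIntegralCurveOn γ (suspension X) (Ioo (-min ε 1) (min ε 1)) := by
    intro p
    by_cases hp : p.1 ∈ Icc (-1 : ℝ) 2
    · obtain ⟨γ, h1, h2⟩ := hεK p ⟨hp, mem_univ _⟩
      exact ⟨γ, h1, h2.mono (Ioo_subset_Ioo (neg_le_neg (min_le_left _ _)) (min_le_left _ _))⟩
    · obtain ⟨γ, h1, h2⟩ := hout p hp
      exact ⟨γ, h1, h2.mono (Ioo_subset_Ioo (neg_le_neg (min_le_right _ _)) (min_le_right _ _))⟩
  choose Fl hFl0 hFl using exists_isMIntegralCurve_of_isMIntegralCurveOn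
    (hW.of_le (by simp)) (lt_min hε one_pos) hunif
  obtain ⟨hadd, hsm⟩ := contMDiff_flow hW hFl0 hFl
  have hfst : ∀ p t, (Fl p t).1 = p.1 + t := by
    intro p
    have h1 : ∀ t, HasDerivAt (fun t => (Fl p t).1 - t) 0 t := by
      intro t
      have h2 := HasMFDerivAt.comp t (hasMFDerivAt_fst (I := 𝓘(ℝ, ℝ)) (I' := I) (Fl p t))
        (hFl p t)
      have h3 : HasMFDerivAt 𝓘(ℝ, ℝ) 𝓘(ℝ, ℝ) (fun t => (Fl p t).1) t
          (ContinuousLinearMap.toSpanSingleton ℝ (1 : ℝ)) :=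
        h2.congr_mfderiv (ContinuousLinearMap.ext_ring rfl)
      have h4 : HasDerivAt (fun t => (Fl p t).1) 1 t := h3.hasFDerivAt
      exact (h4.sub (hasDerivAt_id t)).congr_deriv (sub_self _)
    intro t
    have h4 := is_const_of_deriv_eq_zero (fun t => (h1 t).differentiableAt) (fun t => (h1 t).deriv) t 0
    simp only [hFl0] at h4
    linarith
  have hpair : ∀ p t, Fl p t = (p.1 + t, (Fl p t).2) := fun p t => Prod.ext (hfst p t) rfl
  -- The map at time s flows from the slice at 0 to the slice at s; its inverse starts at slice s
  -- and flows back.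
  have hinv1 : ∀ s x, (Fl (s, (Fl (0, x) s).2) (-s)).2 = x := by
    intro s x
    have := hadd (0, x) s (-s)
    rw [hpair (0, x) s, add_neg_cancel, hFl0, zero_add] at this
    rw [this]
  have hinv2 : ∀ s x, (Fl (0, (Fl (s, x) (-s)).2) s).2 = x := by
    intro s x
    have := hadd (s, x) (-s) s
    rw [hpair (s, x) (-s), neg_add_cancel, hFl0, add_neg_cancel] at this
    rw [this]
  refine ⟨fun s => ⟨⟨fun x => (Fl (0, x) s).2, fun x => (Fl (s, x) (-s)).2, hinv1 s, hinv2 s⟩,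
    ?_, ?_⟩, ?_, ?_, ?_⟩
  · exact contMDiff_snd.comp (hsm.comp (f := fun x : M => (s, ((0 : ℝ), x)))
      (contMDiff_const.prodMk (contMDiff_const.prodMk contMDiff_id)))
  · exact contMDiff_snd.comp (hsm.comp (f := fun x : M => (-s, (s, x)))
      (contMDiff_const.prodMk (contMDiff_const.prodMk contMDiff_id)))
  · exact contMDiff_snd.comp (hsm.comp (f := fun p : ℝ × M => (p.1, ((0 : ℝ), p.2)))
      (contMDiff_fst.prodMk (contMDiff_const.prodMk contMDiff_snd)))
  · intro x
    change (Fl (0, x) 0).2 = x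
    rw [hFl0]
  · intro x s
    have h2 := HasMFDerivAt.comp s (hasMFDerivAt_snd (I := 𝓘(ℝ, ℝ)) (I' := I) (Fl (0, x) s))
        (hFl (0, x) s)
    refine h2.congr_mfderiv (ContinuousLinearMap.ext_ring ?_)
    change (1 : ℝ) • X (Fl (0, x) s).1 (Fl (0, x) s).2 = (1 : ℝ) • X s (Fl (0, x) s).2
    rw [hfst, zero_add]

end Isotopy

/-! ### Linear algebra of covectors and two-forms on three-space -/

/-- Three-dimensional Euclidean space. -/
abbrev Space3 := EuclideanSpace ℝ (Fin 3)

/-- The standard basis vectors. -/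
noncomputable abbrev stdVec (i : Fin 3) : Space3 := EuclideanSpace.single i 1

theorem Space3.eq_sum (u : Space3) : u = u 0 • stdVec 0 + u 1 • stdVec 1 + u 2 • stdVec 2 := by
  ext i
  fin_cases i <;> simp

theorem Space3.apply_eq (a : Space3 →L[ℝ] ℝ) (u : Space3) :
    a u = u 0 * a (stdVec 0) + u 1 * a (stdVec 1) + u 2 * a (stdVec 2) := by
  conv_lhs => rw [Space3.eq_sum u]
  simp

/-- The cross product of two covectors, as a vector. -/
noncomputable def covectorCross (a b : Space3 →L[ℝ] ℝ) : Space3 :=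
  !₂[a (stdVec 1) * b (stdVec 2) - a (stdVec 2) * b (stdVec 1),
    a (stdVec 2) * b (stdVec 0) - a (stdVec 0) * b (stdVec 2),
    a (stdVec 0) * b (stdVec 1) - a (stdVec 1) * b (stdVec 0)]

theorem covectorCross_eq (a b : Space3 →L[ℝ] ℝ) : covectorCross a b =
    (a (stdVec 1) * b (stdVec 2) - a (stdVec 2) * b (stdVec 1)) • stdVec 0 +
    (a (stdVec 2) * b (stdVec 0) - a (stdVec 0) * b (stdVec 2)) • stdVec 1 +
    (a (stdVec 0) * b (stdVec 1) - a (stdVec 1) * b (stdVec 0)) • stdVec 2 :=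
  Space3.eq_sum _

/-- The vector representing a bilinear form `κ` on three-space through `κ u v = ⟪W, u × v⟫`. -/
noncomputable def twoFormVec (κ : Space3 → Space3 → ℝ) : Space3 :=
  !₂[κ (stdVec 1) (stdVec 2), κ (stdVec 2) (stdVec 0), κ (stdVec 0) (stdVec 1)]

/-- Alternating bilinear forms, unbundled. -/
structure IsTwoForm (κ : Space3 → Space3 → ℝ) : Prop where
  add_left : ∀ u u' v, κ (u + u') v = κ u v + κ u' v
  smul_left : ∀ (r : ℝ) u v, κ (r • u) v = r * κ u v
  antisymm : ∀ u v, κ u v = - κ v u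

theorem IsTwoForm.self_eq_zero {κ : Space3 → Space3 → ℝ} (h : IsTwoForm κ) (u : Space3) :
    κ u u = 0 := by linarith [h.antisymm u u]

theorem IsTwoForm.apply_eq {κ : Space3 → Space3 → ℝ} (h : IsTwoForm κ) (u v : Space3) :
    κ u v = twoFormVec κ 0 * (u 1 * v 2 - u 2 * v 1) + twoFormVec κ 1 * (u 2 * v 0 - u 0 * v 2) +
      twoFormVec κ 2 * (u 0 * v 1 - u 1 * v 0) := by
  have key : ∀ (i : Fin 3) (v : Space3), κ (stdVec i) v =
      v 0 * κ (stdVec i) (stdVec 0) + v 1 * κ (stdVec i) (stdVec 1) +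
      v 2 * κ (stdVec i) (stdVec 2) := by
    intro i v
    rw [h.antisymm]
    conv_lhs => rw [Space3.eq_sum v]
    rw [h.add_left, h.add_left, h.smul_left, h.smul_left, h.smul_left,
      h.antisymm (stdVec 0) (stdVec i), h.antisymm (stdVec 1) (stdVec i),
      h.antisymm (stdVec 2) (stdVec i)]
    ring
  conv_lhs => rw [Space3.eq_sum u]
  rw [h.add_left, h.add_left, h.smul_left, h.smul_left, h.smul_left, key 0 v, key 1 v, key 2 v,
    h.self_eq_zero, h.self_eq_zero, h.self_eq_zero, h.antisymm (stdVec 1) (stdVec 0),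
    h.antisymm (stdVec 2) (stdVec 1), h.antisymm (stdVec 0) (stdVec 2)]
  simp [twoFormVec]
  ring

theorem isTwoForm_flatD (a : Space3 → Space3 →L[ℝ] ℝ) (y : Space3) : IsTwoForm (flatD a y) where
  add_left u u' v := by simp [flatD]; ring
  smul_left r u v := by simp [flatD]; ring
  antisymm u v := by simp [flatD]

theorem IsTwoForm.comp {κ : Space3 → Space3 → ℝ} (h : IsTwoForm κ) (L : Space3 →L[ℝ] Space3) :
    IsTwoForm (fun u v => κ (L u) (L v)) where
  add_left u u' v := by simp [h.add_left]
  smul_left r u v := by simp [h.smul_left]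
  antisymm u v := h.antisymm _ _

theorem det_eq (L : Space3 →L[ℝ] Space3) : L.det =
    L (stdVec 0) 0 * (L (stdVec 1) 1 * L (stdVec 2) 2 - L (stdVec 2) 1 * L (stdVec 1) 2)
    - L (stdVec 1) 0 * (L (stdVec 0) 1 * L (stdVec 2) 2 - L (stdVec 2) 1 * L (stdVec 0) 2)
    + L (stdVec 2) 0 * (L (stdVec 0) 1 * L (stdVec 1) 2 - L (stdVec 1) 1 * L (stdVec 0) 2) := by
  rw [ContinuousLinearMap.det,
    ← LinearMap.det_toMatrix (EuclideanSpace.basisFun (Fin 3) ℝ).toBasis, Matrix.det_fin_three]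
  simp [LinearMap.toMatrix_apply]
  ring

/-- The cross product V is defined by ι_V vol = a ∧ b, and L pulls vol back to det L times itself.
As a polynomial identity this also holds for singular L. -/
theorem map_covectorCross_comp (L : Space3 →L[ℝ] Space3) (a b : Space3 →L[ℝ] ℝ) :
    L (covectorCross (a.comp L) (b.comp L)) = L.det • covectorCross a b := by
  rw [Space3.eq_sum (covectorCross (a.comp L) (b.comp L)), det_eq]
  ext i
  simp only [covectorCross, ContinuousLinearMap.comp_apply]
  simp only [Space3.apply_eq a (L _), Space3.apply_eq b (L _)]
  fin_cases i <;> simp <;> ring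

theorem map_twoFormVec_comp (L : Space3 →L[ℝ] Space3) {κ : Space3 → Space3 → ℝ}
    (h : IsTwoForm κ) :
    L (twoFormVec (fun u v => κ (L u) (L v))) = L.det • twoFormVec κ := by
  rw [Space3.eq_sum (twoFormVec (fun u v => κ (L u) (L v))), det_eq]
  ext i
  conv_lhs => unfold twoFormVec
  simp only [h.apply_eq (L _) (L _)]
  fin_cases i <;> simp <;> ring

theorem covector_twoFormVec_comp (L : Space3 →L[ℝ] Space3) {κ : Space3 → Space3 → ℝ}
    (h : IsTwoForm κ) (a : Space3 →L[ℝ] ℝ) :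
    a.comp L (twoFormVec (fun u v => κ (L u) (L v))) = L.det * a (twoFormVec κ) := by
  rw [ContinuousLinearMap.comp_apply, map_twoFormVec_comp L h, map_smul, smul_eq_mul]

/-- A vector in the kernel of a two-form is a multiple of the vector representing it. -/
theorem IsTwoForm.eq_smul_of_ker {κ : Space3 → Space3 → ℝ} (h : IsTwoForm κ)
    (a : Space3 →L[ℝ] ℝ) {R : Space3} (hR : ∀ v, κ R v = 0) :
    a (twoFormVec κ) • R = a R • twoFormVec κ := by
  have h0 := hR (stdVec 0)
  have h1 := hR (stdVec 1)
  have h2 := hR (stdVec 2)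
  rw [h.apply_eq] at h0 h1 h2
  simp at h0 h1 h2
  rw [Space3.apply_eq a R, Space3.apply_eq a (twoFormVec κ)]
  ext i
  fin_cases i <;> simp
  · linear_combination a (stdVec 2) * h1 - a (stdVec 1) * h2
  · linear_combination a (stdVec 0) * h2 - a (stdVec 2) * h0
  · linear_combination a (stdVec 1) * h0 - a (stdVec 0) * h1

theorem apply_covectorCross_left (a b : Space3 →L[ℝ] ℝ) : a (covectorCross a b) = 0 := by
  rw [Space3.apply_eq]; simp [covectorCross]; ring

theorem apply_covectorCross_right (a b : Space3 →L[ℝ] ℝ) : b (covectorCross a b) = 0 := by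
  rw [Space3.apply_eq]; simp [covectorCross]; ring

/-- This is the identity W × (a × b) = b(W) a - a(W) b for the vector W of κ. It makes Gray's
equation explicitly solvable. -/
theorem IsTwoForm.apply_covectorCross {κ : Space3 → Space3 → ℝ} (h : IsTwoForm κ)
    (a b : Space3 →L[ℝ] ℝ) (v : Space3) :
    κ (covectorCross a b) v = b (twoFormVec κ) * a v - a (twoFormVec κ) * b v := by
  rw [h.apply_eq, Space3.apply_eq a v, Space3.apply_eq b v, Space3.apply_eq a (twoFormVec κ),
    Space3.apply_eq b (twoFormVec κ)]
  simp [covectorCross]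
  ring

/-! ### Exterior derivative under pullback, Lie derivative along a flow, divergence -/

theorem flatD_pullback {E F : Type*} [NormedAddCommGroup E] [NormedSpace ℝ E]
    [NormedAddCommGroup F] [NormedSpace ℝ F] {a : F → F →L[ℝ] ℝ}
    {b : E → E →L[ℝ] ℝ} {τ : E → F} {y : E} (hτ : ContDiffAt ℝ ∞ τ y)
    (ha : DifferentiableAt ℝ a (τ y)) (hb : b =ᶠ[𝓝 y] fun z => (a (τ z)).comp (fderiv ℝ τ z))
    (u v : E) : flatD b y u v = flatD a (τ y) (fderiv ℝ τ y u) (fderiv ℝ τ y v) := by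
  have h1 : HasFDerivAt τ (fderiv ℝ τ y) y := (hτ.differentiableAt (by simp)).hasFDerivAt
  have h2 : HasFDerivAt (fderiv ℝ τ) (fderiv ℝ (fderiv ℝ τ) y) y :=
    ((hτ.fderiv_right (m := 1) (by norm_cast)).differentiableAt (by simp)).hasFDerivAt
  have h3 := (ha.hasFDerivAt.comp y h1).clm_comp h2
  have hsymm : IsSymmSndFDerivAt ℝ τ y := by
    apply hτ.isSymmSndFDerivAt
    simp only [minSmoothness_of_isRCLikeNormedField]
    exact WithTop.coe_le_coe.2 (le_top (a := ((2 : ℕ) : ℕ∞)))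
  have h4 := hsymm u v
  simp only [flatD, hb.fderiv_eq]
  rw [show fderiv ℝ (fun z => (a (τ z)).comp (fderiv ℝ τ z)) y = _ from h3.fderiv]
  simp [h4]

/-- Gray's computation: the derivative of `a_s (DG_s v)` along a flow `G` of a field `X`
that lies in the kernel of the forms `a_s`. -/
theorem hasDerivAt_pullback_form {E : Type*} [NormedAddCommGroup E] [NormedSpace ℝ E]
    {G X : ℝ × E → E} {a : ℝ × E → E →L[ℝ] ℝ} {s₀ : ℝ} {z₀ : E}
    (hG : ContDiffAt ℝ ∞ G (s₀, z₀)) (hX : ContDiffAt ℝ ∞ X (s₀, G (s₀, z₀)))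
    (ha : ContDiffAt ℝ ∞ a (s₀, G (s₀, z₀)))
    (hflow : ∀ᶠ p in 𝓝 (s₀, z₀), fderiv ℝ G p (1, 0) = X (p.1, G p))
    (haX : ∀ᶠ q in 𝓝 (s₀, G (s₀, z₀)), a q (X q) = 0) {h : ℝ}
    (hgray : ∀ v, fderiv ℝ a (s₀, G (s₀, z₀)) (1, 0) v +
      flatD (fun y => a (s₀, y)) (G (s₀, z₀)) (X (s₀, G (s₀, z₀))) v = h * a (s₀, G (s₀, z₀)) v)
    (v : E) :
    HasDerivAt (fun s => a (s, G (s, z₀)) (fderiv ℝ G (s, z₀) (0, v)))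
      (h * a (s₀, G (s₀, z₀)) (fderiv ℝ G (s₀, z₀) (0, v))) s₀ := by
  set p₀ : ℝ × E := (s₀, z₀) with hp₀
  set q₀ : ℝ × E := (s₀, G p₀) with hq₀
  set w := fderiv ℝ G p₀ (0, v) with hw
  have dG : HasFDerivAt G (fderiv ℝ G p₀) p₀ := (hG.differentiableAt (by simp)).hasFDerivAt
  have ddG : HasFDerivAt (fderiv ℝ G) (fderiv ℝ (fderiv ℝ G) p₀) p₀ :=
    ((hG.fderiv_right (m := 1) (by norm_cast)).differentiableAt (by simp)).hasFDerivAt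
  have dX : HasFDerivAt X (fderiv ℝ X q₀) q₀ := (hX.differentiableAt (by simp)).hasFDerivAt
  have da : HasFDerivAt a (fderiv ℝ a q₀) q₀ := (ha.differentiableAt (by simp)).hasFDerivAt
  have hsymm : IsSymmSndFDerivAt ℝ G p₀ := by
    apply hG.isSymmSndFDerivAt
    simp only [minSmoothness_of_isRCLikeNormedField]
    exact WithTop.coe_le_coe.2 (le_top (a := ((2 : ℕ) : ℕ∞)))
  have hc : HasDerivAt (fun s : ℝ => (s, z₀)) ((1 : ℝ), (0 : E)) s₀ :=
    (hasDerivAt_id s₀).prodMk (hasDerivAt_const s₀ z₀)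
  have hGs : HasDerivAt (fun s => G (s, z₀)) (X q₀) s₀ := by
    have := dG.comp_hasDerivAt s₀ hc
    rwa [hflow.self_of_nhds] at this
  have hcq : HasDerivAt (fun s => (s, G (s, z₀))) ((1 : ℝ), X q₀) s₀ :=
    (hasDerivAt_id s₀).prodMk hGs
  have has : HasDerivAt (fun s => a (s, G (s, z₀))) (fderiv ℝ a q₀ (1, X q₀)) s₀ :=
    HasFDerivAt.comp_hasDerivAt s₀ da hcq
  have hws : HasDerivAt (fun s => fderiv ℝ G (s, z₀) (0, v))
      -- The mixed second derivative of G arises from differentiating the pushed-forward vector in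
      -- s.
      (fderiv ℝ (fderiv ℝ G) p₀ (1, 0) (0, v)) s₀ := by
    have h1 := HasFDerivAt.comp_hasDerivAt s₀ ddG hc
    exact ((ContinuousLinearMap.apply ℝ E ((0 : ℝ), v)).hasFDerivAt.comp_hasDerivAt s₀ h1)
  -- Symmetry of second derivatives lets the flow equation be differentiated in the direction v
  -- instead.
  have hmix : fderiv ℝ (fderiv ℝ G) p₀ (1, 0) (0, v) = fderiv ℝ X q₀ (0, w) := by
    rw [hsymm (1, 0) (0, v)]
    have h1 : HasFDerivAt (fun p => fderiv ℝ G p (1, 0))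
        ((ContinuousLinearMap.apply ℝ E ((1 : ℝ), (0 : E))).comp (fderiv ℝ (fderiv ℝ G) p₀)) p₀ :=
      (ContinuousLinearMap.apply ℝ E ((1 : ℝ), (0 : E))).hasFDerivAt.comp p₀ ddG
    have h2 : HasFDerivAt (fun p => X (p.1, G p)) ((fderiv ℝ X q₀).comp
        ((ContinuousLinearMap.fst ℝ ℝ E).prod (fderiv ℝ G p₀))) p₀ :=
      HasFDerivAt.comp p₀ dX (hasFDerivAt_fst.prodMk dG)
    have h3 := h1.unique (h2.congr_of_eventuallyEq hflow)
    simpa using DFunLike.congr_fun h3 (0, v)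
  -- Differentiating a(X) = 0 along w trades a(D_w X) for -(D_w a)(X), which completes ι_X da in
  -- Cartan's formula.
  have hker : fderiv ℝ a q₀ (0, w) (X q₀) + a q₀ (fderiv ℝ X q₀ (0, w)) = 0 := by
    have h1 := (da.clm_apply dX).congr_of_eventuallyEq
      (f₁ := fun _ => (0 : ℝ)) (haX.mono fun _ h => h.symm)
    have h2 := DFunLike.congr_fun (h1.unique (hasFDerivAt_const 0 q₀)) (0, w)
    simp at h2
    linarith
  have hpart : fderiv ℝ (fun y => a (s₀, y)) (G p₀) =
      (fderiv ℝ a q₀).comp (ContinuousLinearMap.inr ℝ ℝ E) := by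
    have h1 : HasFDerivAt (fun y : E => (s₀, y)) (ContinuousLinearMap.inr ℝ ℝ E) (G p₀) :=
      hasFDerivAt_prodMk_right s₀ (G p₀)
    exact (HasFDerivAt.comp (G p₀) da h1).fderiv
  have hg := hgray w
  simp only [flatD, hpart, ContinuousLinearMap.comp_apply, ContinuousLinearMap.inr_apply] at hg
  refine (has.clm_apply hws).congr_deriv ?_
  have hsplit : fderiv ℝ a q₀ (1, X q₀) = fderiv ℝ a q₀ (1, 0) + fderiv ℝ a q₀ (0, X q₀) := by
    rw [← map_add]; simp
  rw [hsplit, hmix, add_apply]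
  linarith

/-- The divergence of a vector field on three-space. -/
noncomputable def diverg (V : Space3 → Space3) (y : Space3) : ℝ :=
  ∑ i, fderiv ℝ V y (stdVec i) i

/-- The classical div (a × b) = b · curl a - a · curl b, that is d(a ∧ b) = da ∧ b - a ∧ db. -/
theorem diverg_covectorCross {a b : Space3 → Space3 →L[ℝ] ℝ} {y : Space3}
    (ha : DifferentiableAt ℝ a y) (hb : DifferentiableAt ℝ b y) :
    DifferentiableAt ℝ (fun y => covectorCross (a y) (b y)) y ∧
    diverg (fun y => covectorCross (a y) (b y)) y =
      b y (twoFormVec (flatD a y)) - a y (twoFormVec (flatD b y)) := by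
  have hc : ∀ {c : Space3 → Space3 →L[ℝ] ℝ}, DifferentiableAt ℝ c y → ∀ i,
      HasFDerivAt (fun y => c y (stdVec i))
        ((ContinuousLinearMap.apply ℝ ℝ (stdVec i)).comp (fderiv ℝ c y)) y := fun hc i =>
    (ContinuousLinearMap.apply ℝ ℝ (stdVec i)).hasFDerivAt.comp y hc.hasFDerivAt
  have h : ∀ i j, HasFDerivAt (fun y => a y (stdVec i) * b y (stdVec j) -
      a y (stdVec j) * b y (stdVec i)) _ y := fun i j =>
    ((hc ha i).mul (hc hb j)).sub ((hc ha j).mul (hc hb i))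
  have hV := (((h 1 2).smul_const (stdVec 0)).add ((h 2 0).smul_const (stdVec 1))).add
    ((h 0 1).smul_const (stdVec 2))
  have hV' : HasFDerivAt (fun y => covectorCross (a y) (b y)) _ y :=
    hV.congr_of_eventuallyEq (.of_forall fun y => covectorCross_eq (a y) (b y))
  refine ⟨hV'.differentiableAt, ?_⟩
  rw [diverg, hV'.fderiv, Fin.sum_univ_three, Space3.apply_eq (a y) (twoFormVec _),
    Space3.apply_eq (b y) (twoFormVec _)]
  simp [twoFormVec, flatD]
  ring

theorem diverg_smul {f : Space3 → ℝ} {V : Space3 → Space3} {y : Space3}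
    (hf : DifferentiableAt ℝ f y) (hV : DifferentiableAt ℝ V y) :
    diverg (fun z => f z • V z) y = f y * diverg V y + fderiv ℝ f y (V y) := by
  rw [diverg, show fderiv ℝ (fun z => f z • V z) y = _ from
    (hf.hasFDerivAt.smul hV.hasFDerivAt).fderiv, Space3.apply_eq (fderiv ℝ f y) (V y),
    diverg, Fin.sum_univ_three, Fin.sum_univ_three]
  simp
  ring

theorem twoFormVec_eq (κ : Space3 → Space3 → ℝ) : twoFormVec κ =
    κ (stdVec 1) (stdVec 2) • stdVec 0 + κ (stdVec 2) (stdVec 0) • stdVec 1 +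
    κ (stdVec 0) (stdVec 1) • stdVec 2 :=
  Space3.eq_sum _

theorem ContDiffAt.covectorCross {E : Type*} [NormedAddCommGroup E] [NormedSpace ℝ E]
    {n : WithTop ℕ∞} {a b : E → Space3 →L[ℝ] ℝ} {y : E} (ha : ContDiffAt ℝ n a y)
    (hb : ContDiffAt ℝ n b y) : ContDiffAt ℝ n (fun y => covectorCross (a y) (b y)) y := by
  simp only [covectorCross_eq]
  fun_prop

theorem ContDiffAt.twoFormVec_flatD {a : Space3 → Space3 →L[ℝ] ℝ} {y : Space3}
    (ha : ContDiffAt ℝ ∞ a y) : ContDiffAt ℝ ∞ (fun y => twoFormVec (flatD a y)) y := by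
  have : ContDiffAt ℝ ∞ (fderiv ℝ a) y := ha.fderiv_right (by norm_cast)
  simp only [twoFormVec_eq, flatD]
  fun_prop

/-! ### One-forms on the manifold and their chart expressions -/

section Forms

variable {M : Type*} [TopologicalSpace M] [ChartedSpace Space3 M]

/-- A 1-form is smooth if all its coordinate expressions are. -/
def IsSmoothForm (α : (x : M) → TangentSpace (𝓡 3) x →L[ℝ] ℝ) : Prop :=
  ∀ c, ContDiffOn ℝ ∞ (oneFormInChart α c) (extChartAt (𝓡 3) c).target

theorem IsSmoothForm.contDiffAt {α : (x : M) → TangentSpace (𝓡 3) x →L[ℝ] ℝ}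
    (h : IsSmoothForm α) {c : M} {y : Space3} (hy : y ∈ (extChartAt (𝓡 3) c).target) :
    ContDiffAt ℝ ∞ (oneFormInChart α c) y :=
  (h c).contDiffAt ((isOpen_extChartAt_target c).mem_nhds hy)

/-- The value of a 1-form at a point as a covector on the model space. -/
def covectorAt (α : (x : M) → TangentSpace (𝓡 3) x →L[ℝ] ℝ) (x : M) : Space3 →L[ℝ] ℝ := α x

/-- The derivative of the preferred chart at `c`, as a map of the model space. -/
noncomputable def chartDeriv (c x : M) : Space3 →L[ℝ] Space3 :=
  mfderiv (𝓡 3) 𝓘(ℝ, Space3) (extChartAt (𝓡 3) c) x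

/-- The exterior derivative of a 1-form at a point as a two-form on the model space. -/
noncomputable def twoFormAt (α : (x : M) → TangentSpace (𝓡 3) x →L[ℝ] ℝ) (x : M)
    (u v : Space3) : ℝ :=
  oneFormD α x u v

/-- The value of `α ∧ dβ` on the standard frame at `x`. -/
noncomputable def wedgeAt (α β : (x : M) → TangentSpace (𝓡 3) x →L[ℝ] ℝ) (x : M) : ℝ :=
  covectorAt α x (twoFormVec (twoFormAt β x))

/-- The coordinate function of `α ∧ dβ` in the preferred chart at `c`. -/
noncomputable def wedgeInChart (α β : (x : M) → TangentSpace (𝓡 3) x →L[ℝ] ℝ) (c : M)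
    (y : Space3) : ℝ :=
  oneFormInChart α c y (twoFormVec (flatD (oneFormInChart β c) y))

theorem IsSmoothForm.contDiffAt_wedgeInChart {α β : (x : M) → TangentSpace (𝓡 3) x →L[ℝ] ℝ}
    (hα : IsSmoothForm α) (hβ : IsSmoothForm β) {c : M} {y : Space3}
    (hy : y ∈ (extChartAt (𝓡 3) c).target) : ContDiffAt ℝ ∞ (wedgeInChart α β c) y :=
  (hα.contDiffAt hy).clm_apply (hβ.contDiffAt hy).twoFormVec_flatD

theorem isTwoForm_twoFormAt (α : (x : M) → TangentSpace (𝓡 3) x →L[ℝ] ℝ) (x : M) :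
    IsTwoForm (twoFormAt α x) :=
  (isTwoForm_flatD _ _).comp (chartDeriv x x)

/-- Three-forms on three-space are multiples of the determinant, and the multiple for α ∧ dα is
`wedgeAt α α x`. -/
theorem wedgeAt_ne_zero {α : (x : M) → TangentSpace (𝓡 3) x →L[ℝ] ℝ} {x : M}
    (h : ∃ u v w : TangentSpace (𝓡 3) x, wedgeD α x u v w ≠ 0) : wedgeAt α α x ≠ 0 := by
  obtain ⟨u, v, w, h⟩ := h
  intro h0
  refine h ?_
  rw [wedgeAt, Space3.apply_eq] at h0
  have key : ∀ (a : Space3 →L[ℝ] ℝ) (W u v w : Space3),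
      a u * (W 0 * (v 1 * w 2 - v 2 * w 1) + W 1 * (v 2 * w 0 - v 0 * w 2) +
        W 2 * (v 0 * w 1 - v 1 * w 0)) +
      a v * (W 0 * (w 1 * u 2 - w 2 * u 1) + W 1 * (w 2 * u 0 - w 0 * u 2) +
        W 2 * (w 0 * u 1 - w 1 * u 0)) +
      a w * (W 0 * (u 1 * v 2 - u 2 * v 1) + W 1 * (u 2 * v 0 - u 0 * v 2) +
        W 2 * (u 0 * v 1 - u 1 * v 0)) =
      (W 0 * a (stdVec 0) + W 1 * a (stdVec 1) + W 2 * a (stdVec 2)) *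
      (u 0 * (v 1 * w 2 - v 2 * w 1) + u 1 * (v 2 * w 0 - v 0 * w 2) +
        u 2 * (v 0 * w 1 - v 1 * w 0)) := by
    intro a W u v w
    rw [Space3.apply_eq a u, Space3.apply_eq a v, Space3.apply_eq a w]
    ring
  have h2 := isTwoForm_twoFormAt α x
  have h3 : ∀ u v w : Space3, covectorAt α x u * twoFormAt α x v w +
      covectorAt α x v * twoFormAt α x w u + covectorAt α x w * twoFormAt α x u v = 0 := by
    intro u v w
    rw [h2.apply_eq v w, h2.apply_eq w u, h2.apply_eq u v, key, h0, zero_mul]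
  exact h3 u v w

variable [IsManifold (𝓡 3) ∞ M]

/-- In the trivialization of the cotangent bundle at c, a section is composed with the derivative of
the inverse chart, which is exactly its coordinate expression. -/
theorem IsContactFormOn.isSmoothForm {α : (x : M) → TangentSpace (𝓡 3) x →L[ℝ] ℝ}
    (h : IsContactFormOn α univ) : IsSmoothForm α := by
  intro c
  have h1M : IsManifold (𝓡 3) 1 M := IsManifold.of_le (n := ∞) (by simp)
  have h1 := (trivializationAt (Space3 →L[ℝ] ℝ)
    (fun x : M => TangentSpace (𝓡 3) x →L[ℝ] Bundle.Trivial M ℝ x) c).contMDiffOn_section_baseSet_iff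
    (IB := 𝓡 3) (n := ∞) (s := α)
  have h2 := h1.1 (h.smooth.mono (subset_univ _))
  have hbase : (trivializationAt (Space3 →L[ℝ] ℝ)
      (fun x : M => TangentSpace (𝓡 3) x →L[ℝ] Bundle.Trivial M ℝ x) c).baseSet =
      (chartAt Space3 c).source := by
    rw [hom_trivializationAt_baseSet, TangentBundle.trivializationAt_baseSet]
    simp
  rw [hbase, contMDiffOn_chart_source_iff] at h2
  refine h2.congr fun y hy => ?_
  have hx : (extChartAt (𝓡 3) c).symm y ∈ (chartAt Space3 c).source := by
    rw [← extChartAt_source (𝓡 3)]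
    exact (extChartAt (𝓡 3) c).map_target hy
  rw [hom_trivializationAt_apply]
  have h3 := TangentBundle.symmL_trivializationAt (I := 𝓡 3) hx
  rw [(extChartAt (𝓡 3) c).right_inv hy, ModelWithCorners.range_eq_univ, mfderivWithin_univ] at h3
  simp only [ContinuousLinearMap.inCoordinates]
  rw [h3]
  have h4 : ∀ x : M, (trivializationAt ℝ (Bundle.Trivial M ℝ) c).continuousLinearMapAt ℝ x =
      ContinuousLinearMap.id ℝ ℝ :=
    fun x => Bundle.Trivial.continuousLinearMapAt_trivialization ℝ M ℝ x
  rw [h4]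
  rfl

theorem oneFormInChart_comp_chartDeriv (α : (x : M) → TangentSpace (𝓡 3) x →L[ℝ] ℝ) {c x : M}
    (hx : x ∈ (extChartAt (𝓡 3) c).source) :
    (oneFormInChart α c (extChartAt (𝓡 3) c x)).comp (chartDeriv c x) = covectorAt α x := by
  obtain ⟨y, hy, rfl⟩ : ∃ y ∈ (extChartAt (𝓡 3) c).target, (extChartAt (𝓡 3) c).symm y = x :=
    ⟨_, (extChartAt (𝓡 3) c).map_source hx, (extChartAt (𝓡 3) c).left_inv hx⟩
  rw [(extChartAt (𝓡 3) c).right_inv hy]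
  ext v
  exact congrArg (α _) (mfderiv_extChartAt_symm_comp hy v)

theorem contDiffAt_transition {c x : M} {z : Space3} (hz : z ∈ (extChartAt (𝓡 3) x).target)
    (hx : (extChartAt (𝓡 3) x).symm z ∈ (extChartAt (𝓡 3) c).source) :
    ContDiffAt ℝ ∞ (extChartAt (𝓡 3) c ∘ (extChartAt (𝓡 3) x).symm) z := by
  rw [← contMDiffAt_iff_contDiffAt]
  refine ContMDiffAt.comp z (contMDiffAt_extChartAt' (by rwa [extChartAt_source] at hx)) ?_
  exact (contMDiffOn_extChartAt_symm x).contMDiffAt ((isOpen_extChartAt_target x).mem_nhds hz)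

theorem fderiv_transition {c x : M} {z : Space3} (hz : z ∈ (extChartAt (𝓡 3) x).target)
    (hx : (extChartAt (𝓡 3) x).symm z ∈ (extChartAt (𝓡 3) c).source) (v : Space3) :
    fderiv ℝ (extChartAt (𝓡 3) c ∘ (extChartAt (𝓡 3) x).symm) z v =
      chartDeriv c ((extChartAt (𝓡 3) x).symm z)
        (mfderiv 𝓘(ℝ, Space3) (𝓡 3) (extChartAt (𝓡 3) x).symm z v) := by
  have h1M : IsManifold (𝓡 3) 1 M := IsManifold.of_le (n := ∞) (by simp)
  rw [extChartAt_source] at hx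
  rw [← mfderiv_eq_fderiv, mfderiv_comp z (mdifferentiableAt_extChartAt hx)
    (mdifferentiableAt_extChartAt_symm_of_mem hz)]
  rfl

theorem fderiv_transition_self {c x : M} (hx : x ∈ (extChartAt (𝓡 3) c).source) :
    fderiv ℝ (extChartAt (𝓡 3) c ∘ (extChartAt (𝓡 3) x).symm) (extChartAt (𝓡 3) x x) =
      chartDeriv c x := by
  have h1M : IsManifold (𝓡 3) 1 M := IsManifold.of_le (n := ∞) (by simp)
  rw [extChartAt_source] at hx
  have h := mdifferentiableAt_extChartAt (I := 𝓡 3) hx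
  rw [chartDeriv, h.mfderiv, ModelWithCorners.range_eq_univ, fderivWithin_univ]
  rfl

/-- `oneFormD` uses a different chart at each point. Naturality of d under transition maps expresses
it in one fixed chart, as continuity and integration require. -/
theorem twoFormAt_eq {α : (x : M) → TangentSpace (𝓡 3) x →L[ℝ] ℝ} (hα : IsSmoothForm α) {c x : M}
    (hx : x ∈ (extChartAt (𝓡 3) c).source) (u v : Space3) :
    twoFormAt α x u v = flatD (oneFormInChart α c) (extChartAt (𝓡 3) c x)
      (chartDeriv c x u) (chartDeriv c x v) := by
  have h1M : IsManifold (𝓡 3) 1 M := IsManifold.of_le (n := ∞) (by simp)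
  have hxx : (extChartAt (𝓡 3) x).symm (extChartAt (𝓡 3) x x) ∈ (extChartAt (𝓡 3) c).source := by
    rwa [extChartAt_to_inv]
  have hmem := mem_extChartAt_target (I := 𝓡 3) x
  have hτ := contDiffAt_transition hmem hxx
  have h2 := flatD_pullback (a := oneFormInChart α c) (b := oneFormInChart α x) hτ ?_ ?_ u v
  · rw [fderiv_transition_self hx, Function.comp_apply, extChartAt_to_inv] at h2
    rw [← h2]
    have h3 : chartDeriv x x = ContinuousLinearMap.id ℝ Space3 := mfderiv_extChartAt_self
    change flatD _ _ (chartDeriv x x u) (chartDeriv x x v) = _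
    rw [h3]
    rfl
  · rw [Function.comp_apply, extChartAt_to_inv]
    exact (hα.contDiffAt ((extChartAt (𝓡 3) c).map_source hx)).differentiableAt (by simp)
  · have hev : ∀ᶠ z in 𝓝 (extChartAt (𝓡 3) x x), z ∈ (extChartAt (𝓡 3) x).target ∧
        (extChartAt (𝓡 3) x).symm z ∈ (extChartAt (𝓡 3) c).source :=
      ((isOpen_extChartAt_target x).eventually_mem hmem).and
        ((continuousAt_extChartAt_symm x).eventually_mem
          ((isOpen_extChartAt_source c).mem_nhds hxx))
    filter_upwards [hev] with z hz
    ext w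
    rw [ContinuousLinearMap.comp_apply, fderiv_transition hz.1 hz.2, Function.comp_apply]
    exact (DFunLike.congr_fun (oneFormInChart_comp_chartDeriv α hz.2)
      (mfderiv 𝓘(ℝ, Space3) (𝓡 3) (extChartAt (𝓡 3) x).symm z w)).symm

theorem chartDeriv_det_ne_zero {c x : M} (hx : x ∈ (extChartAt (𝓡 3) c).source) :
    (chartDeriv c x).det ≠ 0 := by
  have h1M : IsManifold (𝓡 3) 1 M := IsManifold.of_le (n := ∞) (by simp)
  obtain ⟨e, he⟩ := isInvertible_mfderiv_extChartAt (I := 𝓡 3) hx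
  let e' : Space3 ≃L[ℝ] Space3 := e
  have h1 : chartDeriv c x = (e' : Space3 →L[ℝ] Space3) := he.symm
  rw [h1, ContinuousLinearMap.det]
  exact (LinearEquiv.isUnit_det' e'.toLinearEquiv).ne_zero

theorem wedgeAt_eq (α : (x : M) → TangentSpace (𝓡 3) x →L[ℝ] ℝ)
    {β : (x : M) → TangentSpace (𝓡 3) x →L[ℝ] ℝ} (hβ : IsSmoothForm β) {c x : M}
    (hx : x ∈ (extChartAt (𝓡 3) c).source) :
    wedgeAt α β x = (chartDeriv c x).det * wedgeInChart α β c (extChartAt (𝓡 3) c x) := by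
  rw [wedgeAt, ← oneFormInChart_comp_chartDeriv α hx]
  have : twoFormAt β x = _ := funext₂ fun u v => twoFormAt_eq hβ hx u v
  rw [this, covector_twoFormVec_comp _ (isTwoForm_flatD _ _)]
  rfl

theorem chartDeriv_covectorCross (α β : (x : M) → TangentSpace (𝓡 3) x →L[ℝ] ℝ) {c x : M}
    (hx : x ∈ (extChartAt (𝓡 3) c).source) :
    chartDeriv c x (covectorCross (covectorAt α x) (covectorAt β x)) =
      (chartDeriv c x).det • covectorCross (oneFormInChart α c (extChartAt (𝓡 3) c x))
        (oneFormInChart β c (extChartAt (𝓡 3) c x)) := by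
  rw [← oneFormInChart_comp_chartDeriv α hx, ← oneFormInChart_comp_chartDeriv β hx,
    map_covectorCross_comp]

end Forms

/-! ### The divergence theorem and Stokes on a closed manifold -/

section Divergence

/-- Each coordinate is an integration by parts against the constant function 1. -/
theorem integral_diverg_eq_zero {V : Space3 → Space3} (hV : ContDiff ℝ ∞ V)
    (hc : HasCompactSupport V) : ∫ y, diverg V y = 0 := by
  have hV1 : ∀ i, ContDiff ℝ ∞ (fun y => V y i) := fun i => by fun_prop
  have hc1 : ∀ i, HasCompactSupport (fun y => V y i) := fun i =>
    hc.comp_left (g := fun v : Space3 => v i) rfl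
  have hd : ∀ i y, fderiv ℝ V y (stdVec i) i = fderiv ℝ (fun y => V y i) y (stdVec i) := by
    intro i y
    have h1 := (EuclideanSpace.proj (𝕜 := ℝ) i : Space3 →L[ℝ] ℝ).hasFDerivAt.comp y
      ((hV.differentiable (by simp)) y).hasFDerivAt
    rw [show fderiv ℝ (fun y => V y i) y = _ from h1.fderiv]
    rfl
  have hi : ∀ i, Integrable (fun y => fderiv ℝ (fun y => V y i) y (stdVec i)) := by
    intro i
    refine Continuous.integrable_of_hasCompactSupport ?_ ?_
    · exact ((hV1 i).continuous_fderiv (by simp)).clm_apply continuous_const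
    · exact (hc1 i).fderiv_apply ℝ (stdVec i)
  have hz : ∀ i, ∫ y, fderiv ℝ (fun y => V y i) y (stdVec i) = 0 := by
    intro i
    have h := integral_mul_fderiv_eq_neg_fderiv_mul_of_integrable (μ := volume) (v := stdVec i)
      (f := fun _ : Space3 => (1 : ℝ)) (g := fun y => V y i) (by simp) (by simpa using hi i)
      (by simpa using (hV1 i).continuous.integrable_of_hasCompactSupport (hc1 i))
      (fun y _ => by fun_prop) (fun y _ => (hV1 i).differentiable (by simp) y)
    simpa using h
  simp only [diverg, hd]
  rw [integral_finsetSum _ fun i _ => hi i]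
  simp [hz]

end Divergence

section Stokes

variable {M : Type*} [TopologicalSpace M] [ChartedSpace Space3 M]

/-- The integral over the chart at `c` of a function against the density of `α ∧ dα`. -/
noncomputable def chartIntegral (α : (x : M) → TangentSpace (𝓡 3) x →L[ℝ] ℝ) (c : M)
    (f : M → ℝ) : ℝ :=
  ∫ y in (extChartAt (𝓡 3) c).target, f ((extChartAt (𝓡 3) c).symm y) * |wedgeInChart α α c y|

/-- The quotient of `d (α ∧ β)` by the volume form `γ ∧ dγ`. -/
noncomputable def exactDensity (γ α β : (x : M) → TangentSpace (𝓡 3) x →L[ℝ] ℝ) (x : M) : ℝ :=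
  (wedgeAt β α x - wedgeAt α β x) / wedgeAt γ γ x

theorem oneFormInChart_eq_zero {α : (x : M) → TangentSpace (𝓡 3) x →L[ℝ] ℝ} {c : M} {y : Space3}
    (h : α ((extChartAt (𝓡 3) c).symm y) = 0) : oneFormInChart α c y = 0 := by
  ext v
  exact DFunLike.congr_fun h (mfderiv 𝓘(ℝ, Space3) (𝓡 3) (extChartAt (𝓡 3) c).symm y v)

theorem twoFormAt_apply (α : (x : M) → TangentSpace (𝓡 3) x →L[ℝ] ℝ) (x : M) (u v : Space3) :
    twoFormAt α x u v =
      fderiv ℝ (oneFormInChart α x) (extChartAt (𝓡 3) x x) (chartDeriv x x u) (chartDeriv x x v) -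
      fderiv ℝ (oneFormInChart α x) (extChartAt (𝓡 3) x x) (chartDeriv x x v)
        (chartDeriv x x u) := rfl

theorem twoFormAt_eq_smul {α β : (x : M) → TangentSpace (𝓡 3) x →L[ℝ] ℝ} {r : ℝ} {x : M}
    (h : ∀ᶠ z in 𝓝 x, β z = r • α z) :
    twoFormAt β x = r • twoFormAt α x := by
  have h2 : oneFormInChart β x =ᶠ[𝓝 (extChartAt (𝓡 3) x x)] r • oneFormInChart α x := by
    have hcont := continuousAt_extChartAt_symm (I := 𝓡 3) x
    rw [ContinuousAt, extChartAt_to_inv] at hcont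
    filter_upwards [hcont.eventually h] with y hy
    simp only [oneFormInChart, hy]
    rfl
  ext u v
  change twoFormAt β x u v = r * twoFormAt α x u v
  have h3 : fderiv ℝ (r • oneFormInChart α x) (extChartAt (𝓡 3) x x) =
      r • fderiv ℝ (oneFormInChart α x) (extChartAt (𝓡 3) x x) := by
    exact congrFun (fderiv_const_smul_field (𝕜 := ℝ) (f := oneFormInChart α x) r) _
  rw [twoFormAt_apply, twoFormAt_apply, h2.fderiv_eq, h3]
  simp only [smul_apply, smul_eq_mul, mul_sub]

theorem twoFormVec_smul (r : ℝ) (κ : Space3 → Space3 → ℝ) :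
    twoFormVec (r • κ) = r • twoFormVec κ := by
  ext i; fin_cases i <;> simp [twoFormVec]

theorem exactDensity_eq_mul {α α' : (x : M) → TangentSpace (𝓡 3) x →L[ℝ] ℝ}
    (γ β : (x : M) → TangentSpace (𝓡 3) x →L[ℝ] ℝ) {r : ℝ} {x : M}
    (h : ∀ᶠ z in 𝓝 x, α' z = r • α z) :
    exactDensity γ α' β x = r * exactDensity γ α β x := by
  have h0 : covectorAt α' x = r • covectorAt α x := h.self_of_nhds
  rw [exactDensity, exactDensity, wedgeAt, wedgeAt, wedgeAt, wedgeAt, wedgeAt,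
    twoFormAt_eq_smul h, twoFormVec_smul, h0, map_smul, smul_apply, smul_eq_mul, smul_eq_mul]
  ring

variable [IsManifold (𝓡 3) ∞ M]

theorem IsSmoothForm.smul {α : (x : M) → TangentSpace (𝓡 3) x →L[ℝ] ℝ} (hα : IsSmoothForm α)
    {f : M → ℝ} (hf : ContMDiff (𝓡 3) 𝓘(ℝ, ℝ) ∞ f) : IsSmoothForm (fun x => f x • α x) := by
  intro c
  exact ((contMDiffOn_chart_source_iff c).1 hf.contMDiffOn).smul (hα c)

/-- `wedgeAt` refers to the preferred chart at each point, which may jump as the point moves, so it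
need not be continuous. In quotients the chart determinants cancel; these are genuine functions on
M. -/
theorem wedgeAt_div_eq {γ β : (x : M) → TangentSpace (𝓡 3) x →L[ℝ] ℝ}
    (α : (x : M) → TangentSpace (𝓡 3) x →L[ℝ] ℝ) (hγ : IsSmoothForm γ) (hβ : IsSmoothForm β)
    {c x : M} (hx : x ∈ (extChartAt (𝓡 3) c).source) :
    wedgeAt α β x / wedgeAt γ γ x = wedgeInChart α β c (extChartAt (𝓡 3) c x) /
      wedgeInChart γ γ c (extChartAt (𝓡 3) c x) := by
  rw [wedgeAt_eq α hβ hx, wedgeAt_eq γ hγ hx, mul_div_mul_left _ _ (chartDeriv_det_ne_zero hx)]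

theorem wedgeInChart_ne_zero {γ : (x : M) → TangentSpace (𝓡 3) x →L[ℝ] ℝ} (hγ : IsSmoothForm γ)
    (h0 : ∀ x, wedgeAt γ γ x ≠ 0) {c : M} {y : Space3} (hy : y ∈ (extChartAt (𝓡 3) c).target) :
    wedgeInChart γ γ c y ≠ 0 := by
  have h := wedgeAt_eq γ hγ ((extChartAt (𝓡 3) c).map_target hy)
  rw [(extChartAt (𝓡 3) c).right_inv hy] at h
  exact fun h1 => h0 _ (by rw [h, h1, mul_zero])

theorem continuous_wedgeAt_div {α β γ : (x : M) → TangentSpace (𝓡 3) x →L[ℝ] ℝ}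
    (hα : IsSmoothForm α) (hβ : IsSmoothForm β) (hγ : IsSmoothForm γ)
    (h0 : ∀ x, wedgeAt γ γ x ≠ 0) : Continuous fun x => wedgeAt α β x / wedgeAt γ γ x := by
  rw [continuous_iff_continuousAt]
  intro x
  have hy := mem_extChartAt_target (I := 𝓡 3) x
  have h1 : (fun z => wedgeAt α β z / wedgeAt γ γ z) =ᶠ[𝓝 x] fun z =>
      wedgeInChart α β x (extChartAt (𝓡 3) x z) / wedgeInChart γ γ x (extChartAt (𝓡 3) x z) := by
    filter_upwards [extChartAt_source_mem_nhds (I := 𝓡 3) x] with z hz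
    exact wedgeAt_div_eq α hγ hβ hz
  refine ContinuousAt.congr ?_ h1.symm
  have h2 := continuousAt_extChartAt (I := 𝓡 3) x
  exact ((hα.contDiffAt_wedgeInChart hβ hy).continuousAt.comp h2).div
    ((hγ.contDiffAt_wedgeInChart hγ hy).continuousAt.comp h2) (wedgeInChart_ne_zero hγ h0 hy)

theorem continuous_exactDensity {α β γ : (x : M) → TangentSpace (𝓡 3) x →L[ℝ] ℝ}
    (hα : IsSmoothForm α) (hβ : IsSmoothForm β) (hγ : IsSmoothForm γ)
    (h0 : ∀ x, wedgeAt γ γ x ≠ 0) : Continuous (exactDensity γ α β) := by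
  have h : exactDensity γ α β = fun x => wedgeAt β α x / wedgeAt γ γ x -
      wedgeAt α β x / wedgeAt γ γ x := funext fun x => sub_div _ _ _
  rw [h]
  exact (continuous_wedgeAt_div hβ hα hγ h0).sub (continuous_wedgeAt_div hα hβ hγ h0)

/-- The sign records whether the chart respects the orientation given by γ ∧ dγ; it is what remains
when a divergence is written as a density against |γ ∧ dγ|. -/
theorem exactDensity_mul_abs {α β γ : (x : M) → TangentSpace (𝓡 3) x →L[ℝ] ℝ}
    (hα : IsSmoothForm α) (hβ : IsSmoothForm β) (hγ : IsSmoothForm γ)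
    (h0 : ∀ x, wedgeAt γ γ x ≠ 0) {c : M} {y : Space3} (hy : y ∈ (extChartAt (𝓡 3) c).target) :
    exactDensity γ α β ((extChartAt (𝓡 3) c).symm y) * |wedgeInChart γ γ c y| =
      SignType.sign (wedgeInChart γ γ c y) *
      diverg (fun y => covectorCross (oneFormInChart α c y) (oneFormInChart β c y)) y := by
  have hx := (extChartAt (𝓡 3) c).map_target hy
  have hne := wedgeInChart_ne_zero hγ h0 hy
  rw [exactDensity, sub_div, wedgeAt_div_eq _ hγ hα hx, wedgeAt_div_eq _ hγ hβ hx,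
    (extChartAt (𝓡 3) c).right_inv hy, (diverg_covectorCross
      ((hα.contDiffAt hy).differentiableAt (by simp))
      ((hβ.contDiffAt hy).differentiableAt (by simp))).2, ← sign_mul_self (wedgeInChart γ γ c y)]
  change (wedgeInChart β α c y / _ - wedgeInChart α β c y / _) * _ =
    _ * (wedgeInChart β α c y - wedgeInChart α β c y)
  field_simp

/-- The integrand is the divergence of the signed cross product. The sign is locally constant, and α
vanishes off K, so extension by zero gives a smooth compactly supported field. -/
theorem chartIntegral_exactDensity {α β γ : (x : M) → TangentSpace (𝓡 3) x →L[ℝ] ℝ}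
    (hα : IsSmoothForm α) (hβ : IsSmoothForm β) (hγ : IsSmoothForm γ)
    (h0 : ∀ x, wedgeAt γ γ x ≠ 0) {c : M} {K : Set M} (hK : IsCompact K)
    (hKc : K ⊆ (extChartAt (𝓡 3) c).source) (hsupp : ∀ x ∉ K, α x = 0) :
    chartIntegral γ c (exactDensity γ α β) = 0 := by
  set φ := extChartAt (𝓡 3) c with hφ
  set V : Space3 → Space3 := indicator φ.target fun y =>
    ((SignType.sign (wedgeInChart γ γ c y) : SignType) : ℝ) •
      covectorCross (oneFormInChart α c y) (oneFormInChart β c y) with hV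
  have hopen : IsOpen φ.target := isOpen_extChartAt_target c
  have hK' : IsCompact (φ '' K) := hK.image_of_continuousOn ((continuousOn_extChartAt c).mono hKc)
  have hzero : ∀ y ∉ φ '' K, V y = 0 := by
    intro y hy
    by_cases hyt : y ∈ φ.target
    · have h1 : α (φ.symm y) = 0 := hsupp _ fun h => hy ⟨_, h, φ.right_inv hyt⟩
      have h2 : oneFormInChart α c y = 0 := oneFormInChart_eq_zero h1
      rw [hV, indicator_of_mem hyt, h2, covectorCross_eq]
      simp
    · exact indicator_of_notMem hyt _
  have hloc : ∀ y ∈ φ.target, V =ᶠ[𝓝 y] fun z =>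
      ((SignType.sign (wedgeInChart γ γ c y) : SignType) : ℝ) •
        covectorCross (oneFormInChart α c z) (oneFormInChart β c z) := by
    intro y hy
    have h1 : ∀ᶠ z in 𝓝 y, SignType.sign (wedgeInChart γ γ c z) =
        SignType.sign (wedgeInChart γ γ c y) := by
      have := (continuousAt_sign_of_ne_zero (wedgeInChart_ne_zero hγ h0 hy)).comp
        (f := wedgeInChart γ γ c) (hγ.contDiffAt_wedgeInChart hγ hy).continuousAt
      exact this.eventually_mem ((isOpen_discrete {_}).mem_nhds rfl)
    filter_upwards [hopen.mem_nhds hy, h1] with z hz hz1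
    rw [hV, indicator_of_mem hz, hz1]
  have hsm : ContDiff ℝ ∞ V := by
    rw [contDiff_iff_contDiffAt]
    intro y
    by_cases hy : y ∈ φ.target
    · exact (((hα.contDiffAt hy).covectorCross (hβ.contDiffAt hy)).const_smul _).congr_of_eventuallyEq
        (hloc y hy)
    · have h1 : V =ᶠ[𝓝 y] fun _ => 0 := by
        filter_upwards [hK'.isClosed.isOpen_compl.mem_nhds (show y ∈ (φ '' K)ᶜ from fun h => hy
          (by obtain ⟨x, hx, rfl⟩ := h; exact φ.map_source (hKc hx)))] with z hz
        exact hzero z hz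
      exact contDiffAt_const.congr_of_eventuallyEq h1
  have hcs : HasCompactSupport V := HasCompactSupport.intro hK' hzero
  have hin : ∫ y in φ.target, diverg V y = 0 := by
    rw [setIntegral_eq_integral_of_forall_compl_eq_zero, integral_diverg_eq_zero hsm hcs]
    intro y hy
    have h1 : V =ᶠ[𝓝 y] fun _ => 0 := by
      filter_upwards [hK'.isClosed.isOpen_compl.mem_nhds (show y ∈ (φ '' K)ᶜ from fun h => hy
        (by obtain ⟨x, hx, rfl⟩ := h; exact φ.map_source (hKc hx)))] with z hz
      exact hzero z hz
    simp [diverg, h1.fderiv_eq]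
  rw [chartIntegral, ← hin]
  refine setIntegral_congr_fun hopen.measurableSet fun y hy => ?_
  change exactDensity γ α β (φ.symm y) * |wedgeInChart γ γ c y| = _
  rw [exactDensity_mul_abs hα hβ hγ h0 hy]
  have hd := (diverg_covectorCross ((hα.contDiffAt hy).differentiableAt (by simp))
    ((hβ.contDiffAt hy).differentiableAt (by simp))).1
  have h2 := diverg_smul (f := fun _ => ((SignType.sign (wedgeInChart γ γ c y) : SignType) : ℝ))
    (differentiableAt_const _) hd
  have h3 : diverg V y = diverg (fun z =>
      ((SignType.sign (wedgeInChart γ γ c y) : SignType) : ℝ) •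
        covectorCross (oneFormInChart α c z) (oneFormInChart β c z)) y := by
    rw [diverg, (hloc y hy).fderiv_eq, ← diverg]
  rw [h3, h2]
  simp

/-- The change of variables formula: |γ ∧ dγ| transforms by the absolute value of the Jacobian, so
charts need not be oriented. -/
theorem chartIntegral_congr_chart {γ : (x : M) → TangentSpace (𝓡 3) x →L[ℝ] ℝ}
    (hγ : IsSmoothForm γ) {c c' : M} {f : M → ℝ}
    (hf : ∀ x, f x ≠ 0 → x ∈ (extChartAt (𝓡 3) c).source ∧ x ∈ (extChartAt (𝓡 3) c').source) :
    chartIntegral γ c f = chartIntegral γ c' f := by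
  set φ := extChartAt (𝓡 3) c with hφ
  set ψ := extChartAt (𝓡 3) c' with hψ
  set s : Set Space3 := ψ.target ∩ ψ.symm ⁻¹' φ.source with hs
  have hsopen : IsOpen s := (continuousOn_extChartAt_symm c').isOpen_inter_preimage
    (isOpen_extChartAt_target c') (isOpen_extChartAt_source c)
  have himg : (φ ∘ ψ.symm) '' s = φ.target ∩ φ.symm ⁻¹' ψ.source := by
    ext y
    constructor
    · rintro ⟨z, hz, rfl⟩
      refine ⟨φ.map_source hz.2, ?_⟩
      rw [mem_preimage, Function.comp_apply, φ.left_inv hz.2]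
      exact ψ.map_target hz.1
    · rintro ⟨hy1, hy2⟩
      refine ⟨ψ (φ.symm y), ⟨ψ.map_source hy2, ?_⟩, ?_⟩
      · rw [mem_preimage, ψ.left_inv hy2]; exact φ.map_target hy1
      · rw [Function.comp_apply, ψ.left_inv hy2, φ.right_inv hy1]
  have hinj : InjOn (φ ∘ ψ.symm) s := by
    intro y hy z hz h
    exact ψ.symm.injOn hy.1 hz.1 (φ.injOn hy.2 hz.2 h)
  have hder : ∀ y ∈ s, HasFDerivWithinAt (φ ∘ ψ.symm) (fderiv ℝ (φ ∘ ψ.symm) y) s y := fun y hy =>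
    ((contDiffAt_transition hy.1 hy.2).differentiableAt (by simp)).hasFDerivAt.hasFDerivWithinAt
  have h1 := integral_image_eq_integral_abs_det_fderiv_smul volume hsopen.measurableSet hder hinj
    (fun y => f (φ.symm y) * |wedgeInChart γ γ c y|)
  rw [himg] at h1
  have h2 : chartIntegral γ c f = ∫ y in φ.target ∩ φ.symm ⁻¹' ψ.source,
      f (φ.symm y) * |wedgeInChart γ γ c y| := by
    refine setIntegral_eq_of_subset_of_forall_sdiff_eq_zero
      (isOpen_extChartAt_target c).measurableSet inter_subset_left fun y hy => ?_
    have : f (φ.symm y) = 0 := by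
      by_contra h
      exact hy.2 ⟨hy.1, (hf _ h).2⟩
    rw [this, zero_mul]
  have h3 : chartIntegral γ c' f = ∫ y in s, f (ψ.symm y) * |wedgeInChart γ γ c' y| := by
    refine setIntegral_eq_of_subset_of_forall_sdiff_eq_zero
      (isOpen_extChartAt_target c').measurableSet inter_subset_left fun y hy => ?_
    have : f (ψ.symm y) = 0 := by
      by_contra h
      exact hy.2 ⟨hy.1, (hf _ h).1⟩
    rw [this, zero_mul]
  rw [h2, h3, h1]
  refine setIntegral_congr_fun hsopen.measurableSet fun y hy => ?_
  have hx := ψ.map_target hy.1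
  have hw := (wedgeAt_eq γ hγ hx).symm.trans (wedgeAt_eq γ hγ hy.2)
  rw [ψ.right_inv hy.1] at hw
  have hdet : chartDeriv c (ψ.symm y) =
      (fderiv ℝ (φ ∘ ψ.symm) y).comp (chartDeriv c' (ψ.symm y)) := by
    ext1 u
    rw [ContinuousLinearMap.comp_apply, fderiv_transition hy.1 hy.2]
    exact congrArg (chartDeriv c (ψ.symm y)) (mfderiv_extChartAt_symm_comp hy.1 u).symm
  have hdet2 : (chartDeriv c (ψ.symm y)).det =
      (fderiv ℝ (φ ∘ ψ.symm) y).det * (chartDeriv c' (ψ.symm y)).det := by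
    rw [hdet]
    exact LinearMap.det_comp _ _
  rw [hdet2, mul_right_comm, mul_comm] at hw
  have hw2 := mul_right_cancel₀ (chartDeriv_det_ne_zero hx) hw
  simp only [Function.comp_apply, φ.left_inv hy.2, smul_eq_mul]
  rw [hw2, abs_mul]
  ring

omit [IsManifold (𝓡 3) ∞ M] in
theorem integrableOn_chart {γ : (x : M) → TangentSpace (𝓡 3) x →L[ℝ] ℝ}
    (hγ : IsSmoothForm γ) {c : M} {f : M → ℝ} (hf : Continuous f) {K : Set M} (hK : IsCompact K)
    (hKc : K ⊆ (extChartAt (𝓡 3) c).source) (hsupp : ∀ x ∉ K, f x = 0) :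
    IntegrableOn (fun y => f ((extChartAt (𝓡 3) c).symm y) * |wedgeInChart γ γ c y|)
      (extChartAt (𝓡 3) c).target := by
  set φ := extChartAt (𝓡 3) c with hφ
  have hK' : IsCompact (φ '' K) := hK.image_of_continuousOn ((continuousOn_extChartAt c).mono hKc)
  have hsub : φ '' K ⊆ φ.target := by
    rintro _ ⟨x, hx, rfl⟩; exact φ.map_source (hKc hx)
  have hcont : ContinuousOn (fun y => f (φ.symm y) * |wedgeInChart γ γ c y|) φ.target := by
    refine (hf.comp_continuousOn (continuousOn_extChartAt_symm c)).mul (ContinuousOn.abs ?_)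
    exact fun y hy => (hγ.contDiffAt_wedgeInChart hγ hy).continuousAt.continuousWithinAt
  refine ((hcont.mono hsub).integrableOn_compact hK').of_forall_sdiff_eq_zero
    (isOpen_extChartAt_target c).measurableSet fun y hy => ?_
  rw [hsupp _ fun h => hy.2 ⟨_, h, φ.right_inv hy.1⟩, zero_mul]

theorem chartIntegral_pos {γ : (x : M) → TangentSpace (𝓡 3) x →L[ℝ] ℝ}
    (hγ : IsSmoothForm γ) (h0 : ∀ x, wedgeAt γ γ x ≠ 0) {c : M} {f : M → ℝ} (hf : Continuous f)
    {K : Set M} (hK : IsCompact K) (hKc : K ⊆ (extChartAt (𝓡 3) c).source)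
    (hsupp : ∀ x ∉ K, f x = 0) (hnn : ∀ x, 0 ≤ f x) {x : M} (hx : 0 < f x) :
    0 < chartIntegral γ c f := by
  have hint := integrableOn_chart hγ hf hK hKc hsupp
  have hxK : x ∈ K := by
    by_contra h
    exact hx.ne' (hsupp x h)
  have hopen := isOpen_extChartAt_target (I := 𝓡 3) c
  have hcont : ContinuousOn (fun y => f ((extChartAt (𝓡 3) c).symm y) * |wedgeInChart γ γ c y|)
      (extChartAt (𝓡 3) c).target := by
    refine (hf.comp_continuousOn (continuousOn_extChartAt_symm c)).mul (ContinuousOn.abs ?_)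
    exact fun y hy => (hγ.contDiffAt_wedgeInChart hγ hy).continuousAt.continuousWithinAt
  rw [chartIntegral, setIntegral_pos_iff_support_of_nonneg_ae
    (.of_forall fun y => mul_nonneg (hnn _) (abs_nonneg _)) hint]
  have h1 := hcont.isOpen_inter_preimage hopen (isOpen_compl_singleton (x := (0 : ℝ)))
  rw [inter_comm]
  refine h1.measure_pos volume ⟨extChartAt (𝓡 3) c x, ?_, ?_⟩
  · exact (extChartAt (𝓡 3) c).map_source (hKc hxK)
  · rw [mem_preimage, (extChartAt (𝓡 3) c).left_inv (hKc hxK), mem_compl_singleton_iff]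
    exact mul_ne_zero hx.ne' (abs_ne_zero.2
      (wedgeInChart_ne_zero hγ h0 ((extChartAt (𝓡 3) c).map_source (hKc hxK))))

omit [IsManifold (𝓡 3) ∞ M] in
theorem twoFormAt_sum {ι : Type*} [Fintype ι]
    {A : ι → (x : M) → TangentSpace (𝓡 3) x →L[ℝ] ℝ} (hA : ∀ j, IsSmoothForm (A j)) (x : M) :
    twoFormAt (fun x => ∑ j, A j x) x = ∑ j, twoFormAt (A j) x := by
  have h1 : oneFormInChart (fun x => ∑ j, A j x) x = fun y => ∑ j, oneFormInChart (A j) x y := by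
    ext y v
    rw [sum_apply]
    exact sum_apply (Finset.univ) (fun j => A j _) _
  ext u v
  rw [Finset.sum_apply, Finset.sum_apply]
  simp only [twoFormAt_apply]
  rw [h1, fderiv_fun_sum fun j _ =>
    ((hA j).contDiffAt (mem_extChartAt_target x)).differentiableAt (by simp),
    Finset.sum_sub_distrib]
  simp only [sum_apply]

omit [IsManifold (𝓡 3) ∞ M] in
theorem exactDensity_sum {ι : Type*} [Fintype ι]
    {A : ι → (x : M) → TangentSpace (𝓡 3) x →L[ℝ] ℝ} (hA : ∀ j, IsSmoothForm (A j))
    (γ β : (x : M) → TangentSpace (𝓡 3) x →L[ℝ] ℝ) (x : M) :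
    exactDensity γ (fun x => ∑ j, A j x) β x = ∑ j, exactDensity γ (A j) β x := by
  have h1 : ∀ κ : ι → Space3 → Space3 → ℝ, twoFormVec (∑ j, κ j) = ∑ j, twoFormVec (κ j) := by
    intro κ
    ext i
    fin_cases i <;> simp [twoFormVec]
  have h2 : covectorAt (fun x => ∑ j, A j x) x = ∑ j, covectorAt (A j) x := rfl
  simp only [exactDensity, wedgeAt]
  rw [twoFormAt_sum hA, h1, h2, map_sum, sum_apply, ← Finset.sum_sub_distrib,
    Finset.sum_div]

/-- Stokes' theorem for `d (α ∧ β)` on a closed manifold: if this form is nonnegative with respect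
to a volume form, it vanishes. -/
theorem exactDensity_eq_zero_of_nonneg [T2Space M] [CompactSpace M]
    {α β γ : (x : M) → TangentSpace (𝓡 3) x →L[ℝ] ℝ}
    (hα : IsSmoothForm α) (hβ : IsSmoothForm β) (hγ : IsSmoothForm γ)
    (h0 : ∀ x, wedgeAt γ γ x ≠ 0) (hnn : ∀ x, 0 ≤ exactDensity γ α β x) (x : M) :
    exactDensity γ α β x = 0 := by
  obtain ⟨t, ht⟩ := isCompact_univ.elim_finite_subcover
    (fun c : M => (chartAt Space3 c).source) (fun c => (chartAt Space3 c).open_source)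
    (fun x _ => mem_iUnion.2 ⟨x, mem_chart_source Space3 x⟩)
  obtain ⟨ρ, hρ⟩ := SmoothPartitionOfUnity.exists_isSubordinate (𝓡 3) (isClosed_univ (X := M))
    (fun c : t => (chartAt Space3 (c : M)).source) (fun c => (chartAt Space3 (c : M)).open_source)
    (fun x hx => by
      obtain ⟨c, hc, hxc⟩ := mem_iUnion₂.1 (ht hx)
      exact mem_iUnion.2 ⟨⟨c, hc⟩, hxc⟩)
  have hsum : ∀ x, ∑ i, ρ i x = 1 := fun x => by
    rw [← finsum_eq_sum_of_fintype]; exact ρ.sum_eq_one (mem_univ x)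
  have hK : ∀ i, IsCompact (tsupport (ρ i)) := fun i => (isClosed_tsupport _).isCompact
  have hKc : ∀ i : t, tsupport (ρ i) ⊆ (extChartAt (𝓡 3) (i : M)).source := fun i => by
    rw [extChartAt_source]; exact hρ i
  have hρ0 : ∀ i, ∀ x ∉ tsupport (ρ i), ρ i x = 0 := fun i x hx => image_eq_zero_of_notMem_tsupport hx
  have hρc : ∀ i, Continuous (ρ i) := fun i => (ρ i).contMDiff.continuous
  -- Cutting off the form α, and not only the density, keeps each piece d(ρ_j α ∧ β) exact with
  -- support in one chart.
  set A : t → (x : M) → TangentSpace (𝓡 3) x →L[ℝ] ℝ := fun j x => ρ j x • α x with hA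
  have hAs : ∀ j, IsSmoothForm (A j) := fun j => hα.smul (ρ j).contMDiff
  have hA0 : ∀ j, ∀ x ∉ tsupport (ρ j), A j x = 0 := fun j x hx => by
    rw [hA]
    simp only [hρ0 j x hx]
    exact zero_smul ℝ (α x)
  have hH0 : ∀ j, ∀ x ∉ tsupport (ρ j), exactDensity γ (A j) β x = 0 := fun j x hx => by
    rw [exactDensity_eq_mul (α := α) (r := 0) γ β, zero_mul]
    filter_upwards [(isClosed_tsupport (ρ j)).isOpen_compl.mem_nhds hx] with z hz
    simp only [hA, hρ0 j z hz]
  have hAα : (fun x => ∑ j, A j x) = α := by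
    funext x
    rw [hA]
    simp only
    rw [← Finset.sum_smul, hsum]
    exact one_smul ℝ (α x)
  have hHs : ∀ x, ∑ j, exactDensity γ (A j) β x = exactDensity γ α β x := fun x => by
    rw [← exactDensity_sum hAs, hAα]
  have hHc : ∀ j, Continuous (exactDensity γ (A j) β) := fun j =>
    continuous_exactDensity (hAs j) hβ hγ h0
  have hHcα := continuous_exactDensity hα hβ hγ h0
  have hrow : ∀ i : t, chartIntegral γ i (fun x => ρ i x * exactDensity γ α β x) =
      ∑ j, chartIntegral γ i (fun x => ρ i x * exactDensity γ (A j) β x) := by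
    intro i
    simp only [chartIntegral]
    rw [← integral_finsetSum]
    · refine integral_congr_ae (.of_forall fun y => ?_)
      simp only
      rw [← hHs, Finset.mul_sum, Finset.sum_mul]
    · intro j _
      exact integrableOn_chart hγ ((hρc i).mul (hHc j)) (hK i) (hKc i)
        (fun x hx => by rw [Pi.mul_apply, hρ0 i x hx, zero_mul])
  have hcol : ∀ j : t, ∑ i : t, chartIntegral γ j (fun x => ρ i x * exactDensity γ (A j) β x) = 0 := by
    intro j
    rw [← chartIntegral_exactDensity (hAs j) hβ hγ h0 (hK j) (hKc j) (hA0 j)]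
    simp only [chartIntegral]
    rw [← integral_finsetSum]
    · refine integral_congr_ae (.of_forall fun y => ?_)
      simp only
      rw [← Finset.sum_mul, ← Finset.sum_mul, hsum, one_mul]
    · intro i _
      exact integrableOn_chart hγ ((hρc i).mul (hHc j)) (hK j) (hKc j)
        (fun x hx => by rw [Pi.mul_apply, hH0 j x hx, mul_zero])
  -- The total is the double sum of the integrals of ρ_i d(ρ_j α ∧ β). Each entry is supported in
  -- both charts i and j, so it may be moved to chart j, where the sum over i removes ρ_i and leaves
  -- an exact piece of integral zero.
  have htot : ∑ i : t, chartIntegral γ i (fun x => ρ i x * exactDensity γ α β x) = 0 := by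
    rw [Finset.sum_congr rfl fun i _ => hrow i, Finset.sum_comm,
      ← Finset.sum_eq_zero fun j _ => hcol j]
    refine Finset.sum_congr rfl fun j _ => Finset.sum_congr rfl fun i _ => ?_
    refine chartIntegral_congr_chart hγ fun x hx => ⟨hKc i ?_, hKc j ?_⟩
    · by_contra h
      exact hx (by rw [hρ0 i x h, zero_mul])
    · by_contra h
      exact hx (by rw [hH0 j x h, mul_zero])
  have hpos : ∀ i : t, 0 ≤ chartIntegral γ i (fun x => ρ i x * exactDensity γ α β x) := fun i =>
    integral_nonneg fun y => mul_nonneg (mul_nonneg (ρ.nonneg i _) (hnn _)) (abs_nonneg _)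
  have hzero := (Finset.sum_eq_zero_iff_of_nonneg fun i _ => hpos i).1 htot
  by_contra hx
  have hx' : 0 < exactDensity γ α β x := lt_of_le_of_ne (hnn x) (Ne.symm hx)
  obtain ⟨i, hi⟩ := ρ.exists_pos_of_mem (mem_univ x)
  refine (chartIntegral_pos hγ h0 ((hρc i).mul hHcα) (hK i) (hKc i)
    (fun x hx => by rw [Pi.mul_apply, hρ0 i x hx, zero_mul])
    (fun x => mul_nonneg (ρ.nonneg i x) (hnn x)) (mul_pos hi hx')).ne' (hzero i (Finset.mem_univ i))

omit [IsManifold (𝓡 3) ∞ M] in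
theorem contMDiff_indicator_of_isClopen {S : Set M} (hS : IsClopen S) :
    ContMDiff (𝓡 3) 𝓘(ℝ, ℝ) ∞ (indicator S fun _ => (1 : ℝ)) := by
  intro x
  by_cases hx : x ∈ S
  · refine (contMDiffAt_const (c := (1 : ℝ))).congr_of_eventuallyEq ?_
    filter_upwards [hS.isOpen.mem_nhds hx] with z hz
    exact indicator_of_mem hz _
  · refine (contMDiffAt_const (c := (0 : ℝ))).congr_of_eventuallyEq ?_
    filter_upwards [hS.compl.isOpen.mem_nhds hx] with z hz
    exact indicator_of_notMem hz _

/-- Two contact forms whose mixed products with the exterior derivatives do not vanish,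
and have the same sign on one side, have the same sign on the other side. -/
theorem wedgeAt_div_pos [T2Space M] [CompactSpace M]
    {α β : (x : M) → TangentSpace (𝓡 3) x →L[ℝ] ℝ}
    (hα : IsSmoothForm α) (hβ : IsSmoothForm β) (h0 : ∀ x, wedgeAt α α x ≠ 0)
    (hp : ∀ x, 0 < wedgeAt β α x / wedgeAt α α x) (hg : ∀ x, wedgeAt α β x ≠ 0) (x : M) :
    0 < wedgeAt α β x / wedgeAt α α x := by
  have hc := continuous_wedgeAt_div hα hβ hα h0
  -- The bad set is clopen because the quotient is continuous and nowhere zero; it is therefore a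
  -- closed manifold to which Stokes applies, by cutting α off with its indicator.
  set S : Set M := {x | wedgeAt α β x / wedgeAt α α x < 0} with hS
  have hSo : IsOpen S := isOpen_lt hc continuous_const
  have hSc : IsClosed S := by
    have : S = {x | wedgeAt α β x / wedgeAt α α x ≤ 0} := by
      ext z
      exact ⟨fun h => le_of_lt (α := ℝ) h, fun h => lt_of_le_of_ne h (div_ne_zero (hg z) (h0 z))⟩
    rw [this]
    exact isClosed_le hc continuous_const
  set α' : (x : M) → TangentSpace (𝓡 3) x →L[ℝ] ℝ :=
    fun x => indicator S (fun _ => (1 : ℝ)) x • α x with hα'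
  have hα's : IsSmoothForm α' := hα.smul (contMDiff_indicator_of_isClopen ⟨hSc, hSo⟩)
  have hin : ∀ x ∈ S, exactDensity α α' β x =
      wedgeAt β α x / wedgeAt α α x - wedgeAt α β x / wedgeAt α α x := by
    intro x hx
    rw [← sub_div, exactDensity_eq_mul (α := α) (r := 1) α β, one_mul, exactDensity]
    filter_upwards [hSo.mem_nhds hx] with z hz
    simp only [hα', indicator_of_mem hz]
  have hout : ∀ x ∉ S, exactDensity α α' β x = 0 := by
    intro x hx
    rw [exactDensity_eq_mul (α := α) (r := 0) α β, zero_mul]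
    filter_upwards [hSc.isOpen_compl.mem_nhds hx] with z hz
    simp only [hα', indicator_of_notMem hz]
  have hpos : ∀ x ∈ S, 0 < exactDensity α α' β x := fun x hx => by
    rw [hin x hx]
    have h1 := hp x
    have h2 : wedgeAt α β x / wedgeAt α α x < 0 := hx
    linarith
  have hzero := exactDensity_eq_zero_of_nonneg hα's hβ hα h0 fun x => by
    by_cases hx : x ∈ S
    · exact (hpos x hx).le
    · exact (hout x hx).ge
  by_contra hx
  have hxS : x ∈ S := lt_of_le_of_ne (not_lt.1 hx) (div_ne_zero (hg x) (h0 x))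
  exact (hpos x hxS).ne' (hzero x)

end Stokes

/-! ### Gray's vector field for the linear segment of forms -/

/-- Gray's equation ∂_s a_s + ι_X da_s = h a_s, with κ = da_s and d the speed of r. The cross
product lies in ker a ∩ ker b; with A = a(W), B = b(W) and μ = (1 - r) A + r B for the vector W of
κ, the equation reduces to μ (b - a) + B a - A b = (B - A)((1 - r) a + r b). -/
theorem gray_identity {κ : Space3 → Space3 → ℝ} (hκ : IsTwoForm κ) (a b : Space3 →L[ℝ] ℝ)
    (r d : ℝ) (hμ : ((1 - r) • a + r • b) (twoFormVec κ) ≠ 0) (v : Space3) :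
    (d • (b - a)) v + κ ((d * (((1 - r) • a + r • b) (twoFormVec κ))⁻¹) • covectorCross a b) v =
      d * ((b (twoFormVec κ) - a (twoFormVec κ)) / ((1 - r) • a + r • b) (twoFormVec κ)) *
        ((1 - r) • a + r • b) v := by
  rw [hκ.smul_left, hκ.apply_covectorCross]
  simp only [add_apply, smul_apply, sub_apply, smul_eq_mul] at hμ ⊢
  field_simp
  ring

theorem flatD_segment {a b : Space3 → Space3 →L[ℝ] ℝ} {y : Space3}
    (ha : DifferentiableAt ℝ a y) (hb : DifferentiableAt ℝ b y) (r : ℝ) :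
    flatD (fun y => (1 - r) • a y + r • b y) y = (1 - r) • flatD a y + r • flatD b y := by
  have h := ((ha.hasFDerivAt.const_smul (1 - r)).add (hb.hasFDerivAt.const_smul r)).fderiv
  ext u v
  rw [flatD, show fderiv ℝ (fun y => (1 - r) • a y + r • b y) y = _ from h]
  simp [flatD]
  ring

theorem twoFormVec_segment (κ κ' : Space3 → Space3 → ℝ) (r : ℝ) :
    twoFormVec ((1 - r) • κ + r • κ') = (1 - r) • twoFormVec κ + r • twoFormVec κ' := by
  ext i
  fin_cases i <;> simp [twoFormVec]

section Gray

variable {M : Type*} [TopologicalSpace M] [ChartedSpace Space3 M]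

/-- The linear interpolation of two 1-forms. -/
noncomputable def formSegment (α β : (x : M) → TangentSpace (𝓡 3) x →L[ℝ] ℝ) (r : ℝ) (x : M) :
    TangentSpace (𝓡 3) x →L[ℝ] ℝ :=
  (1 - r) • α x + r • β x

variable {α β : (x : M) → TangentSpace (𝓡 3) x →L[ℝ] ℝ}

theorem oneFormInChart_formSegment (r : ℝ) (c : M) :
    oneFormInChart (formSegment α β r) c =
      fun y => (1 - r) • oneFormInChart α c y + r • oneFormInChart β c y := rfl

theorem IsSmoothForm.formSegment (hα : IsSmoothForm α) (hβ : IsSmoothForm β) (r : ℝ) :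
    IsSmoothForm (formSegment α β r) := fun c =>
  ((hα c).const_smul (1 - r)).add ((hβ c).const_smul r)

theorem wedgeInChart_formSegment_right (hα : IsSmoothForm α) (hβ : IsSmoothForm β)
    (γ : (x : M) → TangentSpace (𝓡 3) x →L[ℝ] ℝ) (r : ℝ) {c : M} {y : Space3}
    (hy : y ∈ (extChartAt (𝓡 3) c).target) :
    wedgeInChart γ (formSegment α β r) c y =
      (1 - r) * wedgeInChart γ α c y + r * wedgeInChart γ β c y := by
  rw [wedgeInChart, oneFormInChart_formSegment,
    flatD_segment ((hα.contDiffAt hy).differentiableAt (by simp))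
      ((hβ.contDiffAt hy).differentiableAt (by simp)), twoFormVec_segment]
  simp [wedgeInChart]

theorem wedgeInChart_formSegment (hα : IsSmoothForm α) (hβ : IsSmoothForm β)
    (r : ℝ) {c : M} {y : Space3} (hy : y ∈ (extChartAt (𝓡 3) c).target) :
    wedgeInChart (formSegment α β r) (formSegment α β r) c y =
      (1 - r) * ((1 - r) * wedgeInChart α α c y + r * wedgeInChart α β c y) +
      r * ((1 - r) * wedgeInChart β α c y + r * wedgeInChart β β c y) := by
  rw [← wedgeInChart_formSegment_right hα hβ α r hy, ← wedgeInChart_formSegment_right hα hβ β r hy,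
    wedgeInChart, oneFormInChart_formSegment]
  simp [wedgeInChart, oneFormInChart_formSegment]

variable [IsManifold (𝓡 3) ∞ M]

theorem chartDeriv_self (x : M) : chartDeriv x x = ContinuousLinearMap.id ℝ Space3 := by
  have h1M : IsManifold (𝓡 3) 1 M := IsManifold.of_le (n := ∞) (by simp)
  exact mfderiv_extChartAt_self

theorem wedgeAt_eq_wedgeInChart (γ : (x : M) → TangentSpace (𝓡 3) x →L[ℝ] ℝ)
    (hα : IsSmoothForm α) (x : M) :
    wedgeAt γ α x = wedgeInChart γ α x (extChartAt (𝓡 3) x x) := by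
  rw [wedgeAt_eq γ hα (mem_extChartAt_source x), chartDeriv_self]
  simp [ContinuousLinearMap.det]

/-- The forms `(1 - r) α + r β` have nonvanishing volume forms. -/
def SegmentContact (α β : (x : M) → TangentSpace (𝓡 3) x →L[ℝ] ℝ) : Prop :=
  ∀ r ∈ Icc (0 : ℝ) 1, ∀ x, wedgeAt (formSegment α β r) (formSegment α β r) x ≠ 0

/-- Relative to α ∧ dα, the volume form of the segment is a quadratic in r and 1 - r with positive
coefficients. -/
theorem segmentContact_of_pos (hα : IsSmoothForm α) (hβ : IsSmoothForm β)
    (h0 : ∀ x, wedgeAt α α x ≠ 0) (h01 : ∀ x, 0 < wedgeAt α β x / wedgeAt α α x)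
    (h10 : ∀ x, 0 < wedgeAt β α x / wedgeAt α α x)
    (h11 : ∀ x, 0 < wedgeAt β β x / wedgeAt α α x) : SegmentContact α β := by
  intro r hr x
  have hy := mem_extChartAt_target (I := 𝓡 3) x
  have key : wedgeAt (formSegment α β r) (formSegment α β r) x = wedgeAt α α x *
      ((1 - r) * ((1 - r) + r * (wedgeAt α β x / wedgeAt α α x)) +
      r * ((1 - r) * (wedgeAt β α x / wedgeAt α α x) +
        r * (wedgeAt β β x / wedgeAt α α x))) := by
    have := h0 x
    field_simp
    rw [wedgeAt_eq_wedgeInChart _ (hα.formSegment hβ r), wedgeInChart_formSegment hα hβ r hy,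
      wedgeAt_eq_wedgeInChart _ hα, wedgeAt_eq_wedgeInChart _ hα, wedgeAt_eq_wedgeInChart _ hβ,
      wedgeAt_eq_wedgeInChart _ hβ]
    ring
  rw [key]
  refine mul_ne_zero (h0 x) (ne_of_gt ?_)
  have h1 := h01 x
  have h2 := h10 x
  have h3 := h11 x
  obtain ⟨hr0, hr1⟩ := hr
  have h4 : 0 ≤ 1 - r := by linarith
  rcases hr0.eq_or_lt with rfl | hr0
  · norm_num
  · positivity

/-- The vector field of Gray's stability theorem for the family `(1 - r) α + r β`. -/
noncomputable def grayField (α β : (x : M) → TangentSpace (𝓡 3) x →L[ℝ] ℝ) (s : ℝ) (x : M) :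
    TangentSpace (𝓡 3) x :=
  (deriv Real.smoothTransition s *
    (wedgeAt (formSegment α β (Real.smoothTransition s))
      (formSegment α β (Real.smoothTransition s)) x)⁻¹) •
    covectorCross (covectorAt α x) (covectorAt β x)

omit [IsManifold (𝓡 3) ∞ M] in
-- The segment is traversed at the pace of `Real.smoothTransition`, which is constant outside [0,
-- 1]; `exists_isotopy` needs a field supported in that time interval.
theorem grayField_eq_zero {s : ℝ} (hs : s ∉ Icc (0 : ℝ) 1) (x : M) : grayField α β s x = 0 := by
  have h : deriv Real.smoothTransition s = 0 := by
    rw [mem_Icc, not_and_or, not_le, not_le] at hs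
    rcases hs with hs | hs
    · have : Real.smoothTransition =ᶠ[𝓝 s] fun _ => 0 := by
        filter_upwards [gt_mem_nhds hs] with t ht
        exact Real.smoothTransition.zero_of_nonpos ht.le
      rw [this.deriv_eq, deriv_const]
    · have : Real.smoothTransition =ᶠ[𝓝 s] fun _ => 1 := by
        filter_upwards [lt_mem_nhds hs] with t ht
        exact Real.smoothTransition.one_of_one_le ht.le
      rw [this.deriv_eq, deriv_const]
  rw [grayField, h, zero_mul]
  exact zero_smul ℝ (covectorCross (covectorAt α x) (covectorAt β x))

theorem smoothTransition_mem_Icc (s : ℝ) : Real.smoothTransition s ∈ Icc (0 : ℝ) 1 :=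
  ⟨Real.smoothTransition.nonneg s, Real.smoothTransition.le_one s⟩

/-- The cross product acquires the determinant of the chart derivative and the inverse volume factor
its inverse, so the field does not depend on the chart. -/
theorem vectorFieldInChart_grayField (hα : IsSmoothForm α) (hβ : IsSmoothForm β) (s : ℝ) {c : M}
    {y : Space3} (hy : y ∈ (extChartAt (𝓡 3) c).target) :
    vectorFieldInChart (grayField α β s) c y = (deriv Real.smoothTransition s *
      (wedgeInChart (formSegment α β (Real.smoothTransition s))
        (formSegment α β (Real.smoothTransition s)) c y)⁻¹) •
      covectorCross (oneFormInChart α c y) (oneFormInChart β c y) := by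
  have hx := (extChartAt (𝓡 3) c).map_target hy
  have h1 := wedgeAt_eq (formSegment α β (Real.smoothTransition s))
    (hα.formSegment hβ (Real.smoothTransition s)) hx
  have h2 := chartDeriv_covectorCross α β hx
  rw [(extChartAt (𝓡 3) c).right_inv hy] at h1 h2
  have h3 : vectorFieldInChart (grayField α β s) c y =
    chartDeriv c ((extChartAt (𝓡 3) c).symm y) ((deriv Real.smoothTransition s *
    (wedgeAt (formSegment α β (Real.smoothTransition s))
      (formSegment α β (Real.smoothTransition s)) ((extChartAt (𝓡 3) c).symm y))⁻¹) •
    covectorCross (covectorAt α ((extChartAt (𝓡 3) c).symm y))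
      (covectorAt β ((extChartAt (𝓡 3) c).symm y))) := rfl
  have h4 := chartDeriv_det_ne_zero hx
  rw [h3, map_smul, h2, h1, smul_smul, mul_inv]
  congr 1
  field_simp

theorem contDiffOn_grayField (hα : IsSmoothForm α) (hβ : IsSmoothForm β)
    (hc : SegmentContact α β) (c : M) :
    ContDiffOn ℝ ∞ (fun p : ℝ × Space3 => vectorFieldInChart (grayField α β p.1) c p.2)
      (univ ×ˢ (extChartAt (𝓡 3) c).target) := by
  have hσ : ContDiff ℝ ∞ Real.smoothTransition := Real.smoothTransition.contDiff
  have hσ' : ContDiff ℝ ∞ (deriv Real.smoothTransition) :=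
    ((contDiff_infty_iff_deriv (𝕜 := ℝ)).1 hσ).2
  have hw : ∀ γ δ : (x : M) → TangentSpace (𝓡 3) x →L[ℝ] ℝ, IsSmoothForm γ → IsSmoothForm δ →
      ContDiffOn ℝ ∞ (fun p : ℝ × Space3 => wedgeInChart γ δ c p.2)
        (univ ×ˢ (extChartAt (𝓡 3) c).target) := fun γ δ hγ hδ p hp =>
    ((hγ.contDiffAt_wedgeInChart hδ hp.2).comp p contDiffAt_snd).contDiffWithinAt
  have h00 := hw α α hα hα
  have h01 := hw α β hα hβ
  have h10 := hw β α hβ hα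
  have h11 := hw β β hβ hβ
  have hs : ContDiffOn ℝ ∞ (fun p : ℝ × Space3 => Real.smoothTransition p.1)
      (univ ×ˢ (extChartAt (𝓡 3) c).target) := (hσ.comp contDiff_fst).contDiffOn
  have hs' : ContDiffOn ℝ ∞ (fun p : ℝ × Space3 => deriv Real.smoothTransition p.1)
      (univ ×ˢ (extChartAt (𝓡 3) c).target) := (hσ'.comp contDiff_fst).contDiffOn
  have hseg : ContDiffOn ℝ ∞ (fun p : ℝ × Space3 =>
      wedgeInChart (formSegment α β (Real.smoothTransition p.1))
        (formSegment α β (Real.smoothTransition p.1)) c p.2)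
      (univ ×ˢ (extChartAt (𝓡 3) c).target) := by
    refine ContDiffOn.congr ?_ fun p hp => wedgeInChart_formSegment hα hβ _ hp.2
    fun_prop
  have hcross : ContDiffOn ℝ ∞ (fun p : ℝ × Space3 =>
      covectorCross (oneFormInChart α c p.2) (oneFormInChart β c p.2))
      (univ ×ˢ (extChartAt (𝓡 3) c).target) := fun p hp =>
    (((hα.contDiffAt hp.2).covectorCross (hβ.contDiffAt hp.2)).comp p
      contDiffAt_snd).contDiffWithinAt
  refine ((hs'.mul (hseg.inv fun p hp => ?_)).smul hcross).congr fun p hp =>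
    vectorFieldInChart_grayField hα hβ p.1 hp.2
  exact wedgeInChart_ne_zero (hα.formSegment hβ _)
    (hc _ (smoothTransition_mem_Icc p.1)) hp.2

/-- The logarithmic derivative of the forms along Gray's isotopy. -/
noncomputable def grayFactor (α β : (x : M) → TangentSpace (𝓡 3) x →L[ℝ] ℝ) (s : ℝ) (x : M) : ℝ :=
  deriv Real.smoothTransition s *
    ((wedgeAt β (formSegment α β (Real.smoothTransition s)) x -
      wedgeAt α (formSegment α β (Real.smoothTransition s)) x) /
    wedgeAt (formSegment α β (Real.smoothTransition s))
      (formSegment α β (Real.smoothTransition s)) x)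

theorem continuous_grayFactor (hα : IsSmoothForm α) (hβ : IsSmoothForm β)
    (hc : SegmentContact α β) : Continuous fun p : ℝ × M => grayFactor α β p.1 p.2 := by
  have h0 : ∀ x, wedgeAt α α x ≠ 0 := fun x => by
    have h := hc 0 (by simp) x
    have h1 : formSegment α β 0 = α := by
      funext x
      ext v
      simp [formSegment]
    rwa [h1] at h
  have hσ : Continuous Real.smoothTransition := Real.smoothTransition.continuous
  have hσ' : Continuous (deriv Real.smoothTransition) :=
    (Real.smoothTransition.contDiff (n := 1)).continuous_deriv (by simp)
  have hw : ∀ γ δ : (x : M) → TangentSpace (𝓡 3) x →L[ℝ] ℝ, IsSmoothForm γ → IsSmoothForm δ →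
      Continuous fun p : ℝ × M => wedgeAt γ δ p.2 / wedgeAt α α p.2 := fun γ δ hγ hδ =>
    (continuous_wedgeAt_div hγ hδ hα h0).comp continuous_snd
  have h01 := hw α β hα hβ
  have h10 := hw β α hβ hα
  have h11 := hw β β hβ hβ
  have hr : ∀ (γ : (x : M) → TangentSpace (𝓡 3) x →L[ℝ] ℝ) (r : ℝ) (x : M),
      wedgeAt γ (formSegment α β r) x = (1 - r) * wedgeAt γ α x + r * wedgeAt γ β x := by
    intro γ r x
    rw [wedgeAt_eq_wedgeInChart _ (hα.formSegment hβ r),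
      wedgeInChart_formSegment_right hα hβ γ r (mem_extChartAt_target x),
      wedgeAt_eq_wedgeInChart _ hα, wedgeAt_eq_wedgeInChart _ hβ]
  have hl : ∀ (r : ℝ) (x : M), wedgeAt (formSegment α β r) (formSegment α β r) x =
      (1 - r) * wedgeAt α (formSegment α β r) x + r * wedgeAt β (formSegment α β r) x := by
    intro r x
    simp only [wedgeAt]
    rfl
  -- All products are divided by α ∧ dα, since only the quotients are continuous on M; the
  -- normalization cancels in the factor.
  set D : ℝ × M → ℝ := fun p =>
    (1 - Real.smoothTransition p.1) * ((1 - Real.smoothTransition p.1) +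
      Real.smoothTransition p.1 * (wedgeAt α β p.2 / wedgeAt α α p.2)) +
    Real.smoothTransition p.1 *
      ((1 - Real.smoothTransition p.1) * (wedgeAt β α p.2 / wedgeAt α α p.2) +
      Real.smoothTransition p.1 * (wedgeAt β β p.2 / wedgeAt α α p.2)) with hD
  have hDw : ∀ p : ℝ × M, wedgeAt (formSegment α β (Real.smoothTransition p.1))
      (formSegment α β (Real.smoothTransition p.1)) p.2 = wedgeAt α α p.2 * D p := fun p => by
    have := h0 p.2
    rw [hl, hr, hr, hD]
    field_simp
  have hD0 : ∀ p, D p ≠ 0 := fun p h => by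
    refine hc _ (smoothTransition_mem_Icc p.1) p.2 ?_
    rw [hDw, h, mul_zero]
  have heq : (fun p : ℝ × M => grayFactor α β p.1 p.2) = fun p =>
      deriv Real.smoothTransition p.1 *
      (((1 - Real.smoothTransition p.1) * (wedgeAt β α p.2 / wedgeAt α α p.2) +
      Real.smoothTransition p.1 * (wedgeAt β β p.2 / wedgeAt α α p.2) -
      ((1 - Real.smoothTransition p.1) +
      Real.smoothTransition p.1 * (wedgeAt α β p.2 / wedgeAt α α p.2))) / D p) := by
    funext p
    have h1 := h0 p.2
    have h2 := hD0 p
    rw [grayFactor, hDw, hr, hr]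
    congr 1
    field_simp
  rw [heq]
  have hDc : Continuous D := by fun_prop
  refine Continuous.mul (by fun_prop) (Continuous.div (by fun_prop) hDc hD0)

end Gray

/-! ### Gray stability on the manifold -/

section Isotopy

variable {M : Type*} [TopologicalSpace M] [ChartedSpace Space3 M] [IsManifold (𝓡 3) ∞ M]
  {α β : (x : M) → TangentSpace (𝓡 3) x →L[ℝ] ℝ}

/-- The derivative of a map between manifolds, as a map of the model space. -/
noncomputable def pointDeriv (f : M → M) (x : M) : Space3 →L[ℝ] Space3 :=
  mfderiv (𝓡 3) (𝓡 3) f x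

/-- `hasDerivAt_pullback_form` applied to the isotopy read in two charts: one at x₀ in the source
and one at the position at time s₀ in the target, the latter kept fixed while s varies near s₀. -/
theorem hasDerivAt_gray (hα : IsSmoothForm α) (hβ : IsSmoothForm β) (hc : SegmentContact α β)
    {Φ : ℝ → (M ≃ₘ⟮𝓡 3, 𝓡 3⟯ M)}
    (hΦ : ContMDiff (𝓘(ℝ, ℝ).prod (𝓡 3)) (𝓡 3) ∞ (fun p : ℝ × M => Φ p.1 p.2))
    (hΦ' : ∀ x s, HasMFDerivAt 𝓘(ℝ, ℝ) (𝓡 3) (fun s => Φ s x) s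
      ((1 : ℝ →L[ℝ] ℝ).smulRight (grayField α β s (Φ s x)))) (x₀ : M) (v : Space3) (s₀ : ℝ) :
    HasDerivAt (fun s => covectorAt (formSegment α β (Real.smoothTransition s)) (Φ s x₀)
        (pointDeriv (Φ s) x₀ v))
      (grayFactor α β s₀ (Φ s₀ x₀) *
        covectorAt (formSegment α β (Real.smoothTransition s₀)) (Φ s₀ x₀)
          (pointDeriv (Φ s₀) x₀ v)) s₀ := by
  have h1M : IsManifold (𝓡 3) 1 M := IsManifold.of_le (n := ∞) (by simp)
  set c := Φ s₀ x₀ with hcdef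
  set φ := extChartAt (𝓡 3) c with hφ
  set ψ := extChartAt (𝓡 3) x₀ with hψ
  set z₀ := ψ x₀ with hz₀
  have hψz : ψ.symm z₀ = x₀ := extChartAt_to_inv x₀
  set G : ℝ × Space3 → Space3 := fun p => φ (Φ p.1 (ψ.symm p.2)) with hG
  set a : ℝ × Space3 → Space3 →L[ℝ] ℝ := fun p =>
    (1 - Real.smoothTransition p.1) • oneFormInChart α c p.2 +
      Real.smoothTransition p.1 • oneFormInChart β c p.2 with ha
  set X : ℝ × Space3 → Space3 := fun p => vectorFieldInChart (grayField α β p.1) c p.2 with hX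
  have hz₀t : z₀ ∈ ψ.target := mem_extChartAt_target x₀
  have hGz : G (s₀, z₀) = φ c := by
    simp only [hG, hψz, hcdef]
  have hct : φ c ∈ φ.target := mem_extChartAt_target c
  have hopen : ∀ᶠ p : ℝ × Space3 in 𝓝 (s₀, z₀), p.2 ∈ ψ.target ∧
      Φ p.1 (ψ.symm p.2) ∈ φ.source := by
    have h1 : ContinuousAt (fun p : ℝ × Space3 => Φ p.1 (ψ.symm p.2)) (s₀, z₀) := by
      have h2 : ContinuousAt (fun p : ℝ × Space3 => (p.1, ψ.symm p.2)) (s₀, z₀) :=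
        continuousAt_fst.prodMk (ContinuousAt.comp (g := ψ.symm) (f := Prod.snd)
          (continuousAt_extChartAt_symm x₀) continuousAt_snd)
      exact (hΦ.continuous.continuousAt).comp h2
    refine (continuousAt_snd.eventually_mem ((isOpen_extChartAt_target x₀).mem_nhds hz₀t)).and
      (h1.eventually_mem ((isOpen_extChartAt_source c).mem_nhds ?_))
    simp only [hψz]
    exact mem_extChartAt_source c
  have hσ : ContDiff ℝ ∞ Real.smoothTransition := Real.smoothTransition.contDiff
  have hGs : ContDiffAt ℝ ∞ G (s₀, z₀) := by
    have h1 : ContMDiffAt (𝓘(ℝ, ℝ).prod 𝓘(ℝ, Space3)) (𝓡 3) ∞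
        (fun p : ℝ × Space3 => ψ.symm p.2) (s₀, z₀) :=
      ContMDiffAt.comp (s₀, z₀) (g := ψ.symm) (f := Prod.snd)
        ((contMDiffOn_extChartAt_symm x₀).contMDiffAt
        ((isOpen_extChartAt_target x₀).mem_nhds hz₀t)) contMDiffAt_snd
    have h2 : ContMDiffAt (𝓘(ℝ, ℝ).prod 𝓘(ℝ, Space3)) (𝓡 3) ∞
        (fun p : ℝ × Space3 => Φ p.1 (ψ.symm p.2)) (s₀, z₀) :=
      ContMDiffAt.comp (s₀, z₀) (g := fun p : ℝ × M => Φ p.1 p.2) hΦ.contMDiffAt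
        (contMDiffAt_fst.prodMk h1)
    have h3 : ContMDiffAt (𝓘(ℝ, ℝ).prod 𝓘(ℝ, Space3)) 𝓘(ℝ, Space3) ∞ G (s₀, z₀) := by
      refine ContMDiffAt.comp (s₀, z₀) (g := φ) (contMDiffAt_extChartAt' ?_) h2
      simp only [hψz]
      exact mem_chart_source Space3 c
    rw [← contMDiffAt_iff_contDiffAt, modelWithCornersSelf_prod, ← chartedSpaceSelf_prod]
    exact h3
  have hXs : ContDiffAt ℝ ∞ X (s₀, G (s₀, z₀)) := by
    rw [hGz]
    exact (contDiffOn_grayField hα hβ hc c).contDiffAt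
      ((isOpen_univ.prod (isOpen_extChartAt_target c)).mem_nhds ⟨mem_univ _, hct⟩)
  have has : ContDiffAt ℝ ∞ a (s₀, G (s₀, z₀)) := by
    rw [hGz]
    have h1 : ContDiffAt ℝ ∞ (fun p : ℝ × Space3 => Real.smoothTransition p.1) (s₀, φ c) :=
      (hσ.comp contDiff_fst).contDiffAt
    have h2 : ContDiffAt ℝ ∞ (fun p : ℝ × Space3 => oneFormInChart α c p.2) (s₀, φ c) :=
      (hα.contDiffAt hct).comp (s₀, φ c) contDiffAt_snd
    have h3 : ContDiffAt ℝ ∞ (fun p : ℝ × Space3 => oneFormInChart β c p.2) (s₀, φ c) :=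
      (hβ.contDiffAt hct).comp (s₀, φ c) contDiffAt_snd
    fun_prop
  have hflow : ∀ᶠ p in 𝓝 (s₀, z₀), fderiv ℝ G p (1, 0) = X (p.1, G p) := by
    have hdiff : ∀ᶠ p in 𝓝 (s₀, z₀), DifferentiableAt ℝ G p :=
      ((hGs.of_le (m := 1) (by simp)).eventually (by simp)).mono
        fun p hp => hp.differentiableAt (by simp)
    filter_upwards [hopen, hdiff] with p hp hd
    have h1 : HasDerivAt (fun s : ℝ => (s, p.2)) ((1 : ℝ), (0 : Space3)) p.1 :=
      (hasDerivAt_id p.1).prodMk (hasDerivAt_const p.1 p.2)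
    have h2 : HasDerivAt (fun s => G (s, p.2)) (fderiv ℝ G p (1, 0)) p.1 :=
      HasFDerivAt.comp_hasDerivAt p.1 (f := fun s : ℝ => (s, p.2)) hd.hasFDerivAt h1
    have h3 := (mdifferentiableAt_extChartAt (I := 𝓡 3) (x := c) (y := Φ p.1 (ψ.symm p.2))
      (by rw [← extChartAt_source (𝓡 3)]; exact hp.2)).hasMFDerivAt
    have h4 := HasMFDerivAt.comp p.1 h3 (hΦ' (ψ.symm p.2) p.1)
    let Y : Space3 := grayField α β p.1 (Φ p.1 (ψ.symm p.2))
    have h5 : HasFDerivAt (fun s => G (s, p.2)) ((chartDeriv c (Φ p.1 (ψ.symm p.2))).comp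
        ((1 : ℝ →L[ℝ] ℝ).smulRight Y)) p.1 := hasMFDerivAt_iff_hasFDerivAt.1 h4
    have h6 : HasDerivAt (fun s => G (s, p.2)) (chartDeriv c (Φ p.1 (ψ.symm p.2)) Y) p.1 :=
      h5.hasDerivAt.congr_deriv (by simp)
    rw [h2.unique h6]
    -- The chart expression evaluates the field at φ.symm (φ x), whose tangent space is a different
    -- type from that at x; generalizing the point lets the equality be substituted.
    have h7 : ∀ x : M, x = Φ p.1 (ψ.symm p.2) →
        chartDeriv c (Φ p.1 (ψ.symm p.2)) Y = chartDeriv c x (grayField α β p.1 x) := by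
      rintro x rfl
      rfl
    exact h7 _ (φ.left_inv hp.2)
  have haX : ∀ᶠ q in 𝓝 (s₀, G (s₀, z₀)), a q (X q) = 0 := by
    rw [hGz]
    filter_upwards [continuousAt_snd.eventually_mem
      ((isOpen_extChartAt_target c).mem_nhds hct)] with q hq
    simp only [hX, ha]
    rw [vectorFieldInChart_grayField hα hβ q.1 hq, map_smul]
    simp [apply_covectorCross_left, apply_covectorCross_right]
  have hfac : grayFactor α β s₀ c = deriv Real.smoothTransition s₀ *
      ((oneFormInChart β c (φ c) (twoFormVec (flatD (fun y => a (s₀, y)) (φ c))) -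
        oneFormInChart α c (φ c) (twoFormVec (flatD (fun y => a (s₀, y)) (φ c)))) /
      a (s₀, φ c) (twoFormVec (flatD (fun y => a (s₀, y)) (φ c)))) := by
    rw [grayFactor, wedgeAt_eq_wedgeInChart _ (hα.formSegment hβ _),
      wedgeAt_eq_wedgeInChart _ (hα.formSegment hβ _),
      wedgeAt_eq_wedgeInChart _ (hα.formSegment hβ _)]
    rfl
  have hgray : ∀ v, fderiv ℝ a (s₀, G (s₀, z₀)) (1, 0) v +
      flatD (fun y => a (s₀, y)) (G (s₀, z₀)) (X (s₀, G (s₀, z₀))) v =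
      grayFactor α β s₀ c * a (s₀, G (s₀, z₀)) v := by
    intro v
    have hda := (has.differentiableAt (by simp)).hasFDerivAt
    rw [hGz] at hda ⊢
    have h1 : HasDerivAt (fun s : ℝ => (s, φ c)) ((1 : ℝ), (0 : Space3)) s₀ :=
      (hasDerivAt_id s₀).prodMk (hasDerivAt_const s₀ (φ c))
    have h2 : HasDerivAt (fun s => a (s, φ c)) (fderiv ℝ a (s₀, φ c) (1, 0)) s₀ :=
      HasFDerivAt.comp_hasDerivAt s₀ (f := fun s : ℝ => (s, φ c)) hda h1
    have hσd : HasDerivAt Real.smoothTransition (deriv Real.smoothTransition s₀) s₀ :=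
      (hσ.differentiable (by simp) s₀).hasDerivAt
    have h3 : HasDerivAt (fun s => a (s, φ c)) (deriv Real.smoothTransition s₀ •
        (oneFormInChart β c (φ c) - oneFormInChart α c (φ c))) s₀ := by
      refine (((hσd.const_sub 1).smul_const (oneFormInChart α c (φ c))).add
        (hσd.smul_const (oneFormInChart β c (φ c)))).congr_deriv ?_
      rw [smul_sub, neg_smul]
      abel
    have hne : a (s₀, φ c) (twoFormVec (flatD (fun y => a (s₀, y)) (φ c))) ≠ 0 :=
      wedgeInChart_ne_zero (hα.formSegment hβ _) (hc _ (smoothTransition_mem_Icc s₀)) hct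
    rw [h2.unique h3, hfac]
    have hXc : X (s₀, φ c) = (deriv Real.smoothTransition s₀ *
        (a (s₀, φ c) (twoFormVec (flatD (fun y => a (s₀, y)) (φ c))))⁻¹) •
        covectorCross (oneFormInChart α c (φ c)) (oneFormInChart β c (φ c)) :=
      vectorFieldInChart_grayField hα hβ s₀ hct
    rw [hXc]
    exact gray_identity (isTwoForm_flatD _ _) _ _ _ _ hne v
  have hmain := hasDerivAt_pullback_form hGs hXs has hflow haX hgray (chartDeriv x₀ x₀ v)
  have hcurve : ∀ᶠ s in 𝓝 s₀, DifferentiableAt ℝ G (s, z₀) ∧ Φ s x₀ ∈ φ.source := by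
    have hdiff : ∀ᶠ p in 𝓝 (s₀, z₀), DifferentiableAt ℝ G p :=
      ((hGs.of_le (m := 1) (by simp)).eventually (by simp)).mono
        fun p hp => hp.differentiableAt (by simp)
    have h1 : ContinuousAt (fun s : ℝ => (s, z₀)) s₀ := by fun_prop
    filter_upwards [h1.eventually (hopen.and hdiff)] with s hs
    refine ⟨hs.2, ?_⟩
    have := hs.1.2
    rwa [hψz] at this
  have heq : ∀ᶠ s in 𝓝 s₀, covectorAt (formSegment α β (Real.smoothTransition s)) (Φ s x₀)
      (pointDeriv (Φ s) x₀ v) =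
      a (s, G (s, z₀)) (fderiv ℝ G (s, z₀) (0, chartDeriv x₀ x₀ v)) := by
    let L : Space3 →L[ℝ] Space3 := mfderiv 𝓘(ℝ, Space3) (𝓡 3) ψ.symm z₀
    have hL : L (chartDeriv x₀ x₀ v) = v := by
      have h : L (chartDeriv x₀ (ψ.symm z₀) v) = v := mfderiv_extChartAt_symm_comp hz₀t v
      rwa [hψz] at h
    filter_upwards [hcurve] with s hs
    have h1 : HasFDerivAt (fun z : Space3 => (s, z)) (ContinuousLinearMap.inr ℝ ℝ Space3) z₀ :=
      hasFDerivAt_prodMk_right s z₀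
    have h2 : HasFDerivAt (fun z => G (s, z)) _ z₀ :=
      HasFDerivAt.comp z₀ (f := fun z : Space3 => (s, z)) hs.1.hasFDerivAt h1
    have hsymm := (mdifferentiableAt_extChartAt_symm_of_mem hz₀t).hasMFDerivAt
    have hφd := (mdifferentiableAt_extChartAt (I := 𝓡 3) (x := c) (y := Φ s x₀)
      (by rw [← extChartAt_source (𝓡 3)]; exact hs.2)).hasMFDerivAt
    have hΦd : HasMFDerivAt (𝓡 3) (𝓡 3) (Φ s) x₀ (mfderiv (𝓡 3) (𝓡 3) (Φ s) x₀) :=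
      ((Φ s).contMDiff.mdifferentiable (by simp) x₀).hasMFDerivAt
    have h3 := hφd.comp x₀ hΦd
    have h4 : HasMFDerivAt 𝓘(ℝ, Space3) 𝓘(ℝ, Space3) (fun z => G (s, z)) z₀ _ :=
      HasMFDerivAt.comp z₀ (g := φ ∘ Φ s) (f := ψ.symm) (by rw [hψz]; exact h3) hsymm
    have h5 : HasFDerivAt (fun z => G (s, z))
        (((chartDeriv c (Φ s x₀)).comp (pointDeriv (Φ s) x₀)).comp L) z₀ :=
      hasMFDerivAt_iff_hasFDerivAt.1 h4
    have h7 : fderiv ℝ G (s, z₀) (0, chartDeriv x₀ x₀ v) =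
        chartDeriv c (Φ s x₀) (pointDeriv (Φ s) x₀ v) := by
      have h6 := DFunLike.congr_fun (h2.unique h5) (chartDeriv x₀ x₀ v)
      simpa [hL] using h6
    have h8 := DFunLike.congr_fun (oneFormInChart_comp_chartDeriv
      (formSegment α β (Real.smoothTransition s)) hs.2) (pointDeriv (Φ s) x₀ v)
    rw [← h8, h7]
    simp only [hG, hψz]
    rfl
  refine HasDerivAt.congr_of_eventuallyEq ?_ heq
  rw [heq.self_of_nhds]
  exact hmain

/-- Gray's stability theorem for the linear interpolation of two 1-forms. -/
theorem exists_isotopy_of_segmentContact [T2Space M] [CompactSpace M] (hα : IsSmoothForm α)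
    (hβ : IsSmoothForm β) (hc : SegmentContact α β) :
    ∃ Φ : ℝ → (M ≃ₘ⟮𝓡 3, 𝓡 3⟯ M),
      ContMDiff (𝓘(ℝ, ℝ).prod (𝓡 3)) (𝓡 3) ∞ (fun p : ℝ × M => Φ p.1 p.2) ∧
      (∀ x, Φ 0 x = x) ∧
      ∀ x v, covectorAt α x v = 0 ↔ covectorAt β (Φ 1 x) (pointDeriv (Φ 1) x v) = 0 := by
  obtain ⟨Φ, hΦ, hΦ0, hΦ'⟩ := exists_isotopy (contDiffOn_grayField hα hβ hc)
    fun s hs x => grayField_eq_zero hs x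
  refine ⟨Φ, hΦ, hΦ0, fun x v => ?_⟩
  set u : ℝ → ℝ := fun s => covectorAt (formSegment α β (Real.smoothTransition s)) (Φ s x)
    (pointDeriv (Φ s) x v) with hu
  set h : ℝ → ℝ := fun s => grayFactor α β s (Φ s x) with hh
  have hd : ∀ s, HasDerivAt u (h s * u s) s := fun s => hasDerivAt_gray hα hβ hc hΦ hΦ' x v s
  have hcont : Continuous h := by
    have h1 : Continuous fun s : ℝ => (s, Φ s x) :=
      continuous_id.prodMk (hΦ.continuous.comp (continuous_id.prodMk continuous_const))
    exact (continuous_grayFactor hα hβ hc).comp h1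
  have hH : ∀ s, HasDerivAt (fun s => ∫ r in (0 : ℝ)..s, h r) (h s) s := fun s =>
    hcont.integral_hasStrictDerivAt 0 s |>.hasDerivAt
  -- Integrating factor for the linear equation u' = h u: u at time 1 is a nonzero multiple of u at
  -- time 0, so they vanish together.
  have hconst : ∀ s, HasDerivAt (fun s => u s * Real.exp (-∫ r in (0 : ℝ)..s, h r)) 0 s := by
    intro s
    refine ((hd s).mul (hH s).neg.exp).congr_deriv ?_
    ring
  have h01 := is_const_of_deriv_eq_zero (fun s => (hconst s).differentiableAt)
    (fun s => (hconst s).deriv) 0 1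
  have h0 : u 0 = covectorAt α x v := by
    have hid : (Φ 0 : M → M) = id := funext hΦ0
    have h1 : pointDeriv (Φ 0) x = ContinuousLinearMap.id ℝ Space3 := by
      rw [hid]; exact mfderiv_id
    have h2 : formSegment α β (Real.smoothTransition 0) = α := by
      funext x
      ext v
      simp [formSegment, Real.smoothTransition.zero]
    simp only [hu]
    rw [h1, h2, hΦ0]
    rfl
  have h1 : u 1 = covectorAt β (Φ 1 x) (pointDeriv (Φ 1) x v) := by
    have h2 : formSegment α β (Real.smoothTransition 1) = β := by
      funext x
      ext v
      simp [formSegment, Real.smoothTransition.one]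
    simp only [hu]
    rw [h2]
  rw [← h0, ← h1]
  simp only [intervalIntegral.integral_same, neg_zero, Real.exp_zero, mul_one] at h01
  rw [h01]
  simp

end Isotopy

/-! ### Tangents to fibers and parallel Reeb fields -/

section Fibers

variable {M : Type*} [TopologicalSpace M] [ChartedSpace Space3 M] {B : Type*}

theorem IsFiberedSolidTorus.exists_center_eq {π : M → B} {x : M} {m k : ℕ} {T : ℝ}
    {q : ℝ × ℂ → M} (hq : IsFiberedSolidTorus π (π x) m k T q) : ∃ s, q (s, 0) = x := by
  have h := hq.fiber_eq 0 0 (Metric.mem_ball_self one_pos)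
  rw [hq.center] at h
  have hx : x ∈ π ⁻¹' {π x} := rfl
  rwa [h] at hx

/-- A curve with image in the central fiber of a fibered solid torus is tangent to it. -/
theorem IsFiberedSolidTorus.exists_smul_eq {π : M → B} {x : M} {m k : ℕ} {T : ℝ}
    {q : ℝ × ℂ → M} (hq : IsFiberedSolidTorus π (π x) m k T q) {s₀ : ℝ} (hs₀ : q (s₀, 0) = x)
    {γ : ℝ → M} {V : Space3} (hγ : HasMFDerivAt 𝓘(ℝ, ℝ) (𝓡 3) γ 0 ((1 : ℝ →L[ℝ] ℝ).smulRight V))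
    (hγ0 : γ 0 = x) (hfib : ∀ t, π (γ t) = π x) :
    ∃ r : ℝ, V = r • (mfderiv 𝓘(ℝ, ℝ × ℂ) (𝓡 3) q (s₀, 0) ((1, 0) : ℝ × ℂ) : Space3) := by
  subst hs₀
  have h0 : (0 : ℂ) ∈ Metric.ball (0 : ℂ) 1 := Metric.mem_ball_self one_pos
  have hf : IsLocalDiffeomorphAt 𝓘(ℝ, ℝ × ℂ) (𝓡 3) ∞ q (s₀, 0) :=
    hq.localDiffeo ⟨(s₀, 0), mem_univ _, h0⟩
  have hψ0 : hf.localInverse (q (s₀, 0)) = (s₀, 0) :=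
    hf.localInverse_left_inv hf.localInverse_mem_target
  have hψd := (hf.localInverse_mdifferentiableAt (by simp)).hasMFDerivAt
  have hqd := (hf.mdifferentiableAt (by simp)).hasMFDerivAt
  let P : Space3 →L[ℝ] ℝ × ℂ := mfderiv (𝓡 3) 𝓘(ℝ, ℝ × ℂ) hf.localInverse (q (s₀, 0))
  let Q : ℝ × ℂ →L[ℝ] Space3 := mfderiv 𝓘(ℝ, ℝ × ℂ) (𝓡 3) q (s₀, 0)
  have hQP : Q (P V) = V := by
    have h1 : HasMFDerivAt (𝓡 3) (𝓡 3) (q ∘ hf.localInverse) (q (s₀, 0)) (Q.comp P) :=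
      HasMFDerivAt.comp (q (s₀, 0)) (by rw [hψ0]; exact hqd) hψd
    have h2 : HasMFDerivAt (𝓡 3) (𝓡 3) (q ∘ hf.localInverse) (q (s₀, 0))
        (ContinuousLinearMap.id ℝ Space3) :=
      (hasMFDerivAt_id (q (s₀, 0))).congr_of_eventuallyEq hf.localInverse_eventuallyEq_right
    exact DFunLike.congr_fun (hasMFDerivAt_unique h1 h2) V
  have hcont : ContinuousAt γ 0 := hγ.continuousAt
  -- Points of the disk identified with a point of the core are rotations of 0, so a lift of a curve
  -- in the central fiber has zero disk coordinate.
  have hev : ∀ᶠ t in 𝓝 (0 : ℝ), (hf.localInverse (γ t)).2 = 0 := by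
    have h1 : ∀ᶠ t in 𝓝 (0 : ℝ), q (hf.localInverse (γ t)) = γ t := by
      rw [ContinuousAt, hγ0] at hcont
      exact hcont.eventually hf.localInverse_eventuallyEq_right
    have h2 : ∀ᶠ t in 𝓝 (0 : ℝ), (hf.localInverse (γ t)).2 ∈ Metric.ball (0 : ℂ) 1 := by
      have h3 : ContinuousAt (fun t => (hf.localInverse (γ t)).2) 0 := by
        have h4 : ContinuousAt hf.localInverse (γ 0) := by
          rw [hγ0]; exact hf.localInverse_contMDiffAt.continuousAt
        exact (h4.comp hcont).snd
      refine h3.eventually_mem (Metric.isOpen_ball.mem_nhds ?_)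
      rw [hγ0, hψ0]
      exact h0
    filter_upwards [h1, h2] with t ht1 ht2
    have h3 : γ t ∈ π ⁻¹' {π (q (0, 0))} := by
      rw [hq.center]; exact hfib t
    rw [hq.fiber_eq 0 0 h0] at h3
    obtain ⟨s, hs⟩ := h3
    have hs' : q (s, 0) = q ((hf.localInverse (γ t)).1, (hf.localInverse (γ t)).2) := by
      rw [Prod.mk.eta, ht1]; exact hs
    obtain ⟨j, -, hj⟩ := (hq.eq_iff _ _ 0 h0 _ ht2).1 hs'
    rw [hj, mul_zero]
  have hPV : (P V).2 = 0 := by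
    have h1 : HasMFDerivAt 𝓘(ℝ, ℝ) 𝓘(ℝ, ℝ × ℂ) (hf.localInverse ∘ γ) 0
        (P.comp ((1 : ℝ →L[ℝ] ℝ).smulRight V)) :=
      HasMFDerivAt.comp 0 (by rw [hγ0]; exact hψd) hγ
    have h2 : HasFDerivAt (hf.localInverse ∘ γ) (P.comp ((1 : ℝ →L[ℝ] ℝ).smulRight V)) 0 :=
      hasMFDerivAt_iff_hasFDerivAt.1 h1
    have h3 := h2.snd
    have h4 : HasFDerivAt (fun t => (hf.localInverse (γ t)).2) (0 : ℝ →L[ℝ] ℂ) 0 :=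
      (hasFDerivAt_const (0 : ℂ) (0 : ℝ)).congr_of_eventuallyEq hev
    have h5 := DFunLike.congr_fun (h3.unique h4) 1
    simpa using h5
  refine ⟨(P V).1, ?_⟩
  have h6 : P V = (P V).1 • ((1, 0) : ℝ × ℂ) := by
    ext1
    · simp
    · simp [hPV]
  change V = (P V).1 • Q (1, 0)
  rw [← map_smul, ← h6, hQP]

end Fibers

section Reeb

variable {M : Type*} [TopologicalSpace M] [ChartedSpace Space3 M]
  {α β : (x : M) → TangentSpace (𝓡 3) x →L[ℝ] ℝ}

/-- The vectors of dα and dβ are (α ∧ dα) R and (β ∧ dβ) R'. With R' = r R the mixed products are r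
(β ∧ dβ) and (α ∧ dα) β(R), and r β(R) = β(R') = 1. -/
theorem wedgeAt_mul_of_parallel {x : M} {R R' : Space3} {r : ℝ} (hR : covectorAt α x R = 1)
    (hRd : ∀ v, twoFormAt α x R v = 0) (hR' : covectorAt β x R' = 1)
    (hRd' : ∀ v, twoFormAt β x R' v = 0) (hpar : R' = r • R) :
    wedgeAt α β x * wedgeAt β α x = wedgeAt α α x * wedgeAt β β x := by
  have h1 := (isTwoForm_twoFormAt α x).eq_smul_of_ker (covectorAt α x) hRd
  have h2 := (isTwoForm_twoFormAt β x).eq_smul_of_ker (covectorAt β x) hRd'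
  rw [hR, one_smul] at h1
  rw [hR', one_smul, hpar] at h2
  have h3 : covectorAt β x (twoFormVec (twoFormAt α x)) =
      wedgeAt α α x * covectorAt β x R := by
    rw [← h1, map_smul]; rfl
  have h4 : covectorAt α x (twoFormVec (twoFormAt β x)) = wedgeAt β β x * r := by
    rw [← h2, map_smul, map_smul, hR]
    simp [wedgeAt]
  rw [hpar, map_smul, smul_eq_mul] at hR'
  rw [show wedgeAt α β x = _ from h4, show wedgeAt β α x = _ from h3]
  linear_combination wedgeAt α α x * wedgeAt β β x * hR'

end Reeb

/-! ### Sign correction and conclusion -/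

section Main

variable {M : Type*} [TopologicalSpace M] [ChartedSpace Space3 M] [IsManifold (𝓡 3) ∞ M]
  {α β : (x : M) → TangentSpace (𝓡 3) x →L[ℝ] ℝ}

/-- Two contact forms with parallel Reeb fields are joined, up to the sign of one of them,
by a segment of contact forms. -/
theorem exists_segmentContact [T2Space M] [CompactSpace M] (hα : IsSmoothForm α)
    (hβ : IsSmoothForm β) (h0 : ∀ x, wedgeAt α α x ≠ 0) (h1 : ∀ x, wedgeAt β β x ≠ 0)
    (hpar : ∀ x, wedgeAt α β x * wedgeAt β α x = wedgeAt α α x * wedgeAt β β x) :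
    ∃ β' : (x : M) → TangentSpace (𝓡 3) x →L[ℝ] ℝ, IsSmoothForm β' ∧ SegmentContact α β' ∧
      ∀ x v, covectorAt β' x v = 0 ↔ covectorAt β x v = 0 := by
  have hne : ∀ x, wedgeAt α β x * wedgeAt β α x ≠ 0 := fun x => by
    rw [hpar]; exact mul_ne_zero (h0 x) (h1 x)
  have hc := continuous_wedgeAt_div hβ hα hα h0
  set S : Set M := {x | 0 < wedgeAt β α x / wedgeAt α α x} with hS
  have hSo : IsOpen S := isOpen_lt continuous_const hc
  have hSc : IsClosed S := by
    have : S = {x | 0 ≤ wedgeAt β α x / wedgeAt α α x} := by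
      ext z
      exact ⟨fun h => le_of_lt (α := ℝ) h, fun h => lt_of_le_of_ne h
        (div_ne_zero (right_ne_zero_of_mul (hne z)) (h0 z)).symm⟩
    rw [this]
    exact isClosed_le continuous_const hc
  -- A locally constant sign, +1 where β ∧ dα agrees in sign with α ∧ dα and -1 elsewhere; being
  -- locally constant it passes through d.
  set ε : M → ℝ := fun x => 2 * indicator S (fun _ => (1 : ℝ)) x - 1 with hε
  have hεs : ContMDiff (𝓡 3) 𝓘(ℝ, ℝ) ∞ ε :=
    (contMDiff_const.mul (contMDiff_indicator_of_isClopen ⟨hSc, hSo⟩)).sub contMDiff_const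
  have hεin : ∀ x ∈ S, ε x = 1 := fun x hx => by
    simp only [hε, indicator_of_mem hx]; norm_num
  have hεout : ∀ x ∉ S, ε x = -1 := fun x hx => by
    simp only [hε, indicator_of_notMem hx]; norm_num
  have hε2 : ∀ x, ε x * ε x = 1 := fun x => by
    by_cases hx : x ∈ S
    · rw [hεin x hx]; norm_num
    · rw [hεout x hx]; norm_num
  have hε0 : ∀ x, ε x ≠ 0 := fun x h => by simpa [h] using hε2 x
  have hεloc : ∀ x, ∀ᶠ z in 𝓝 x, ε z = ε x := fun x => by
    by_cases hx : x ∈ S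
    · filter_upwards [hSo.mem_nhds hx] with z hz
      rw [hεin x hx, hεin z hz]
    · filter_upwards [hSc.isOpen_compl.mem_nhds hx] with z hz
      rw [hεout x hx, hεout z hz]
  set β' : (x : M) → TangentSpace (𝓡 3) x →L[ℝ] ℝ := fun x => ε x • β x with hβ'
  have hβ's : IsSmoothForm β' := hβ.smul hεs
  have hleft : ∀ (γ : (x : M) → TangentSpace (𝓡 3) x →L[ℝ] ℝ) x,
      wedgeAt β' γ x = ε x * wedgeAt β γ x := fun γ x => rfl
  have hright : ∀ (γ : (x : M) → TangentSpace (𝓡 3) x →L[ℝ] ℝ) x,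
      wedgeAt γ β' x = ε x * wedgeAt γ β x := fun γ x => by
    have h2 : twoFormAt β' x = ε x • twoFormAt β x :=
      twoFormAt_eq_smul ((hεloc x).mono fun z hz => by simp only [hβ', hz])
    rw [wedgeAt, h2, twoFormVec_smul, map_smul]
    rfl
  have h10 : ∀ x, 0 < wedgeAt β' α x / wedgeAt α α x := fun x => by
    rw [hleft, mul_div_assoc]
    by_cases hx : x ∈ S
    · rw [hεin x hx, one_mul]; exact hx
    · rw [hεout x hx, neg_one_mul, Left.neg_pos_iff]
      exact lt_of_le_of_ne (not_lt.1 hx) (div_ne_zero (right_ne_zero_of_mul (hne x)) (h0 x))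
  -- This is where Stokes enters: the parallel Reeb fields alone do not fix the sign of the other
  -- mixed product.
  have h01 := wedgeAt_div_pos hα hβ's h0 h10 fun x => by
    rw [hright]; exact mul_ne_zero (hε0 x) (left_ne_zero_of_mul (hne x))
  have h11 : ∀ x, 0 < wedgeAt β' β' x / wedgeAt α α x := fun x => by
    have h2 : wedgeAt β' β' x / wedgeAt α α x =
        wedgeAt α β' x / wedgeAt α α x * (wedgeAt β' α x / wedgeAt α α x) := by
      have := h0 x
      rw [hleft, hright, hright, hleft]
      field_simp
      linear_combination -(ε x ^ 2) * hpar x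
    rw [h2]
    exact mul_pos (h01 x) (h10 x)
  refine ⟨β', hβ's, segmentContact_of_pos hα hβ's h0 h01 h10 h11, fun x v => ?_⟩
  change ε x * covectorAt β x v = 0 ↔ _
  simp [hε0 x]

end Main

end

theorem lemma4p3 {M : Type*} [TopologicalSpace M]
    [ChartedSpace (EuclideanSpace ℝ (Fin 3)) M] [IsManifold (𝓡 3) ∞ M]
    [T2Space M] [CompactSpace M]
    {B : Type*} [TopologicalSpace B] (π : M → B) (hπ : IsSeifertFibering π)
    (ξ ξ' : (x : M) → Submodule ℝ (TangentSpace (𝓡 3) x))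
    (hξ : IsContactStructure ξ) (hξ' : IsContactStructure ξ')
    (hξt : IsTransverseToFibers π ξ) (hξt' : IsTransverseToFibers π ξ')
    (hξi : IsS1Invariant π ξ) (hξi' : IsS1Invariant π ξ') :
    AreIsotopic ξ ξ' := by
  obtain ⟨α, R, hα, hαξ, hR, hRγ, -⟩ := hξi
  obtain ⟨β, R', hβ, hβξ, hR', hRγ', -⟩ := hξi'
  have hparallel : ∀ x, ∃ r : ℝ, (R' x : Space3) = r • (R x : Space3) := by
    intro x
    -- Each x lies on the core of the solid torus around its own fiber, so the tangent computation
    -- is only needed at z = 0.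
    obtain ⟨m, k, q, hq⟩ := hπ.locally_fibered (π x)
    obtain ⟨s₀, hs₀⟩ := hq.exists_center_eq
    obtain ⟨γ, hγ, hγ0, hγr⟩ := hRγ x
    obtain ⟨γ', hγ', hγ0', hγr'⟩ := hRγ' x
    have hd := hγ 0
    have hd' := hγ' 0
    rw [hγ0] at hd
    rw [hγ0'] at hd'
    let V : Space3 := mfderiv 𝓘(ℝ, ℝ × ℂ) (𝓡 3) q (s₀, 0) ((1, 0) : ℝ × ℂ)
    obtain ⟨r, hr⟩ : ∃ r : ℝ, (R x : Space3) = r • V := hq.exists_smul_eq hs₀ hd hγ0 fun t => by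
      have : γ t ∈ π ⁻¹' {π x} := hγr ▸ Set.mem_range_self t
      exact this
    obtain ⟨r', hr'⟩ : ∃ r : ℝ, (R' x : Space3) = r • V := hq.exists_smul_eq hs₀ hd' hγ0' fun t => by
      have : γ' t ∈ π ⁻¹' {π x} := hγr' ▸ Set.mem_range_self t
      exact this
    have hr0 : r ≠ 0 := by
      rintro rfl
      have h1 : covectorAt α x (R x) = 1 := hR.apply_eq_one x
      rw [hr, zero_smul, map_zero] at h1
      exact zero_ne_one h1
    have hV : r' • V = (r' / r) • r • V := by rw [smul_smul, div_mul_cancel₀ _ hr0]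
    exact ⟨r' / r, by rw [hr, hr']; exact hV⟩
  obtain ⟨β', hβ', hseg, hker⟩ := exists_segmentContact hα.isSmoothForm hβ.isSmoothForm
    (fun x => wedgeAt_ne_zero (hα.wedge_ne_zero x (Set.mem_univ x)))
    (fun x => wedgeAt_ne_zero (hβ.wedge_ne_zero x (Set.mem_univ x)))
    fun x => by
      obtain ⟨r, hr⟩ := hparallel x
      exact wedgeAt_mul_of_parallel (hR.apply_eq_one x) (hR.d_eq_zero x) (hR'.apply_eq_one x)
        (hR'.d_eq_zero x) hr
  obtain ⟨Φ, hΦ, hΦ0, hΦ1⟩ := exists_isotopy_of_segmentContact hα.isSmoothForm hβ' hseg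
  refine ⟨Φ, hΦ, hΦ0, fun x => ?_⟩
  have hmem : ∀ v : TangentSpace (𝓡 3) x,
      v ∈ ξ x ↔ mfderiv (𝓡 3) (𝓡 3) (Φ 1) x v ∈ ξ' (Φ 1 x) := fun v =>
    (hαξ x v).trans ((hΦ1 x v).trans ((hker _ _).trans (hβξ _ _).symm))
  ext w
  rw [Submodule.mem_map]
  constructor
  · rintro ⟨v, hv, rfl⟩
    exact (hmem v).1 hv
  · intro hw
    -- The equivalence `hmem` only controls vectors in the image; the derivative of a diffeomorphism
    -- is onto.
    obtain ⟨v, rfl⟩ := ((Φ 1).mfderivToContinuousLinearEquiv (by simp) x).surjective w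
    exact ⟨v, (hmem v).2 hw, rfl⟩
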